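/- Let $n\ge 3$, let $\mathcal S^{n\times n}$ be the space of real symmetric $n\times n$ matrices, $\mathcal S^{n\times n}_+\subset\mathcal S^{n\times n}$ the positive definite ones, $O(n)$ the group of real orthogonal $n\times n$ matrices, and $I$ the identity matrix. For a positive function $u$ of class $C^2$ on $\mathbb R^n$ put $$A^u:=-\frac{2}{n-2}u^{-\frac{n+2}{n-2}}\nabla^2u+\frac{2n}{(n-2)^2}u^{-\frac{2n}{n-2}}\nabla u\otimes\nabla u-\frac{2}{(n-2)^2}u^{-\frac{2n}{n-2}}|\nabla u|^2I .$$ Let $U\subset\mathcal S^{n\times n}$ be open and such that $O^{-1}UO=U$ for all $O\in O(n)$, and such that $U\cap\{M+tN : 0<t<\infty\}$ is convex for all $M\in\mathcal S^{n\times n}$ and $N\in\mathcal S^{n\times n}_+$. Let $F\in C^2(U)$ be real-valued and satisfy, for all $M\in U$, $F(O^{-1}MO)=F(M)$ for every $O\in O(n)$, and $(F_{ij}(M))>0$ (positive definite), where $F_{ij}=\partial F/\partial M_{ij}$, i.e. $(F_{ij}(M))$ is the symmetric matrix with $dF_M(N)=\sum_{i,j}F_{ij}(M)N_{ij}$ for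 all $N\in\mathcal S^{n\times n}$. Let $-\infty<p\le\frac{n+2}{n-2}$ and let $u\in C^2(\mathbb R^n)$ be positive and superharmonic ($\Delta u\le 0$ on $\mathbb R^n$), with $$A^u\in U\quad\text{and}\quad F(A^u)=u^{\,p-\frac{n+2}{n-2}}\qquad\text{everywhere on }\mathbb R^n .$$ Then either $u$ is constant, or $p=\frac{n+2}{n-2}$ and there are $\bar x\in\mathbb R^n$ and constants $a,b>0$ with $2b^2a^{-2}I\in U$ and $F(2b^2a^{-2}I)=1$ such that $$u(x)=\left(\frac{a}{1+b^2|x-\bar x|^2}\right)^{\frac{n-2}{2}}\qquad\text{for all }x\in\mathbb R^n .$$ -/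

import Mathlib

open scoped Matrix Matrix.Norms.Elementwise

noncomputable section

/-- The real vector space of real symmetric `n × n` matrices (its norm, the elementwise one, is
only used for its topology and for differentiability, which do not depend on the choice). -/
def SymMat (n : ℕ) : Submodule ℝ (Matrix (Fin n) (Fin n) ℝ) where
  carrier := {M | M.IsSymm}
  add_mem' := fun hA hB => Matrix.IsSymm.add hA hB
  zero_mem' := Matrix.isSymm_zero
  smul_mem' := fun c _ hA => Matrix.IsSymm.smul hA c

namespace SymMat

/-- The identity matrix as a symmetric matrix. -/
def id (n : ℕ) : SymMat n := ⟨1, Matrix.isSymm_one⟩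

/-- The conjugate `O⁻¹ M O` of a symmetric matrix `M` by an orthogonal matrix `O`. -/
def conj {n : ℕ} (O : Matrix.orthogonalGroup (Fin n) ℝ) (M : SymMat n) : SymMat n :=
  ⟨((O⁻¹ : Matrix.orthogonalGroup (Fin n) ℝ) : Matrix (Fin n) (Fin n) ℝ)
      * (M : Matrix (Fin n) (Fin n) ℝ) * (O : Matrix (Fin n) (Fin n) ℝ), by
    have hM : (M : Matrix (Fin n) (Fin n) ℝ)ᵀ = M := M.2
    change (_ * _ * _)ᵀ = _
    have hO : ((O⁻¹ : Matrix.orthogonalGroup (Fin n) ℝ) : Matrix (Fin n) (Fin n) ℝ)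
        = (O : Matrix (Fin n) (Fin n) ℝ)ᵀ := rfl
    rw [hO, Matrix.transpose_mul, Matrix.transpose_mul, hM, Matrix.transpose_transpose,
      Matrix.mul_assoc]⟩

/-- The symmetric matrix `(E_ij + E_ji) / 2`, where `E_ij` is the matrix unit. -/
def unit {n : ℕ} (i j : Fin n) : SymMat n :=
  ⟨(1 / 2 : ℝ) • (Matrix.single i j (1 : ℝ) + Matrix.single j i 1), by
    change (_ : Matrix (Fin n) (Fin n) ℝ)ᵀ = _
    rw [Matrix.transpose_smul, Matrix.transpose_add, Matrix.transpose_single,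
      Matrix.transpose_single, add_comm]⟩

/-- The matrix `(F_ij(M))`, `F_ij = ∂F/∂M_ij`, of a function of a symmetric matrix: the symmetric
matrix with `dF(M)(N) = ∑ i j, F_ij(M) N_ij` for all symmetric `N`. -/
def grad {n : ℕ} (F : SymMat n → ℝ) (M : SymMat n) : Matrix (Fin n) (Fin n) ℝ :=
  Matrix.of fun i j => fderiv ℝ F M (unit i j)

theorem sum_unit {n : ℕ} (N : SymMat n) :
    ∑ i, ∑ j, (N : Matrix (Fin n) (Fin n) ℝ) i j • unit i j = N := by
  have hN : (N : Matrix (Fin n) (Fin n) ℝ)ᵀ = N := N.2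
  have h1 : ∑ i, ∑ j, Matrix.single i j ((N : Matrix (Fin n) (Fin n) ℝ) i j) = N :=
    (Matrix.matrix_eq_sum_single _).symm
  have h2 : ∑ i, ∑ j, Matrix.single j i ((N : Matrix (Fin n) (Fin n) ℝ) i j) = N := by
    have := congrArg Matrix.transpose h1
    simpa [Matrix.transpose_sum, hN] using this
  apply Subtype.ext
  have h3 : ((∑ i, ∑ j, (N : Matrix (Fin n) (Fin n) ℝ) i j • unit i j : SymMat n) :
      Matrix (Fin n) (Fin n) ℝ)
      = (1 / 2 : ℝ) • (∑ i, ∑ j, Matrix.single i j ((N : Matrix (Fin n) (Fin n) ℝ) i j)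
        + ∑ i, ∑ j, Matrix.single j i ((N : Matrix (Fin n) (Fin n) ℝ) i j)) := by
    simp only [Submodule.coe_sum, Submodule.coe_smul, unit, ← Finset.sum_add_distrib,
      Finset.smul_sum]
    refine Finset.sum_congr rfl fun i _ => Finset.sum_congr rfl fun j _ => ?_
    rw [smul_comm]
    simp [smul_add, Matrix.smul_single]
  rw [h3, h1, h2, ← two_smul ℝ, smul_smul]
  norm_num

/-- `grad F M` represents the derivative of `F` at `M`. -/
theorem fderiv_apply_eq_sum_grad {n : ℕ} (F : SymMat n → ℝ) (M N : SymMat n) :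
    fderiv ℝ F M N = ∑ i, ∑ j, grad F M i j * (N : Matrix (Fin n) (Fin n) ℝ) i j := by
  conv_lhs => rw [← sum_unit N]
  simp [grad, map_sum, mul_comm]

end SymMat

/-- The Hessian matrix of `u` at `x`: its entry `(i, j)` is `∂_i ∂_j u (x)`. -/
def hessianMatrix {n : ℕ} (u : EuclideanSpace ℝ (Fin n) → ℝ) (x : EuclideanSpace ℝ (Fin n)) :
    Matrix (Fin n) (Fin n) ℝ :=
  Matrix.of fun i j =>
    fderiv ℝ (fderiv ℝ u) x (EuclideanSpace.single i 1) (EuclideanSpace.single j 1)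

/-- The entries of the conformal Hessian `A^u` at `x`:
`-2/(n-2) u^{-(n+2)/(n-2)} ∇²u + 2n/(n-2)² u^{-2n/(n-2)} ∇u ⊗ ∇u
  - 2/(n-2)² u^{-2n/(n-2)} |∇u|² I`. -/
def conformalHessianMatrix {n : ℕ} (u : EuclideanSpace ℝ (Fin n) → ℝ)
    (x : EuclideanSpace ℝ (Fin n)) : Matrix (Fin n) (Fin n) ℝ :=
  (-(2 / ((n : ℝ) - 2)) * u x ^ (-(((n : ℝ) + 2) / ((n : ℝ) - 2)))) • hessianMatrix u x
    + (2 * (n : ℝ) / ((n : ℝ) - 2) ^ 2 * u x ^ (-(2 * (n : ℝ) / ((n : ℝ) - 2)))) •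
        Matrix.vecMulVec (fun i => gradient u x i) (fun i => gradient u x i)
    - (2 / ((n : ℝ) - 2) ^ 2 * u x ^ (-(2 * (n : ℝ) / ((n : ℝ) - 2))) * ‖gradient u x‖ ^ 2) •
        (1 : Matrix (Fin n) (Fin n) ℝ)

theorem conformalHessianMatrix_isSymm {n : ℕ} {u : EuclideanSpace ℝ (Fin n) → ℝ}
    {x : EuclideanSpace ℝ (Fin n)} (hu : ContDiffAt ℝ 2 u x) :
    (conformalHessianMatrix u x).IsSymm := by
  have h : IsSymmSndFDerivAt ℝ u x := hu.isSymmSndFDerivAt (by simp)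
  have hH : (hessianMatrix u x).IsSymm := by
    ext i j
    exact h _ _
  have hG : (Matrix.vecMulVec (fun i => gradient u x i) (fun i => gradient u x i)).IsSymm := by
    ext i j
    simp [Matrix.vecMulVec_apply, mul_comm]
  exact ((hH.smul _).add (hG.smul _)).sub (Matrix.isSymm_one.smul _)

/-- The conformal Hessian `A^u` at a point where `u` is `C²`, as a symmetric matrix. -/
def conformalHessian {n : ℕ} (u : EuclideanSpace ℝ (Fin n) → ℝ) (x : EuclideanSpace ℝ (Fin n))
    (hu : ContDiffAt ℝ 2 u x) : SymMat n :=
  ⟨conformalHessianMatrix u x, conformalHessianMatrix_isSymm hu⟩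

end

open Filter Topology

/-! ### Second-derivative calculus. -/

section SecondDerivative

variable {E : Type*} [NormedAddCommGroup E] [NormedSpace ℝ E]

/-! The proof is the method of moving spheres. With `v = u ^ (-2/(n-2))` the matrix `A^u` becomes `v
D²v - ½|Dv|² I`, and the equation becomes `F(A[v]) = v ^ q` with `q ≥ 0` and `q = 0` exactly at the
critical exponent. The inversion of radius `√L` turns `v` into `v_L(y) = |y|²/L · v(L y/|y|²)`, and
`A[v_L]` at `y` is `A[v]` at the inverted point conjugated by a reflection (`confJet_kelvin`). Hence
`F(A[v_L]) - v_L ^ q ≤ 0 = F(A[v]) - v ^ q` outside the sphere, which is the sign needed to compare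
`v_L` with `v`.

`F` can be linearized only where a segment of jets stays in its domain. At a first-order contact of
`v_L` from above with `v`, the two matrices differ by a positive semidefinite one, so convexity of
`U` in positive directions supplies the segment. Compactness then gives uniform ellipticity nearby,
and Hopf's lemma excludes flat contacts (`no_flat_contact`). Both the strong maximum principle
outside the sphere and the strict radial derivative on it follow.

Superharmonicity gives `u ≥ c|y|^(2-n)` at infinity, hence quadratic growth of `v`, and the spheres
about any centre `x` can start. By Hopf and compactness they can stop only because of infinity: at
the stopping `L`, `limsup v/|y|²` equals `v(x)/L` (`moving_spheres`). If they never stop about any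
centre, large spheres force `v` to be constant. If they stop about one centre, they stop about all,
with one common value `β = v(x)/L`. Then `v ≤ v_L` yields `v(y) ≤ β|y|² + ⟨∇v(x) - 2βx, y⟩ + o(|y|)`
for every `x`.

Two different vectors `∇v(x) - 2βx` would push `limsup v/|y|²` strictly below `β`: after inversion,
a positive superharmonic function on a punctured ball lies above a boundary function with a ridge,
and a harmonic quadratic polynomial lifts it at the origin (`exists_gap_of_two_upper_bounds`). So
`∇v(x) - 2βx` is constant and `v` is a quadratic `d + β|x - z|²`. Its `A[v]` is a constant matrix,
so `v ^ q` is constant; as `v` is not, `q = 0`. -/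

theorem fderiv_fderiv_eq_of_eventually {F : Type*} [NormedAddCommGroup F] [NormedSpace ℝ F]
    {f : E → F} {f' : E → E →L[ℝ] F} {x : E} {B : E →L[ℝ] E →L[ℝ] F}
    (h : ∀ᶠ y in 𝓝 x, HasFDerivAt f (f' y) y) (hB : HasFDerivAt f' B x) :
    fderiv ℝ (fderiv ℝ f) x = B := by
  have h1 : fderiv ℝ f =ᶠ[𝓝 x] f' := h.mono fun y hy => hy.fderiv
  rw [h1.fderiv_eq, hB.fderiv]

theorem ContDiffAt.eventually_hasFDerivAt_fderiv {F : Type*} [NormedAddCommGroup F]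
    [NormedSpace ℝ F] {f : E → F} {x : E} (hf : ContDiffAt ℝ 2 f x) :
    ∀ᶠ y in 𝓝 x, HasFDerivAt f (fderiv ℝ f y) y := by
  have h : ∀ᶠ y in 𝓝 x, ContDiffAt ℝ 2 f y := hf.eventually (by simp)
  exact h.mono fun y hy => (hy.differentiableAt (by norm_num)).hasFDerivAt

theorem ContDiffAt.hasFDerivAt_fderiv {F : Type*} [NormedAddCommGroup F]
    [NormedSpace ℝ F] {f : E → F} {x : E} (hf : ContDiffAt ℝ 2 f x) :
    HasFDerivAt (fderiv ℝ f) (fderiv ℝ (fderiv ℝ f) x) x :=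
  ((hf.fderiv_right (m := 1) (by norm_num)).differentiableAt (by norm_num)).hasFDerivAt

theorem fderiv_comp_real {f : E → ℝ} {x : E} (hf : ContDiffAt ℝ 2 f x) {g g' : ℝ → ℝ} {g'' : ℝ}
    (hg : ∀ᶠ t in 𝓝 (f x), HasDerivAt g (g' t) t) (hg' : HasDerivAt g' g'' (f x)) :
    (∀ e, fderiv ℝ (fun y => g (f y)) x e = g' (f x) * fderiv ℝ f x e) ∧
    ∀ e e', fderiv ℝ (fderiv ℝ (fun y => g (f y))) x e e' =
      g'' * fderiv ℝ f x e * fderiv ℝ f x e' + g' (f x) * fderiv ℝ (fderiv ℝ f) x e e' := by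
  have h1 : ∀ᶠ y in 𝓝 x, HasFDerivAt (fun y => g (f y)) (g' (f y) • fderiv ℝ f y) y := by
    filter_upwards [hf.continuousAt.eventually hg, hf.eventually_hasFDerivAt_fderiv] with y hy hy'
    exact hy.comp_hasFDerivAt y hy'
  refine ⟨fun e => ?_, fun e e' => ?_⟩
  · rw [h1.self_of_nhds.fderiv]; simp
  · have h2 : HasFDerivAt (fun y => g' (f y)) (g'' • fderiv ℝ f x) x :=
      hg'.comp_hasFDerivAt x hf.eventually_hasFDerivAt_fderiv.self_of_nhds
    rw [fderiv_fderiv_eq_of_eventually h1 (h2.smul hf.hasFDerivAt_fderiv)]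
    simp
    ring

/-- If `c < 0`, then `g - (c/4) t²` still has negative second derivative, so a local maximum at `0`,
and `g` drops below `g 0` on the right. The minimum is one-sided because contact may occur on the
boundary of the region of comparison. -/
theorem secondDeriv_nonneg_of_right_min {g g' : ℝ → ℝ} {c : ℝ}
    (hg : ∀ᶠ t in 𝓝 0, HasDerivAt g (g' t) t) (hg' : HasDerivAt g' c 0) (h0 : g' 0 = 0)
    (hmin : ∀ᶠ t in 𝓝[>] (0 : ℝ), g 0 ≤ g t) : 0 ≤ c := by
  by_contra! hc
  set G : ℝ → ℝ := fun t => g t - c / 4 * t ^ 2 with hG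
  have hGd : ∀ᶠ t in 𝓝 0, HasDerivAt G (g' t - c / 2 * t) t := by
    filter_upwards [hg] with t ht
    refine (ht.sub (((hasDerivAt_id t).pow 2).const_mul (c / 4))).congr_deriv ?_
    simp; ring
  have e1 : deriv G =ᶠ[𝓝 0] fun t => g' t - c / 2 * t := hGd.mono fun t ht => ht.deriv
  have e2 : HasDerivAt (fun t => g' t - c / 2 * t) (c / 2) 0 := by
    refine (hg'.sub ((hasDerivAt_id (0:ℝ)).const_mul (c / 2))).congr_deriv ?_
    ring
  have hmax : IsLocalMax G 0 := by
    apply isLocalMax_of_deriv_deriv_neg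
    · rw [e1.deriv_eq, e2.deriv]; linarith
    · rw [e1.eq_of_nhds, h0]; simp
    · exact hGd.self_of_nhds.continuousAt
  have hmax' : ∀ᶠ t in 𝓝[>] (0 : ℝ), G t ≤ G 0 := nhdsWithin_le_nhds hmax
  obtain ⟨t, ht1, ht2, ht3⟩ := (hmin.and (hmax'.and self_mem_nhdsWithin)).exists
  have ht3' : (0:ℝ) < t := ht3
  simp only [hG] at ht2
  have : c / 4 * t ^ 2 < 0 := mul_neg_of_neg_of_pos (by linarith) (by positivity)
  nlinarith

theorem fderiv_fderiv_nonneg_of_ray_min {f : E → ℝ} {x e : E} (hf : ContDiffAt ℝ 2 f x)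
    (h0 : fderiv ℝ f x e = 0) (hmin : ∀ᶠ t in 𝓝[>] (0 : ℝ), f x ≤ f (x + t • e)) :
    0 ≤ fderiv ℝ (fderiv ℝ f) x e e := by
  have hl : ∀ t : ℝ, HasDerivAt (fun t : ℝ => x + t • e) e t := fun t => by
    simpa using ((hasDerivAt_id t).smul_const e).const_add x
  have hc : Tendsto (fun t : ℝ => x + t • e) (𝓝 0) (𝓝 x) := by
    simpa using (hl 0).continuousAt.tendsto
  refine secondDeriv_nonneg_of_right_min (g := fun t => f (x + t • e))
    (g' := fun t => fderiv ℝ f (x + t • e) e) ?_ ?_ ?_ ?_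
  · filter_upwards [hc.eventually hf.eventually_hasFDerivAt_fderiv] with t ht
    exact ht.comp_hasDerivAt t (hl t)
  · have h2 := hf.hasFDerivAt_fderiv
    have : HasDerivAt (fun t : ℝ => fderiv ℝ f (x + t • e)) (fderiv ℝ (fderiv ℝ f) x e) 0 := by
      refine HasFDerivAt.comp_hasDerivAt (f := fun t : ℝ => x + t • e) (0:ℝ) ?_ (hl 0)
      simpa using h2
    exact ((ContinuousLinearMap.apply ℝ ℝ e).hasFDerivAt.comp_hasDerivAt (0:ℝ) this)
  · simpa using h0
  · simpa using hmin

theorem fderiv_fderiv_sub {f g : E → ℝ} {x : E} (hf : ContDiffAt ℝ 2 f x)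
    (hg : ContDiffAt ℝ 2 g x) :
    fderiv ℝ (fderiv ℝ (fun y => f y - g y)) x =
      fderiv ℝ (fderiv ℝ f) x - fderiv ℝ (fderiv ℝ g) x := by
  refine fderiv_fderiv_eq_of_eventually (f' := fun y => fderiv ℝ f y - fderiv ℝ g y) ?_
    (hf.hasFDerivAt_fderiv.sub hg.hasFDerivAt_fderiv)
  filter_upwards [hf.eventually_hasFDerivAt_fderiv, hg.eventually_hasFDerivAt_fderiv] with y h1 h2
  exact h1.sub h2

theorem fderiv_fderiv_add {f g : E → ℝ} {x : E} (hf : ContDiffAt ℝ 2 f x)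
    (hg : ContDiffAt ℝ 2 g x) :
    fderiv ℝ (fderiv ℝ (fun y => f y + g y)) x =
      fderiv ℝ (fderiv ℝ f) x + fderiv ℝ (fderiv ℝ g) x := by
  refine fderiv_fderiv_eq_of_eventually (f' := fun y => fderiv ℝ f y + fderiv ℝ g y) ?_
    (hf.hasFDerivAt_fderiv.add hg.hasFDerivAt_fderiv)
  filter_upwards [hf.eventually_hasFDerivAt_fderiv, hg.eventually_hasFDerivAt_fderiv] with y h1 h2
  exact h1.add h2

theorem fderiv_fderiv_const_mul {f : E → ℝ} {x : E} (c : ℝ) (hf : ContDiffAt ℝ 2 f x) :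
    fderiv ℝ (fderiv ℝ (fun y => c * f y)) x = c • fderiv ℝ (fderiv ℝ f) x := by
  refine fderiv_fderiv_eq_of_eventually (f' := fun y => c • fderiv ℝ f y) ?_
    (hf.hasFDerivAt_fderiv.const_smul c)
  filter_upwards [hf.eventually_hasFDerivAt_fderiv] with y h1
  exact h1.const_mul c

theorem fderiv_fderiv_clm (ℓ : E →L[ℝ] ℝ) (x : E) :
    fderiv ℝ (fderiv ℝ (fun y => ℓ y)) x = 0 := by
  refine fderiv_fderiv_eq_of_eventually (f' := fun _ => ℓ) ?_ (hasFDerivAt_const _ _)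
  exact Eventually.of_forall fun y => ℓ.hasFDerivAt

theorem fderiv_fderiv_const_add (c : ℝ) (f : E → ℝ) (x : E) :
    fderiv ℝ (fderiv ℝ (fun y => c + f y)) x = fderiv ℝ (fderiv ℝ f) x := by
  congr 1
  ext y : 1
  exact fderiv_const_add c

theorem fderiv_comp_const_add (f : E → ℝ) (a x : E) :
    fderiv ℝ (fun y => f (a + y)) x = fderiv ℝ f (a + x) :=
  fderiv_comp_add_left a

theorem fderiv_fderiv_comp_const_add (f : E → ℝ) (a x : E) :
    fderiv ℝ (fderiv ℝ (fun y => f (a + y))) x = fderiv ℝ (fderiv ℝ f) (a + x) := by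
  have : fderiv ℝ (fun y => f (a + y)) = fun y => fderiv ℝ f (a + y) := by
    ext y : 1; exact fderiv_comp_const_add f a y
  rw [this]
  exact fderiv_comp_add_left a

end SecondDerivative

/-! ### Derivatives of functions of the distance to a point. -/

section Radial

variable {E : Type*} [NormedAddCommGroup E] [InnerProductSpace ℝ E]

theorem contDiffAt_norm_sub_sq (z x : E) : ContDiffAt ℝ 2 (fun y => ‖y - z‖ ^ 2) x :=
  (contDiffAt_id.sub contDiffAt_const).norm_sq ℝ

theorem fderiv_norm_sub_sq (z x : E) :
    (∀ e, fderiv ℝ (fun y => ‖y - z‖ ^ 2) x e = 2 * inner ℝ (x - z) e) ∧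
    ∀ e e', fderiv ℝ (fderiv ℝ (fun y => ‖y - z‖ ^ 2)) x e e' = 2 * inner ℝ e e' := by
  have h1 : ∀ y, HasFDerivAt (fun y => ‖y - z‖ ^ 2) (2 • innerSL ℝ (y - z)) y := fun y => by
    have := ((hasFDerivAt_id y).sub_const z).norm_sq
    simpa using this
  have h2 : HasFDerivAt (fun y => 2 • innerSL ℝ (y - z)) (2 • innerSL ℝ (E := E)) x := by
    have := ((innerSL ℝ (E := E)).hasFDerivAt (x := x - z)).comp x ((hasFDerivAt_id x).sub_const z)
    exact this.const_smul (2 : ℕ)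
  refine ⟨fun e => ?_, fun e e' => ?_⟩
  · rw [(h1 x).fderiv]; simp [inner_sub_left]
  · rw [fderiv_fderiv_eq_of_eventually (Eventually.of_forall h1) h2]; simp; rfl

theorem fderiv_radial (z x : E) {g g' : ℝ → ℝ} {g'' : ℝ}
    (hg : ∀ᶠ t in 𝓝 (‖x - z‖ ^ 2), HasDerivAt g (g' t) t) (hg' : HasDerivAt g' g'' (‖x - z‖ ^ 2)) :
    (∀ e, fderiv ℝ (fun y => g (‖y - z‖ ^ 2)) x e = g' (‖x - z‖ ^ 2) * (2 * inner ℝ (x - z) e)) ∧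
    ∀ e e', fderiv ℝ (fderiv ℝ (fun y => g (‖y - z‖ ^ 2))) x e e' =
      g'' * (2 * inner ℝ (x - z) e) * (2 * inner ℝ (x - z) e')
        + g' (‖x - z‖ ^ 2) * (2 * inner ℝ e e') := by
  have h := fderiv_comp_real (contDiffAt_norm_sub_sq z x) hg hg'
  simp only [(fderiv_norm_sub_sq z x).1, (fderiv_norm_sub_sq z x).2] at h
  exact h

end Radial

/-! ### The conformal Hessian as a function of the 2-jet of `v`. -/

section ConformalJet

/-- The symmetric matrix of a bilinear form on `ℝⁿ` (symmetrized). -/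
noncomputable def bilinMat (n : ℕ) :
    (EuclideanSpace ℝ (Fin n) →L[ℝ] EuclideanSpace ℝ (Fin n) →L[ℝ] ℝ) →ₗ[ℝ] SymMat n where
  toFun B := ⟨Matrix.of fun i j =>
    (B (EuclideanSpace.single i 1) (EuclideanSpace.single j 1)
      + B (EuclideanSpace.single j 1) (EuclideanSpace.single i 1)) / 2, by
    change (_ : Matrix (Fin n) (Fin n) ℝ)ᵀ = _
    ext i j
    simp [add_comm]⟩
  map_add' B C := by
    apply Subtype.ext
    ext i j
    simp
    ring
  map_smul' c B := by
    apply Subtype.ext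
    ext i j
    simp
    ring

theorem bilinMat_apply {n : ℕ}
    (B : EuclideanSpace ℝ (Fin n) →L[ℝ] EuclideanSpace ℝ (Fin n) →L[ℝ] ℝ) (i j : Fin n) :
    (bilinMat n B : Matrix (Fin n) (Fin n) ℝ) i j =
      (B (EuclideanSpace.single i 1) (EuclideanSpace.single j 1)
      + B (EuclideanSpace.single j 1) (EuclideanSpace.single i 1)) / 2 := rfl

/-- The space of triples (value, first derivative, second derivative). -/
def JetSpace (G H : Type*) : Type _ := ℝ × G × H

namespace Jet

section

variable {G H : Type*} [NormedAddCommGroup G] [NormedSpace ℝ G] [NormedAddCommGroup H]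
  [NormedSpace ℝ H]

noncomputable instance : NormedAddCommGroup (JetSpace G H) :=
  inferInstanceAs (NormedAddCommGroup (ℝ × G × H))

noncomputable instance : NormedSpace ℝ (JetSpace G H) :=
  inferInstanceAs (NormedSpace ℝ (ℝ × G × H))

instance [FiniteDimensional ℝ G] [FiniteDimensional ℝ H] :
    FiniteDimensional ℝ (JetSpace G H) :=
  inferInstanceAs (FiniteDimensional ℝ (ℝ × G × H))

/-- The jet with given entries. -/
def mk (s : ℝ) (ℓ : G) (B : H) : JetSpace G H := (s, ℓ, B)

/-- The value of a jet. -/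
noncomputable def val : JetSpace G H →L[ℝ] ℝ := ContinuousLinearMap.fst ℝ ℝ (G × H)

/-- The first derivative of a jet. -/
noncomputable def der : JetSpace G H →L[ℝ] G :=
  (ContinuousLinearMap.fst ℝ G H).comp (ContinuousLinearMap.snd ℝ ℝ (G × H))

/-- The second derivative of a jet. -/
noncomputable def hess : JetSpace G H →L[ℝ] H :=
  (ContinuousLinearMap.snd ℝ G H).comp (ContinuousLinearMap.snd ℝ ℝ (G × H))

@[simp] theorem val_mk (s : ℝ) (ℓ : G) (B : H) : val (mk s ℓ B) = s := rfl

@[simp] theorem der_mk (s : ℝ) (ℓ : G) (B : H) : der (mk s ℓ B) = ℓ := rfl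

@[simp] theorem hess_mk (s : ℝ) (ℓ : G) (B : H) : hess (mk s ℓ B) = B := rfl

theorem smul_mk (c s : ℝ) (ℓ : G) (B : H) : c • mk s ℓ B = mk (c * s) (c • ℓ) (c • B) := rfl

end

section

variable {G H : Type*} [NormedAddCommGroup G] [NormedAddCommGroup H]

theorem mk_add (s s' : ℝ) (ℓ ℓ' : G) (B B' : H) :
    mk s ℓ B + mk s' ℓ' B' = mk (s + s') (ℓ + ℓ') (B + B') := rfl

theorem mk_sub (s s' : ℝ) (ℓ ℓ' : G) (B B' : H) :
    mk s ℓ B - mk s' ℓ' B' = mk (s - s') (ℓ - ℓ') (B - B') := rfl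

theorem norm_mk (s : ℝ) (ℓ : G) (B : H) : ‖mk s ℓ B‖ = max ‖s‖ (max ‖ℓ‖ ‖B‖) := rfl

theorem continuousAt_mk {X : Type*} [TopologicalSpace X] {s : X → ℝ} {ℓ : X → G} {B : X → H}
    {x : X} (hs : ContinuousAt s x) (hℓ : ContinuousAt ℓ x) (hB : ContinuousAt B x) :
    ContinuousAt (fun y => mk (s y) (ℓ y) (B y)) x :=
  hs.prodMk (hℓ.prodMk hB)

end

end Jet

section

variable (n : ℕ)

noncomputable instance instNormedAddCommGroupDual :
    NormedAddCommGroup (EuclideanSpace ℝ (Fin n) →L[ℝ] ℝ) := inferInstance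

noncomputable instance instNormedSpaceDual :
    NormedSpace ℝ (EuclideanSpace ℝ (Fin n) →L[ℝ] ℝ) := inferInstance

noncomputable instance instNormedAddCommGroupBilin :
    NormedAddCommGroup (EuclideanSpace ℝ (Fin n) →L[ℝ] EuclideanSpace ℝ (Fin n) →L[ℝ] ℝ) :=
  inferInstance

noncomputable instance instNormedSpaceBilin :
    NormedSpace ℝ (EuclideanSpace ℝ (Fin n) →L[ℝ] EuclideanSpace ℝ (Fin n) →L[ℝ] ℝ) :=
  inferInstance

end

/-- The 2-jets `(v, Dv, D²v)` of real functions on `ℝⁿ`. -/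
abbrev Jet (n : ℕ) : Type :=
  JetSpace (EuclideanSpace ℝ (Fin n) →L[ℝ] ℝ)
    (EuclideanSpace ℝ (Fin n) →L[ℝ] EuclideanSpace ℝ (Fin n) →L[ℝ] ℝ)

section

variable (n : ℕ)

noncomputable instance instNormedAddCommGroupJet : NormedAddCommGroup (Jet n) := inferInstance

noncomputable instance instNormedSpaceJet : NormedSpace ℝ (Jet n) := inferInstance

noncomputable instance instModuleJet : Module ℝ (Jet n) := inferInstance

end

/-- The 2-jet of `v` at `x`. -/
noncomputable def jetAt {n : ℕ} (v : EuclideanSpace ℝ (Fin n) → ℝ)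
    (x : EuclideanSpace ℝ (Fin n)) : Jet n :=
  Jet.mk (v x) (fderiv ℝ v x) (fderiv ℝ (fderiv ℝ v) x)

/-- The conformal Hessian `v D²v - ½ |Dv|² I` as a function of the 2-jet of `v`. -/
noncomputable def confJet {n : ℕ} (J : Jet n) : SymMat n :=
  Jet.val J • bilinMat n (Jet.hess J)
    - ((1 / 2 : ℝ) * ∑ k, (Jet.der J (EuclideanSpace.single k 1)) ^ 2) • SymMat.id n

theorem confJet_apply {n : ℕ} (J : Jet n) (i j : Fin n) :
    (confJet J : Matrix (Fin n) (Fin n) ℝ) i j =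
      Jet.val J * ((Jet.hess J (EuclideanSpace.single i 1) (EuclideanSpace.single j 1)
      + Jet.hess J (EuclideanSpace.single j 1) (EuclideanSpace.single i 1)) / 2)
      - (1 / 2 : ℝ) * (∑ k, (Jet.der J (EuclideanSpace.single k 1)) ^ 2) *
        (1 : Matrix (Fin n) (Fin n) ℝ) i j := by
  simp [confJet, bilinMat_apply, SymMat.id]

theorem contDiff_confJet (n : ℕ) : ContDiff ℝ 2 (confJet (n := n)) := by
  have h : ∀ B, bilinMat n B = LinearMap.toContinuousLinearMap (bilinMat n) B := fun B => rfl
  unfold confJet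
  simp only [h]
  fun_prop

theorem trace_confJet {n : ℕ} (J : Jet n) :
    (confJet J : Matrix (Fin n) (Fin n) ℝ).trace =
      Jet.val J * ∑ i, Jet.hess J (EuclideanSpace.single i 1) (EuclideanSpace.single i 1)
      - (n : ℝ) / 2 * ∑ k, (Jet.der J (EuclideanSpace.single k 1)) ^ 2 := by
  simp only [Matrix.trace, Matrix.diag_apply, confJet_apply, Finset.sum_sub_distrib,
    Matrix.one_apply_eq, Finset.sum_const, Finset.card_univ, Fintype.card_fin, nsmul_eq_mul,
    ← Finset.mul_sum]
  congr 1
  · congr 1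
    refine Finset.sum_congr rfl fun i _ => ?_
    ring
  · ring

theorem sum_sq_apply_single {n : ℕ} (ℓ : EuclideanSpace ℝ (Fin n) →L[ℝ] ℝ)
    (g : EuclideanSpace ℝ (Fin n)) (h : ∀ e, ℓ e = inner ℝ g e) :
    ∑ k, (ℓ (EuclideanSpace.single k 1)) ^ 2 = ‖g‖ ^ 2 := by
  simp [h, EuclideanSpace.real_norm_sq_eq, EuclideanSpace.inner_single_right]

theorem laplacian_eq_sum {n : ℕ} (u : EuclideanSpace ℝ (Fin n) → ℝ)
    (x : EuclideanSpace ℝ (Fin n)) :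
    Laplacian.laplacian u x = ∑ i, fderiv ℝ (fderiv ℝ u) x
      (EuclideanSpace.single i 1) (EuclideanSpace.single i 1) := by
  rw [InnerProductSpace.laplacian_eq_iteratedFDeriv_orthonormalBasis u
    (EuclideanSpace.basisFun (Fin n) ℝ)]
  simp [iteratedFDeriv_two_apply]

variable {n : ℕ} {v : EuclideanSpace ℝ (Fin n) → ℝ} {x : EuclideanSpace ℝ (Fin n)}

theorem fderiv_rpow_neg (hv : ContDiffAt ℝ 2 v x) (hx : 0 < v x) (m : ℝ) :
    (∀ e, fderiv ℝ (fun y => v y ^ (-m)) x e = -m * v x ^ (-m - 1) * fderiv ℝ v x e) ∧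
    ∀ e e', fderiv ℝ (fderiv ℝ (fun y => v y ^ (-m))) x e e' =
      m * (m + 1) * v x ^ (-m - 2) * fderiv ℝ v x e * fderiv ℝ v x e'
        - m * v x ^ (-m - 1) * fderiv ℝ (fderiv ℝ v) x e e' := by
  have h := fderiv_comp_real hv (g := fun t => t ^ (-m)) (g' := fun t => -m * t ^ (-m - 1))
    (g'' := -m * ((-m - 1) * v x ^ (-m - 1 - 1))) ?_ ?_
  · refine ⟨h.1, fun e e' => ?_⟩
    rw [h.2, show -m - 1 - 1 = -m - 2 by ring]
    ring
  · filter_upwards [lt_mem_nhds hx] with t ht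
    exact Real.hasDerivAt_rpow_const (Or.inl ht.ne')
  · exact (Real.hasDerivAt_rpow_const (Or.inl hx.ne')).const_mul _

/-- The power `-(n-2)/2` is the one for which the `∇v ⊗ ∇v` terms from `∇²u` and from `∇u ⊗ ∇u`
cancel; all remaining powers of `v` collapse to `v` or `1`. Writing `n = 2m + 2` keeps the exponents
polynomial in `m`. -/
theorem conformalHessianMatrix_rpow (hn : 3 ≤ n) (hv : ContDiffAt ℝ 2 v x) (hx : 0 < v x) :
    conformalHessianMatrix (fun y => v y ^ (-(((n : ℝ) - 2) / 2))) x = confJet (jetAt v x) := by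
  have hn' : (3 : ℝ) ≤ n := by exact_mod_cast hn
  obtain ⟨m, hm⟩ : ∃ m : ℝ, (n : ℝ) = 2 * m + 2 := ⟨((n : ℝ) - 2) / 2, by ring⟩
  have hm0 : 0 < m := by linarith
  have hm1 : ((n : ℝ) - 2) / 2 = m := by rw [hm]; ring
  have hm2 : (n : ℝ) - 2 = 2 * m := by rw [hm]; ring
  have hsym : ∀ e e', fderiv ℝ (fderiv ℝ v) x e e' = fderiv ℝ (fderiv ℝ v) x e' e :=
    fun e e' => (hv.isSymmSndFDerivAt (by simp)) e e'
  have h := fderiv_rpow_neg hv hx m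
  have hcoord : ∀ (f : EuclideanSpace ℝ (Fin n) → ℝ) (i : Fin n),
      gradient f x i = fderiv ℝ f x (EuclideanSpace.single i 1) := fun f i => by
    rw [← inner_gradient_left, EuclideanSpace.inner_single_right]
    simp
  have hnorm : ∀ (f : EuclideanSpace ℝ (Fin n) → ℝ),
      ‖gradient f x‖ ^ 2 = ∑ k, (fderiv ℝ f x (EuclideanSpace.single k 1)) ^ 2 := fun f => by
    simp [EuclideanSpace.real_norm_sq_eq, hcoord]
  rw [hm1]
  ext i j
  have p1 : (v x ^ (-m)) ^ (-(((n : ℝ) + 2) / ((n : ℝ) - 2))) = v x ^ (m + 2) := by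
    rw [← Real.rpow_mul hx.le]; congr 1; rw [hm2, hm]; field_simp; ring
  have p2 : (v x ^ (-m)) ^ (-(2 * (n : ℝ) / ((n : ℝ) - 2))) = v x ^ (2 * m + 2) := by
    rw [← Real.rpow_mul hx.le]; congr 1; rw [hm2, hm]; field_simp
  have q1 : v x ^ (m + 2) * v x ^ (-m - 2) = 1 := by
    rw [← Real.rpow_add hx, show m + 2 + (-m - 2) = 0 by ring, Real.rpow_zero]
  have q2 : v x ^ (m + 2) * v x ^ (-m - 1) = v x := by
    rw [← Real.rpow_add hx, show m + 2 + (-m - 1) = 1 by ring, Real.rpow_one]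
  have q3 : v x ^ (2 * m + 2) * (v x ^ (-m - 1)) ^ 2 = 1 := by
    rw [← Real.rpow_natCast, ← Real.rpow_mul hx.le, ← Real.rpow_add hx,
      show 2 * m + 2 + (-m - 1) * ((2 : ℕ) : ℝ) = 0 by push_cast; ring, Real.rpow_zero]
  have c1 : 2 / ((n : ℝ) - 2) = 1 / m := by rw [hm2]; field_simp
  have c2 : 2 * (n : ℝ) / ((n : ℝ) - 2) ^ 2 = (m + 1) / m ^ 2 := by rw [hm2, hm]; field_simp
  have c3 : 2 / ((n : ℝ) - 2) ^ 2 = 1 / (2 * m ^ 2) := by rw [hm2]; field_simp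
  simp only [conformalHessianMatrix, Matrix.sub_apply, Matrix.add_apply, Matrix.smul_apply,
    smul_eq_mul, hessianMatrix, Matrix.of_apply, Matrix.vecMulVec_apply, hnorm, hcoord, h.1, h.2,
    confJet_apply, jetAt, Jet.val_mk, Jet.der_mk, Jet.hess_mk, p1, p2, c1, c2, c3,
    hsym (EuclideanSpace.single j 1)]
  simp only [mul_pow, ← Finset.mul_sum]
  set d := fderiv ℝ v x
  set H := fderiv ℝ (fderiv ℝ v) x (EuclideanSpace.single i 1) (EuclideanSpace.single j 1)
  set S := ∑ k, (d (EuclideanSpace.single k 1)) ^ 2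
  set a := v x ^ (m + 2)
  set b := v x ^ (-m - 1)
  set c := v x ^ (-m - 2)
  set f := v x ^ (2 * m + 2)
  have e1 : -(1 / m) * a * (m * (m + 1) * c * d (EuclideanSpace.single i 1) *
        d (EuclideanSpace.single j 1)
      - m * b * H) = -(m + 1) * (a * c) * d (EuclideanSpace.single i 1) *
        d (EuclideanSpace.single j 1)
      + (a * b) * H := by field_simp; ring
  have e2 : (m + 1) / m ^ 2 * f * (-m * b * d (EuclideanSpace.single i 1) *
        (-m * b * d (EuclideanSpace.single j 1)))
      = (m + 1) * (f * b ^ 2) * d (EuclideanSpace.single i 1) * d (EuclideanSpace.single j 1) := by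
    field_simp
  have e3 : 1 / (2 * m ^ 2) * f * ((-m) ^ 2 * b ^ 2 * S) = 1 / 2 * (f * b ^ 2) * S := by
    field_simp
  rw [e1, e2, e3, q1, q2, q3]
  ring

/-- Superharmonicity of `u` becomes nonnegativity of `tr A[v]`. In this form it passes to Kelvin
transforms, since conjugation preserves the trace. -/
theorem laplacian_rpow_neg (hv : ContDiffAt ℝ 2 v x) (hx : 0 < v x) :
    Laplacian.laplacian (fun y => v y ^ (-(((n : ℝ) - 2) / 2))) x =
      -(((n : ℝ) - 2) / 2) * v x ^ (-(((n : ℝ) - 2) / 2) - 2) *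
        (confJet (jetAt v x) : Matrix (Fin n) (Fin n) ℝ).trace := by
  rw [laplacian_eq_sum, trace_confJet]
  simp only [(fderiv_rpow_neg hv hx _).2, jetAt, Jet.val_mk, Jet.der_mk, Jet.hess_mk]
  set m := ((n : ℝ) - 2) / 2 with hm
  have q : v x ^ (-m - 1) = v x * v x ^ (-m - 2) := by
    rw [show -m - 1 = 1 + (-m - 2) by ring, Real.rpow_add hx, Real.rpow_one]
  rw [q, Finset.sum_sub_distrib]
  have e : (n : ℝ) / 2 = m + 1 := by rw [hm]; ring
  rw [e]
  simp only [Finset.mul_sum, mul_sub, ← Finset.sum_sub_distrib]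
  refine Finset.sum_congr rfl fun i _ => ?_
  ring

end ConformalJet

theorem hasDerivAt_line {E : Type*} [NormedAddCommGroup E] [NormedSpace ℝ E] (y e : E) (t : ℝ) :
    HasDerivAt (fun t : ℝ => y + t • e) e t := by
  simpa using ((hasDerivAt_id t).smul_const e).const_add y

/-! ### Inversions and the Kelvin transform. -/

section Kelvin

variable {E : Type*} [NormedAddCommGroup E] [InnerProductSpace ℝ E]

/-- The inversion of centre `0` in the sphere of radius `√L`. -/
noncomputable def inv0 (L : ℝ) (y : E) : E := (L / ‖y‖ ^ 2) • y

/-- The reflection in the hyperplane orthogonal to `y`. -/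
noncomputable def refl0 (y e : E) : E := e - (2 * inner ℝ y e / ‖y‖ ^ 2) • y

/-- The Kelvin transform of `v = u ^ (-2 / (n - 2))` in the sphere of radius `√L` about `0`. -/
noncomputable def kelvin (L : ℝ) (v : E → ℝ) (y : E) : ℝ := ‖y‖ ^ 2 / L * v (inv0 L y)

variable {L : ℝ} {v : E → ℝ} {y : E}

theorem contDiffAt_inv0 (hy : y ≠ 0) : ContDiffAt ℝ 2 (inv0 L) y := by
  unfold inv0
  exact (contDiffAt_const.div (contDiffAt_id.norm_sq ℝ) (by simpa using hy)).smul contDiffAt_id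

theorem contDiffAt_kelvin (hy : y ≠ 0) (hv : ContDiffAt ℝ 2 v (inv0 L y)) :
    ContDiffAt ℝ 2 (kelvin L v) y :=
  ((contDiffAt_id.norm_sq ℝ).div_const L).mul (hv.comp y (contDiffAt_inv0 hy))

theorem hasDerivAt_norm_sq_line (y e : E) :
    HasDerivAt (fun t : ℝ => ‖y + t • e‖ ^ 2) (2 * inner ℝ y e) 0 := by
  simpa using (hasDerivAt_line y e 0).norm_sq

theorem hasDerivAt_inv0_line (hy : y ≠ 0) (e : E) :
    HasDerivAt (fun t : ℝ => inv0 L (y + t • e)) ((L / ‖y‖ ^ 2) • refl0 y e) 0 := by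
  have hy2 : ‖y‖ ^ 2 ≠ 0 := by simpa using hy
  have h := (((hasDerivAt_const (0:ℝ) L).div (hasDerivAt_norm_sq_line y e)
    (by simpa using hy2))).smul (hasDerivAt_line y e 0)
  refine h.congr_deriv ?_
  simp only [zero_smul, add_zero, refl0, smul_sub, smul_smul, Pi.div_apply]
  rw [sub_eq_add_neg _ ((L / ‖y‖ ^ 2 * (2 * inner ℝ y e / ‖y‖ ^ 2)) • y), ← neg_smul]
  congr 2
  field_simp
  ring

theorem fderiv_kelvin (hy : y ≠ 0) (hL : L ≠ 0) (hv : DifferentiableAt ℝ v (inv0 L y))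
    (e : E) : fderiv ℝ (kelvin L v) y e =
      2 * inner ℝ y e / L * v (inv0 L y) + fderiv ℝ v (inv0 L y) (refl0 y e) := by
  have hy2 : ‖y‖ ^ 2 ≠ 0 := by simpa using hy
  have hd : DifferentiableAt ℝ (kelvin L v) y := by
    have h1 : DifferentiableAt ℝ (inv0 L) y := (contDiffAt_inv0 hy).differentiableAt (by norm_num)
    have h2 : DifferentiableAt ℝ (fun y : E => ‖y‖ ^ 2 / L) y := by
      have h3 : DifferentiableAt ℝ (fun y : E => ‖y‖ ^ 2) y := differentiableAt_id.norm_sq ℝ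
      simpa only [div_eq_mul_inv] using h3.mul_const L⁻¹
    exact h2.mul (hv.comp y h1)
  have h1 : HasDerivAt (fun t : ℝ => kelvin L v (y + t • e)) (fderiv ℝ (kelvin L v) y e) 0 := by
    refine HasFDerivAt.comp_hasDerivAt (l := kelvin L v) (f := fun t : ℝ => y + t • e) (0:ℝ) ?_
      (hasDerivAt_line y e 0)
    simpa using hd.hasFDerivAt
  have h2 : HasDerivAt (fun t : ℝ => v (inv0 L (y + t • e)))
      (fderiv ℝ v (inv0 L y) ((L / ‖y‖ ^ 2) • refl0 y e)) 0 := by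
    refine HasFDerivAt.comp_hasDerivAt (f := fun t : ℝ => inv0 L (y + t • e)) (0:ℝ) ?_
      (hasDerivAt_inv0_line hy e)
    simpa using hv.hasFDerivAt
  have h3 := ((hasDerivAt_norm_sq_line y e).div_const L).mul h2
  rw [h1.unique h3]
  simp
  field_simp

/-- Differentiate the first-derivative formula along `y + t e`. The terms carrying `⟨y, e'⟩` cancel,
so apart from the reflected Hessian only multiples of `⟨e, e'⟩` survive. -/
theorem fderiv_fderiv_kelvin (hy : y ≠ 0) (hL : L ≠ 0) (hv : ContDiffAt ℝ 2 v (inv0 L y))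
    (e e' : E) : fderiv ℝ (fderiv ℝ (kelvin L v)) y e e' =
      2 * inner ℝ e e' / L * v (inv0 L y) - 2 * inner ℝ e e' / ‖y‖ ^ 2 * fderiv ℝ v (inv0 L y) y
      + L / ‖y‖ ^ 2 * fderiv ℝ (fderiv ℝ v) (inv0 L y) (refl0 y e) (refl0 y e') := by
  have hy2 : ‖y‖ ^ 2 ≠ 0 := by simpa using hy
  have hk := (contDiffAt_kelvin hy hv).hasFDerivAt_fderiv
  have h1 : HasDerivAt (fun t : ℝ => fderiv ℝ (kelvin L v) (y + t • e) e')
      (fderiv ℝ (fderiv ℝ (kelvin L v)) y e e') 0 := by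
    have : HasDerivAt (fun t : ℝ => fderiv ℝ (kelvin L v) (y + t • e))
        (fderiv ℝ (fderiv ℝ (kelvin L v)) y e) 0 := by
      refine HasFDerivAt.comp_hasDerivAt (f := fun t : ℝ => y + t • e) (0:ℝ) ?_
        (hasDerivAt_line y e 0)
      simpa using hk
    exact ((ContinuousLinearMap.apply ℝ ℝ e').hasFDerivAt.comp_hasDerivAt (0:ℝ) this)
  have hinv : ContinuousAt (fun t : ℝ => inv0 L (y + t • e)) 0 :=
    (hasDerivAt_inv0_line hy e).continuousAt
  have hne : ∀ᶠ t : ℝ in 𝓝 0, y + t • e ≠ 0 := by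
    have hc : ContinuousAt (fun t : ℝ => y + t • e) 0 := (hasDerivAt_line y e 0).continuousAt
    exact hc.eventually_ne (by simpa using hy)
  have hd : ∀ᶠ t : ℝ in 𝓝 0, HasFDerivAt v (fderiv ℝ v (inv0 L (y + t • e)))
      (inv0 L (y + t • e)) := by
    refine hinv.eventually (p := fun z => HasFDerivAt v (fderiv ℝ v z) z) ?_
    simpa using hv.eventually_hasFDerivAt_fderiv
  have heq : (fun t : ℝ => fderiv ℝ (kelvin L v) (y + t • e) e') =ᶠ[𝓝 0] fun t =>
      2 * inner ℝ (y + t • e) e' / L * v (inv0 L (y + t • e))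
        + fderiv ℝ v (inv0 L (y + t • e))
          (e' - (2 * inner ℝ (y + t • e) e' / ‖y + t • e‖ ^ 2) • (y + t • e)) := by
    filter_upwards [hne, hd] with t ht1 ht2
    rw [fderiv_kelvin ht1 hL ht2.differentiableAt]
    rfl
  have hin : HasDerivAt (fun t : ℝ => 2 * inner ℝ (y + t • e) e') (2 * inner ℝ e e') 0 := by
    simpa using ((hasDerivAt_line y e 0).inner ℝ (hasDerivAt_const (0:ℝ) e')).const_mul (2:ℝ)
  have hv1 : HasDerivAt (fun t : ℝ => v (inv0 L (y + t • e)))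
      (fderiv ℝ v (inv0 L y) ((L / ‖y‖ ^ 2) • refl0 y e)) 0 := by
    refine HasFDerivAt.comp_hasDerivAt (f := fun t : ℝ => inv0 L (y + t • e)) (0:ℝ) ?_
      (hasDerivAt_inv0_line hy e)
    simpa using (hv.differentiableAt (by norm_num)).hasFDerivAt
  have hv2 : HasDerivAt (fun t : ℝ => fderiv ℝ v (inv0 L (y + t • e)))
      (fderiv ℝ (fderiv ℝ v) (inv0 L y) ((L / ‖y‖ ^ 2) • refl0 y e)) 0 := by
    refine HasFDerivAt.comp_hasDerivAt (f := fun t : ℝ => inv0 L (y + t • e)) (0:ℝ) ?_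
      (hasDerivAt_inv0_line hy e)
    simpa using hv.hasFDerivAt_fderiv
  have hr := ((hin.div (hasDerivAt_norm_sq_line y e) (by simpa using hy2)).smul
    (hasDerivAt_line y e 0)).const_sub e'
  have h2 := ((hin.div_const L).mul hv1).add (hv2.clm_apply hr)
  rw [h1.unique (h2.congr_of_eventuallyEq heq)]
  simp only [zero_smul, add_zero, map_smul, smul_apply, smul_eq_mul, map_neg,
    map_add, Pi.div_apply, Pi.smul_apply']
  have hR : fderiv ℝ v (inv0 L y) (refl0 y e) = fderiv ℝ v (inv0 L y) e
      - 2 * inner ℝ y e / ‖y‖ ^ 2 * fderiv ℝ v (inv0 L y) y := by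
    simp [refl0]
  rw [hR]
  have hR' : e' - (2 * inner ℝ y e' / ‖y‖ ^ 2) • y = refl0 y e' := rfl
  rw [hR']
  field_simp
  ring

end Kelvin

/-! ### Conformal invariance. -/

section KelvinConf

variable {n : ℕ}

theorem norm_refl_combination {E : Type*} [NormedAddCommGroup E] [InnerProductSpace ℝ E]
    {y : E} (hy : y ≠ 0) (c : ℝ) (g : E) :
    ‖c • y + refl0 y g‖ ^ 2 = c ^ 2 * ‖y‖ ^ 2 - 2 * c * inner ℝ y g + ‖g‖ ^ 2 := by
  have hy2 : ‖y‖ ^ 2 ≠ 0 := by simpa using hy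
  rw [refl0, show c • y + (g - (2 * inner ℝ y g / ‖y‖ ^ 2) • y)
    = (c - 2 * inner ℝ y g / ‖y‖ ^ 2) • y + g by module, norm_add_sq_real, norm_smul, mul_pow,
    inner_smul_left]
  simp
  field_simp
  ring

/-- The matrix of the reflection in the hyperplane orthogonal to `y`. -/
noncomputable def reflMat (y : EuclideanSpace ℝ (Fin n)) : Matrix (Fin n) (Fin n) ℝ :=
  1 - (2 / ‖y‖ ^ 2) • Matrix.vecMulVec (fun i => y i) (fun i => y i)

theorem reflMat_transpose (y : EuclideanSpace ℝ (Fin n)) : (reflMat y)ᵀ = reflMat y := by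
  ext i j
  simp [reflMat, Matrix.vecMulVec_apply, Matrix.one_apply, eq_comm, mul_comm]

theorem reflMat_mul_self {y : EuclideanSpace ℝ (Fin n)} (hy : y ≠ 0) :
    reflMat y * reflMat y = 1 := by
  have hy2 : ‖y‖ ^ 2 ≠ 0 := by simpa using hy
  have h : Matrix.vecMulVec (fun i => y i) (fun i => y i)
      * Matrix.vecMulVec (fun i => y i) (fun i => y i)
      = ‖y‖ ^ 2 • Matrix.vecMulVec (fun i => y i) (fun i => y i) := by
    ext i j
    simp only [Matrix.mul_apply, Matrix.vecMulVec_apply, Matrix.smul_apply, smul_eq_mul,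
      EuclideanSpace.real_norm_sq_eq, Finset.sum_mul]
    exact Finset.sum_congr rfl fun k _ => by ring
  simp only [reflMat, sub_mul, mul_sub, one_mul, mul_one, Matrix.smul_mul, Matrix.mul_smul, h,
    smul_smul]
  rw [show 2 / ‖y‖ ^ 2 * (2 / ‖y‖ ^ 2 * ‖y‖ ^ 2) = 2 / ‖y‖ ^ 2 + 2 / ‖y‖ ^ 2 by
    field_simp; ring, add_smul]
  abel

/-- `reflMat y` as an orthogonal matrix. -/
noncomputable def reflOrth {y : EuclideanSpace ℝ (Fin n)} (hy : y ≠ 0) :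
    Matrix.orthogonalGroup (Fin n) ℝ :=
  ⟨reflMat y, by
    rw [Matrix.mem_orthogonalGroup_iff, reflMat_transpose, reflMat_mul_self hy]⟩

theorem refl0_single (y : EuclideanSpace ℝ (Fin n)) (j : Fin n) :
    refl0 y (EuclideanSpace.single j 1) =
      ∑ k, reflMat y k j • (EuclideanSpace.single k (1 : ℝ) : EuclideanSpace ℝ (Fin n)) := by
  ext i
  simp [refl0, reflMat, Matrix.one_apply, Matrix.vecMulVec_apply, EuclideanSpace.inner_single_right,
    Pi.single_apply]
  ring

theorem coe_conj (O : Matrix.orthogonalGroup (Fin n) ℝ) (M : SymMat n) :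
    (SymMat.conj O M : Matrix (Fin n) (Fin n) ℝ) =
      (O : Matrix (Fin n) (Fin n) ℝ)ᵀ * M * (O : Matrix (Fin n) (Fin n) ℝ) := rfl

theorem trace_conj (O : Matrix.orthogonalGroup (Fin n) ℝ) (M : SymMat n) :
    (SymMat.conj O M : Matrix (Fin n) (Fin n) ℝ).trace = (M : Matrix (Fin n) (Fin n) ℝ).trace := by
  rw [coe_conj, Matrix.trace_mul_cycle]
  have h := O.2
  rw [Matrix.mem_orthogonalGroup_iff] at h
  rw [h, one_mul]

/-- The factor `|y|²/L` of the transform cancels the `L/|y|²` in front of the reflected Hessian. The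
extra multiple of the identity in the Hessian is exactly compensated by the change of `½|∇v|²`,
computed in `norm_refl_combination`. -/
theorem confJet_kelvin {L : ℝ} {v : EuclideanSpace ℝ (Fin n) → ℝ} {y : EuclideanSpace ℝ (Fin n)}
    (hy : y ≠ 0) (hL : L ≠ 0) (hv : ContDiffAt ℝ 2 v (inv0 L y)) :
    confJet (jetAt (kelvin L v) y) = SymMat.conj (reflOrth hy) (confJet (jetAt v (inv0 L y))) := by
  have hy2 : ‖y‖ ^ 2 ≠ 0 := by simpa using hy
  have hd := hv.differentiableAt (by norm_num)
  set g := gradient v (inv0 L y) with hg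
  have hgr : ∀ e, fderiv ℝ v (inv0 L y) e = inner ℝ g e := fun e => by simp [hg]
  have hs1 := sum_sq_apply_single _ _ hgr
  have hs2 := sum_sq_apply_single (fderiv ℝ (kelvin L v) y)
    ((2 * v (inv0 L y) / L) • y + refl0 y g) (fun e => by
      rw [fderiv_kelvin hy hL hd, hgr, refl0, refl0, inner_add_left, inner_smul_left,
        inner_sub_left, inner_sub_right, inner_smul_left, inner_smul_right, real_inner_comm g y]
      simp
      field_simp)
  rw [norm_refl_combination hy] at hs2
  apply Subtype.ext
  ext i j
  rw [coe_conj, confJet_apply]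
  change _ = ((reflMat y)ᵀ *
    (confJet (jetAt v (inv0 L y)) : Matrix (Fin n) (Fin n) ℝ) * reflMat y) i j
  have hM : (confJet (jetAt v (inv0 L y)) : Matrix (Fin n) (Fin n) ℝ) =
      v (inv0 L y) • (bilinMat n (fderiv ℝ (fderiv ℝ v) (inv0 L y)) : Matrix (Fin n) (Fin n) ℝ)
      - (1 / 2 * ‖g‖ ^ 2) • (1 : Matrix (Fin n) (Fin n) ℝ) := by
    rw [← hs1]; rfl
  have hB : ((reflMat y)ᵀ * (bilinMat n (fderiv ℝ (fderiv ℝ v) (inv0 L y)) :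
      Matrix (Fin n) (Fin n) ℝ) * reflMat y) i j =
      (fderiv ℝ (fderiv ℝ v) (inv0 L y) (refl0 y (EuclideanSpace.single i 1))
        (refl0 y (EuclideanSpace.single j 1))
      + fderiv ℝ (fderiv ℝ v) (inv0 L y) (refl0 y (EuclideanSpace.single j 1))
        (refl0 y (EuclideanSpace.single i 1))) / 2 := by
    simp only [refl0_single, map_sum, map_smul, sum_apply,
      smul_apply, smul_eq_mul, Matrix.mul_apply, Matrix.transpose_apply,
      bilinMat_apply]
    rw [add_div, Finset.sum_div, Finset.sum_div, ]
    simp only [Finset.sum_mul, Finset.mul_sum, Finset.sum_div]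
    rw [Finset.sum_comm (f := fun a b => reflMat y a i * (reflMat y b j * _) / 2)]
    rw [← Finset.sum_add_distrib]
    refine Finset.sum_congr rfl fun k _ => ?_
    rw [← Finset.sum_add_distrib]
    refine Finset.sum_congr rfl fun l _ => ?_
    ring
  rw [hM, mul_sub, sub_mul, Matrix.mul_smul, Matrix.smul_mul, Matrix.mul_smul, Matrix.smul_mul,
    mul_one, reflMat_transpose, reflMat_mul_self hy, Matrix.sub_apply, Matrix.smul_apply]
  rw [reflMat_transpose] at hB
  rw [hB, Matrix.smul_apply]
  simp only [jetAt, Jet.val_mk, Jet.der_mk, Jet.hess_mk, fderiv_fderiv_kelvin hy hL hv, hs2]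
  have hij : inner ℝ (EuclideanSpace.single i (1:ℝ) : EuclideanSpace ℝ (Fin n))
      (EuclideanSpace.single j 1) = (1 : Matrix (Fin n) (Fin n) ℝ) i j := by
    simp [EuclideanSpace.inner_single_right, Matrix.one_apply, eq_comm]
  rw [real_inner_comm (EuclideanSpace.single i (1:ℝ) : EuclideanSpace ℝ (Fin n)), hij, hgr y,
    real_inner_comm y g, kelvin]
  simp only [smul_eq_mul]
  generalize inner ℝ y g = a
  field_simp
  ring

end KelvinConf

/-! ### Linearizing the equation along segments of jets. -/

section Linearization

variable {n : ℕ}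

theorem quadForm_bilinMat
    (B : EuclideanSpace ℝ (Fin n) →L[ℝ] EuclideanSpace ℝ (Fin n) →L[ℝ] ℝ) (x : Fin n → ℝ) :
    x ⬝ᵥ ((bilinMat n B : Matrix (Fin n) (Fin n) ℝ) *ᵥ x) =
      B (WithLp.toLp 2 x) (WithLp.toLp 2 x) := by
  have hx : (WithLp.toLp 2 x : EuclideanSpace ℝ (Fin n)) =
      ∑ k, x k • EuclideanSpace.single k (1:ℝ) := by
    ext i; simp [Pi.single_apply]
  rw [hx]
  simp only [dotProduct, Matrix.mulVec, bilinMat_apply, map_sum, map_smul, sum_apply, smul_apply,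
    smul_eq_mul]
  have h2 : ∑ i, ∑ j, x i * x j * B (EuclideanSpace.single i 1) (EuclideanSpace.single j 1) =
      ∑ i, ∑ j, x i * x j * B (EuclideanSpace.single j 1) (EuclideanSpace.single i 1) := by
    rw [Finset.sum_comm]
    exact Finset.sum_congr rfl fun i _ => Finset.sum_congr rfl fun j _ => by ring
  have h3 : ∑ i, ∑ j, x i * x j * B (EuclideanSpace.single i 1) (EuclideanSpace.single j 1) =
      ∑ i, x i * ∑ j, x j * B (EuclideanSpace.single i 1) (EuclideanSpace.single j 1) := by
    simp only [Finset.mul_sum, mul_assoc]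
  have h4 : ∑ i, x i * ∑ j, (B (EuclideanSpace.single i 1) (EuclideanSpace.single j 1)
      + B (EuclideanSpace.single j 1) (EuclideanSpace.single i 1)) / 2 * x j =
      (∑ i, ∑ j, x i * x j * B (EuclideanSpace.single i 1) (EuclideanSpace.single j 1) +
      ∑ i, ∑ j, x i * x j * B (EuclideanSpace.single j 1) (EuclideanSpace.single i 1)) / 2 := by
    simp only [Finset.mul_sum, ← Finset.sum_add_distrib, Finset.sum_div]
    exact Finset.sum_congr rfl fun i _ => Finset.sum_congr rfl fun j _ => by ring
  rw [h4, ← h2, add_self_div_two, h3]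
  simp only [Finset.mul_sum]
  rw [Finset.sum_comm]
  exact Finset.sum_congr rfl fun i _ => Finset.sum_congr rfl fun j _ => by ring

theorem isHermitian_coe (M : SymMat n) : (M : Matrix (Fin n) (Fin n) ℝ).IsHermitian := by
  have : (M : Matrix (Fin n) (Fin n) ℝ)ᵀ = M := M.2
  rwa [Matrix.IsHermitian, Matrix.conjTranspose_eq_transpose_of_trivial]

theorem bilinMat_posSemidef
    {B : EuclideanSpace ℝ (Fin n) →L[ℝ] EuclideanSpace ℝ (Fin n) →L[ℝ] ℝ}
    (hB : ∀ e, 0 ≤ B e e) : (bilinMat n B : Matrix (Fin n) (Fin n) ℝ).PosSemidef := by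
  refine Matrix.PosSemidef.of_dotProduct_mulVec_nonneg (isHermitian_coe _) fun x => ?_
  rw [star_trivial, quadForm_bilinMat]
  exact hB _

/-- `U ∩ {M + t N : t > 0}` is convex for every positive definite `N`. -/
def ConvexInPosDir (U : Set (SymMat n)) : Prop :=
  ∀ M N : SymMat n, (N : Matrix (Fin n) (Fin n) ℝ).PosDef →
    Convex ℝ (U ∩ {X : SymMat n | ∃ t : ℝ, 0 < t ∧ X = M + t • N})

/-- Convexity is assumed only in positive definite directions. Openness leaves room to replace `N`
by `N + ε I`, with the endpoints shifted by `-sε I` and `(1-s)ε I` so that the shifts cancel at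
parameter `s`. -/
theorem ConvexInPosDir.add_smul_mem {U : Set (SymMat n)} (hc : ConvexInPosDir U) (hU : IsOpen U)
    {M N : SymMat n} (hN : (N : Matrix (Fin n) (Fin n) ℝ).PosSemidef) (hM : M ∈ U)
    (hMN : M + N ∈ U) {s : ℝ} (hs : s ∈ Set.Icc (0:ℝ) 1) : M + s • N ∈ U := by
  have h1 : ∀ᶠ ε : ℝ in 𝓝 0, M - (s * ε) • SymMat.id n ∈ U := by
    have : Continuous fun ε : ℝ => M - (s * ε) • SymMat.id n := by fun_prop
    exact this.continuousAt.eventually_mem (hU.mem_nhds (by simpa using hM))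
  have h2 : ∀ᶠ ε : ℝ in 𝓝 0, M + N + ((1 - s) * ε) • SymMat.id n ∈ U := by
    have : Continuous fun ε : ℝ => M + N + ((1 - s) * ε) • SymMat.id n := by fun_prop
    exact this.continuousAt.eventually_mem (hU.mem_nhds (by simpa using hMN))
  have h12 : ∀ᶠ ε : ℝ in 𝓝[>] 0, (M - (s * ε) • SymMat.id n ∈ U ∧
      M + N + ((1 - s) * ε) • SymMat.id n ∈ U) ∧ ε ∈ Set.Ioi (0:ℝ) :=
    ((h1.and h2).filter_mono nhdsWithin_le_nhds).and self_mem_nhdsWithin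
  obtain ⟨ε, ⟨ha, hb⟩, hε⟩ := h12.exists
  have hε : 0 < ε := hε
  set N' : SymMat n := N + ε • SymMat.id n with hN'
  have hpd : (N' : Matrix (Fin n) (Fin n) ℝ).PosDef := by
    have : (N' : Matrix (Fin n) (Fin n) ℝ) = (N : Matrix (Fin n) (Fin n) ℝ) + ε • 1 := rfl
    rw [this]
    exact Matrix.PosDef.posSemidef_add hN (Matrix.PosDef.one.smul hε)
  -- The origin of the ray is one step behind the first endpoint, so the endpoints have the positive
  -- parameters `1` and `2`.
  set M' : SymMat n := M - (s * ε) • SymMat.id n - N' with hM'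
  have hconv := hc M' N' hpd
  have hx : M - (s * ε) • SymMat.id n ∈ U ∩ {X : SymMat n | ∃ t : ℝ, 0 < t ∧ X = M' + t • N'} :=
    ⟨ha, 1, one_pos, by rw [hM', one_smul]; abel⟩
  have hy : M + N + ((1 - s) * ε) • SymMat.id n ∈
      U ∩ {X : SymMat n | ∃ t : ℝ, 0 < t ∧ X = M' + t • N'} :=
    ⟨hb, 2, two_pos, by rw [hM', hN']; module⟩
  have hz := hconv hx hy (sub_nonneg.2 hs.2) hs.1 (by ring)
  convert hz.1 using 1
  module

/-- The pairing of two positive semidefinite matrices is nonnegative: write one as `Cᴴ C` and take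
the trace of `C (grad F) Cᴴ`. -/
theorem fderiv_bilinMat_nonneg {F : SymMat n → ℝ} {M : SymMat n} (hF : (SymMat.grad F M).PosDef)
    {B : EuclideanSpace ℝ (Fin n) →L[ℝ] EuclideanSpace ℝ (Fin n) →L[ℝ] ℝ}
    (hB : ∀ e, 0 ≤ B e e) : 0 ≤ fderiv ℝ F M (bilinMat n B) := by
  have hN := bilinMat_posSemidef hB
  rw [SymMat.fderiv_apply_eq_sum_grad]
  obtain ⟨C, hC⟩ : ∃ C : Matrix (Fin n) (Fin n) ℝ,
      (bilinMat n B : Matrix (Fin n) (Fin n) ℝ) = Cᴴ * C := by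
    open scoped MatrixOrder Matrix.Norms.L2Operator in
    exact CStarAlgebra.nonneg_iff_eq_star_mul_self.mp hN.nonneg
  have h1 : ∑ i, ∑ j, SymMat.grad F M i j * (bilinMat n B : Matrix (Fin n) (Fin n) ℝ) i j
      = (C * SymMat.grad F M * Cᴴ).trace := by
    rw [Matrix.trace_mul_comm, ← Matrix.mul_assoc, ← hC, Matrix.trace_mul_comm]
    simp only [Matrix.trace, Matrix.diag_apply, Matrix.mul_apply]
    refine Finset.sum_congr rfl fun i _ => Finset.sum_congr rfl fun j _ => ?_
    rw [bilinMat_apply, bilinMat_apply, add_comm]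
  rw [h1]
  exact (hF.posSemidef.mul_mul_conjTranspose_same C).trace_nonneg

/-- The bilinear form `e ⊗ e`. -/
noncomputable def tensorSq (e : EuclideanSpace ℝ (Fin n)) :
    EuclideanSpace ℝ (Fin n) →L[ℝ] EuclideanSpace ℝ (Fin n) →L[ℝ] ℝ :=
  ContinuousLinearMap.smulRightL ℝ (EuclideanSpace ℝ (Fin n)) (EuclideanSpace ℝ (Fin n) →L[ℝ] ℝ)
    (innerSL ℝ e) (innerSL ℝ e)

theorem tensorSq_apply (e x y : EuclideanSpace ℝ (Fin n)) :
    tensorSq e x y = inner ℝ e x * inner ℝ e y := by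
  simp [tensorSq]

theorem continuous_tensorSq : Continuous (tensorSq (n := n)) := by
  unfold tensorSq
  fun_prop

theorem tensorSq_smul (c : ℝ) (e : EuclideanSpace ℝ (Fin n)) :
    tensorSq (c • e) = c ^ 2 • tensorSq e := by
  ext x y
  simp [tensorSq_apply, inner_smul_left]
  ring

theorem fderiv_tensorSq_pos {F : SymMat n → ℝ} {M : SymMat n} (hF : (SymMat.grad F M).PosDef)
    {e : EuclideanSpace ℝ (Fin n)} (he : e ≠ 0) : 0 < fderiv ℝ F M (bilinMat n (tensorSq e)) := by
  rw [SymMat.fderiv_apply_eq_sum_grad]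
  have he' : (e.ofLp : Fin n → ℝ) ≠ 0 := fun h => he (by ext i; simpa using congrFun h i)
  have := hF.dotProduct_mulVec_pos he'
  rw [star_trivial] at this
  refine this.trans_eq (Eq.symm ?_)
  simp only [dotProduct, Matrix.mulVec, Finset.mul_sum]
  refine Finset.sum_congr rfl fun i _ => Finset.sum_congr rfl fun j _ => ?_
  rw [bilinMat_apply]
  simp only [tensorSq_apply, EuclideanSpace.inner_single_right]
  simp
  ring

/-- The jets at which the equation makes sense. -/
def jetDomain (U : Set (SymMat n)) : Set (Jet n) := {J | 0 < Jet.val J ∧ confJet J ∈ U}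

theorem isOpen_jetDomain {U : Set (SymMat n)} (hU : IsOpen U) : IsOpen (jetDomain U) :=
  (isOpen_lt continuous_const Jet.val.continuous).inter
    (hU.preimage (contDiff_confJet n).continuous)

/-- The operator `F(A[v]) - v ^ q` as a function of the jet. -/
noncomputable def jetOp (F : SymMat n → ℝ) (q : ℝ) (J : Jet n) : ℝ := F (confJet J) - Jet.val J ^ q

theorem contDiffOn_jetOp {U : Set (SymMat n)} {F : SymMat n → ℝ}
    (hF : ContDiffOn ℝ 2 F U) (q : ℝ) : ContDiffOn ℝ 2 (jetOp F q) (jetDomain U) := by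
  refine (hF.comp (contDiff_confJet n).contDiffOn fun J hJ => hJ.2).sub ?_
  exact Jet.val.contDiff.contDiffOn.rpow_const_of_ne fun J hJ => hJ.1.ne'

/-- In a pure Hessian direction `confJet` is affine with slope `v · B` and the term `v ^ q` does not
move. The ellipticity of `F` is therefore that of the jet operator. -/
theorem fderiv_jetOp_hess {U : Set (SymMat n)} (hU : IsOpen U) {F : SymMat n → ℝ}
    (hF : ContDiffOn ℝ 2 F U) (q : ℝ) {J : Jet n} (hJ : J ∈ jetDomain U)
    (B : EuclideanSpace ℝ (Fin n) →L[ℝ] EuclideanSpace ℝ (Fin n) →L[ℝ] ℝ) :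
    fderiv ℝ (jetOp F q) J (Jet.mk 0 0 B) = Jet.val J * fderiv ℝ F (confJet J) (bilinMat n B) := by
  have hd : DifferentiableAt ℝ (jetOp F q) J :=
    ((contDiffOn_jetOp hF q).contDiffAt ((isOpen_jetDomain hU).mem_nhds hJ)).differentiableAt
      (by norm_num)
  have hFd : DifferentiableAt ℝ F (confJet J) :=
    (hF.contDiffAt (hU.mem_nhds hJ.2)).differentiableAt (by norm_num)
  have h1 : HasDerivAt (fun t : ℝ => jetOp F q (J + t • Jet.mk 0 0 B))
      (fderiv ℝ (jetOp F q) J (Jet.mk 0 0 B)) 0 := by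
    refine HasFDerivAt.comp_hasDerivAt (l := jetOp F q) (f := fun t : ℝ => J + t • Jet.mk 0 0 B)
      (0:ℝ) ?_ (hasDerivAt_line J (Jet.mk 0 0 B) 0)
    simpa using hd.hasFDerivAt
  have h2 : ∀ t : ℝ, jetOp F q (J + t • Jet.mk 0 0 B) =
      F (confJet J + t • (Jet.val J • bilinMat n B)) - Jet.val J ^ q := fun t => by
    simp only [jetOp, confJet, map_add, map_smul, smul_add, Jet.val_mk, Jet.der_mk, Jet.hess_mk,
      smul_zero, add_zero]
    congr 2
    module
  have h3 : HasDerivAt (fun t : ℝ => F (confJet J + t • (Jet.val J • bilinMat n B)) - Jet.val J ^ q)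
      (fderiv ℝ F (confJet J) (Jet.val J • bilinMat n B)) 0 := by
    refine HasDerivAt.sub_const _ ?_
    refine HasFDerivAt.comp_hasDerivAt (l := F)
      (f := fun t : ℝ => confJet J + t • (Jet.val J • bilinMat n B))
      (0:ℝ) ?_ (hasDerivAt_line _ _ 0)
    rw [zero_smul, add_zero]
    exact hFd.hasFDerivAt
  simp only [h2] at h1
  rw [h1.unique h3, map_smul, smul_eq_mul]

/-- A closed tube around the segment is compact, convex and contained in `W`. Compactness gives the
constants `κ` and `K`, and convexity lets the mean value theorem produce the intermediate point `J`
for any two points near the ends. -/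
theorem exists_linearization_of_contDiffOn {E : Type*} [NormedAddCommGroup E] [NormedSpace ℝ E]
    [FiniteDimensional ℝ E] {W : Set E} (hW : IsOpen W) {Φ : E → ℝ} (hΦ : ContDiffOn ℝ 2 Φ W)
    {D : Set E} (hD : IsCompact D) (hpos : ∀ J ∈ W, ∀ d ∈ D, 0 < fderiv ℝ Φ J d)
    {J₀ J₁ : E} (hseg : segment ℝ J₀ J₁ ⊆ W) :
    ∃ κ > 0, ∃ K, ∃ δ > 0, ∀ J₀' ∈ Metric.closedBall J₀ δ, ∀ J₁' ∈ Metric.closedBall J₁ δ,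
      Φ J₁' ≤ Φ J₀' → ∃ J ∈ W, ‖fderiv ℝ Φ J‖ ≤ K ∧
        (∀ d ∈ D, κ ≤ fderiv ℝ Φ J d) ∧ fderiv ℝ Φ J (J₁' - J₀') ≤ 0 := by
  have : ProperSpace E := FiniteDimensional.proper ℝ E
  have hcs : IsCompact (segment ℝ J₀ J₁) := by
    rw [← convexHull_pair]
    exact (Set.toFinite {J₀, J₁}).isCompact_convexHull ℝ
  obtain ⟨δ, hδ, hδW⟩ := hcs.exists_cthickening_subset_open hW hseg
  set C := Metric.cthickening δ (segment ℝ J₀ J₁) with hC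
  have hCc : IsCompact C := hcs.cthickening
  have hCconv : Convex ℝ C := (convex_segment J₀ J₁).cthickening δ
  have hcont : ContinuousOn (fderiv ℝ Φ) C :=
    (hΦ.continuousOn_fderiv_of_isOpen hW (by norm_num)).mono hδW
  obtain ⟨K, hK⟩ := hCc.exists_bound_of_continuousOn hcont
  have hκ : ∃ κ > 0, ∀ J ∈ C, ∀ d ∈ D, κ ≤ fderiv ℝ Φ J d := by
    have hg : ContinuousOn (fun p : E × E => fderiv ℝ Φ p.1 p.2) (C ×ˢ D) :=
      (hcont.comp continuousOn_fst fun p hp => hp.1).clm_apply continuousOn_snd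
    rcases (C ×ˢ D).eq_empty_or_nonempty with hE | hne
    · refine ⟨1, one_pos, fun J hJ e he => ?_⟩
      have : (J, e) ∈ C ×ˢ D := ⟨hJ, he⟩
      rw [hE] at this
      exact this.elim
    · obtain ⟨p, hp, hmin⟩ := (hCc.prod hD).exists_isMinOn hne hg
      exact ⟨_, hpos p.1 (hδW hp.1) p.2 hp.2, fun J hJ e he => hmin (a := (J, e)) ⟨hJ, he⟩⟩
  obtain ⟨κ, hκ0, hκ⟩ := hκ
  refine ⟨κ, hκ0, K, δ, hδ, fun J₀' h0 J₁' h1 hle => ?_⟩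
  have h0C : J₀' ∈ C := Metric.closedBall_subset_cthickening (left_mem_segment ℝ J₀ J₁) δ h0
  have h1C : J₁' ∈ C := Metric.closedBall_subset_cthickening (right_mem_segment ℝ J₀ J₁) δ h1
  obtain ⟨J, hJ, hJe⟩ := domain_mvt (f := Φ) (f' := fderiv ℝ Φ) (s := C)
    (fun J hJ => ((hΦ.contDiffAt (hW.mem_nhds (hδW hJ))).differentiableAt
      (by norm_num)).hasFDerivAt.hasFDerivWithinAt) hCconv h0C h1C
  have hJC : J ∈ C := hCconv.segment_subset h0C h1C hJ
  exact ⟨J, hδW hJC, hK J hJC, hκ J hJC, by rw [← hJe]; linarith⟩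

theorem exists_linearization {U : Set (SymMat n)} (hU : IsOpen U) {F : SymMat n → ℝ}
    (hF : ContDiffOn ℝ 2 F U) (hell : ∀ M ∈ U, (SymMat.grad F M).PosDef) (q : ℝ)
    {J₀ J₁ : Jet n} (hseg : segment ℝ J₀ J₁ ⊆ jetDomain U) :
    ∃ κ > 0, ∃ K, ∃ δ > 0, ∀ J₀' ∈ Metric.closedBall J₀ δ, ∀ J₁' ∈ Metric.closedBall J₁ δ,
      jetOp F q J₁' ≤ jetOp F q J₀' → ∃ ℓ : Jet n →L[ℝ] ℝ, ‖ℓ‖ ≤ K ∧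
        (∀ e, κ * ‖e‖ ^ 2 ≤ ℓ (Jet.mk 0 0 (tensorSq e))) ∧
        (∀ B, (∀ e, 0 ≤ B e e) → 0 ≤ ℓ (Jet.mk 0 0 B)) ∧ ℓ (J₁' - J₀') ≤ 0 := by
  set D : Set (Jet n) := (fun e => (Jet.mk 0 0 (tensorSq e))) '' Metric.sphere 0 1
  have hD : IsCompact D := (isCompact_sphere _ _).image (continuous_iff_continuousAt.2 fun e =>
    Jet.continuousAt_mk continuousAt_const continuousAt_const continuous_tensorSq.continuousAt)
  have hpos : ∀ J ∈ jetDomain U, ∀ d ∈ D, 0 < fderiv ℝ (jetOp F q) J d := by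
    rintro J hJ _ ⟨e, he, rfl⟩
    have he1 : e ≠ 0 := by
      rintro rfl
      simp at he
    rw [fderiv_jetOp_hess hU hF q hJ]
    exact mul_pos hJ.1 (fderiv_tensorSq_pos (hell _ hJ.2) he1)
  obtain ⟨κ, hκ0, K, δ, hδ, H⟩ := exists_linearization_of_contDiffOn (isOpen_jetDomain hU)
    (contDiffOn_jetOp hF q) hD hpos hseg
  refine ⟨κ, hκ0, K, δ, hδ, fun J₀' h0 J₁' h1 hle => ?_⟩
  obtain ⟨J, hJ, hJK, hκ, hle'⟩ := H J₀' h0 J₁' h1 hle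
  refine ⟨fderiv ℝ (jetOp F q) J, hJK, fun e => ?_, fun B hB => ?_, hle'⟩
  · rcases eq_or_ne e 0 with rfl | he
    · have : tensorSq (0 : EuclideanSpace ℝ (Fin n)) = 0 := by ext; simp [tensorSq_apply]
      rw [fderiv_jetOp_hess hU hF q hJ, this]
      simp
    · have hn : ‖e‖ ≠ 0 := norm_ne_zero_iff.2 he
      have h := hκ _ ⟨‖e‖⁻¹ • e, by
        rw [mem_sphere_zero_iff_norm, norm_smul, norm_inv, norm_norm, inv_mul_cancel₀ hn], rfl⟩
      rw [fderiv_jetOp_hess hU hF q hJ] at h ⊢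
      rw [tensorSq_smul, map_smul, map_smul, smul_eq_mul, inv_pow, mul_left_comm, ← div_eq_inv_mul,
        le_div_iff₀ (by positivity)] at h
      exact h
  · rw [fderiv_jetOp_hess hU hF q hJ]
    exact mul_nonneg hJ.1.le (fderiv_bilinMat_nonneg (hell _ hJ.2) hB)

/-- With equal values and gradients, `confJet` is affine along the segment and moves in a positive
semidefinite direction, where convexity of `U` applies. -/
theorem segment_subset_jetDomain {U : Set (SymMat n)} (hU : IsOpen U) (hc : ConvexInPosDir U)
    {J₀ J₁ : Jet n} (h0 : J₀ ∈ jetDomain U) (h1 : J₁ ∈ jetDomain U) (hfst : Jet.val J₁ = Jet.val J₀)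
    (hsnd : Jet.der J₁ = Jet.der J₀) (hB : ∀ e, 0 ≤ (Jet.hess J₁ - Jet.hess J₀) e e) :
    segment ℝ J₀ J₁ ⊆ jetDomain U := by
  intro J hJ
  rw [segment_eq_image'] at hJ
  obtain ⟨t, ht, rfl⟩ := hJ
  have hN : ((Jet.val J₀ • bilinMat n (Jet.hess J₁ - Jet.hess J₀) : SymMat n) :
      Matrix (Fin n) (Fin n) ℝ).PosSemidef :=
    (bilinMat_posSemidef hB).smul h0.1.le
  have hadd : ∀ s : ℝ, confJet (J₀ + s • (J₁ - J₀)) =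
      confJet J₀ + s • (Jet.val J₀ • bilinMat n (Jet.hess J₁ - Jet.hess J₀)) := fun s => by
    simp only [confJet, map_add, map_smul, map_sub, hfst, hsnd, sub_self, smul_zero, add_zero,
      smul_add]
    module
  refine ⟨by simpa [hfst] using h0.1, ?_⟩
  change confJet (J₀ + t • (J₁ - J₀)) ∈ U
  rw [hadd t]
  refine hc.add_smul_mem hU hN h0.2 ?_ ht
  have := hadd 1
  rw [one_smul, one_smul, add_sub_cancel] at this
  rw [← this]
  exact h1.2

end Linearization

/-! ### Hopf's boundary point lemma. -/

section Hopf

variable {n : ℕ}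

theorem deriv_nonneg_of_right_min {f : ℝ → ℝ} {f' : ℝ} (hf : HasDerivAt f f' 0)
    (hmin : ∀ᶠ t in 𝓝[>] (0 : ℝ), f 0 ≤ f t) : 0 ≤ f' := by
  have h := hf.tendsto_slope_zero_right
  refine ge_of_tendsto h ?_
  filter_upwards [hmin, self_mem_nhdsWithin] with t ht ht0
  have : (0:ℝ) < t := ht0
  simp only [zero_add, smul_eq_mul]
  exact mul_nonneg (inv_nonneg.2 this.le) (sub_nonneg.2 ht)

theorem jetAt_sub {f g : EuclideanSpace ℝ (Fin n) → ℝ} {x : EuclideanSpace ℝ (Fin n)}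
    (hf : ContDiffAt ℝ 2 f x) (hg : ContDiffAt ℝ 2 g x) :
    jetAt (fun y => f y - g y) x = jetAt f x - jetAt g x := by
  rw [jetAt, jetAt, jetAt, Jet.mk_sub, fderiv_fderiv_sub hf hg]
  congr 1
  exact fderiv_sub (hf.differentiableAt (by norm_num)) (hg.differentiableAt (by norm_num))

theorem jetAt_const_mul {f : EuclideanSpace ℝ (Fin n) → ℝ} {x : EuclideanSpace ℝ (Fin n)}
    (c : ℝ) (hf : ContDiffAt ℝ 2 f x) :
    jetAt (fun y => c * f y) x = c • jetAt f x := by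
  rw [jetAt, jetAt, Jet.smul_mk, fderiv_fderiv_const_mul c hf]
  congr 1
  exact fderiv_const_mul (hf.differentiableAt (by norm_num)) c

/-- The Euclidean inner product as a continuous bilinear form. -/
noncomputable def innerForm (n : ℕ) :
    EuclideanSpace ℝ (Fin n) →L[ℝ] EuclideanSpace ℝ (Fin n) →L[ℝ] ℝ := innerSL ℝ

theorem innerForm_apply (e e' : EuclideanSpace ℝ (Fin n)) : innerForm n e e' = inner ℝ e e' := rfl

theorem norm_innerForm_le : ‖innerForm n‖ ≤ 1 := norm_innerSL_le ℝ

/-- The barrier `exp (-a |y - z|²) - exp (-a R²)`. -/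
noncomputable def expBarrier (a R : ℝ) (z y : EuclideanSpace ℝ (Fin n)) : ℝ :=
  Real.exp (-a * ‖y - z‖ ^ 2) - Real.exp (-a * R ^ 2)

theorem contDiff_expBarrier (a R : ℝ) (z : EuclideanSpace ℝ (Fin n)) :
    ContDiff ℝ 2 (expBarrier a R z) := by
  unfold expBarrier
  exact ((contDiff_const.mul ((contDiff_id.sub contDiff_const).norm_sq ℝ)).exp).sub contDiff_const

theorem jetAt_expBarrier (a R : ℝ) (z y : EuclideanSpace ℝ (Fin n)) :
    jetAt (expBarrier a R z) y = Jet.mk (expBarrier a R z y)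
      ((-2 * a * Real.exp (-a * ‖y - z‖ ^ 2)) • innerForm n (y - z))
      ((4 * a ^ 2 * Real.exp (-a * ‖y - z‖ ^ 2)) • tensorSq (y - z)
        - (2 * a * Real.exp (-a * ‖y - z‖ ^ 2)) • innerForm n) := by
  have hd : ∀ t : ℝ, HasDerivAt (fun t => Real.exp (-a * t) - Real.exp (-a * R ^ 2))
      (-a * Real.exp (-a * t)) t := fun t => by
    have := (((hasDerivAt_id t).const_mul (-a)).exp).sub_const (Real.exp (-a * R ^ 2))
    refine this.congr_deriv ?_
    simp; ring
  have hd' : ∀ t : ℝ, HasDerivAt (fun t => -a * Real.exp (-a * t))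
      (a ^ 2 * Real.exp (-a * t)) t := fun t => by
    have := (((hasDerivAt_id t).const_mul (-a)).exp).const_mul (-a)
    refine this.congr_deriv ?_
    simp; ring
  have h := fderiv_radial z y (g := fun t => Real.exp (-a * t) - Real.exp (-a * R ^ 2))
    (Eventually.of_forall hd) (hd' _)
  have h1 : fderiv ℝ (expBarrier a R z) y =
      (-2 * a * Real.exp (-a * ‖y - z‖ ^ 2)) • innerForm n (y - z) := by
    ext e
    refine (h.1 e).trans ?_
    rw [smul_apply, innerForm_apply, smul_eq_mul]
    ring
  have h2 : fderiv ℝ (fderiv ℝ (expBarrier a R z)) y =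
      (4 * a ^ 2 * Real.exp (-a * ‖y - z‖ ^ 2)) • tensorSq (y - z)
        - (2 * a * Real.exp (-a * ‖y - z‖ ^ 2)) • innerForm n := by
    refine ContinuousLinearMap.ext fun e => ContinuousLinearMap.ext fun e' => ?_
    refine (h.2 e e').trans ?_
    rw [sub_apply, sub_apply, smul_apply, smul_apply, smul_apply, smul_apply, innerForm_apply,
      tensorSq_apply, smul_eq_mul, smul_eq_mul]
    ring
  rw [jetAt, h1, h2]

/-- On the annulus the rank-one part of the Hessian contributes at least `κ a² R² E`, with `E` the
exponential, while all other terms are at most linear in `a`. The margin `K` times the barrier is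
there to absorb the zeroth-order part of `ℓ`. -/
theorem expBarrier_supersolution {a R κ K : ℝ} (hK : 0 ≤ K) (ha : 1 ≤ a)
    (haR : 2 * K * R + 4 * K < a * (κ * R ^ 2)) (hκ : 0 < κ)
    {ℓ : Jet n →L[ℝ] ℝ} (hℓK : ‖ℓ‖ ≤ K) (hℓ : ∀ e, κ * ‖e‖ ^ 2 ≤ ℓ (Jet.mk 0 0 (tensorSq e)))
    {z y : EuclideanSpace ℝ (Fin n)} (h1 : R / 2 ≤ ‖y - z‖) (h2 : ‖y - z‖ ≤ R) :
    K * expBarrier a R z y < ℓ (jetAt (expBarrier a R z) y) := by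
  have hR : 0 ≤ R := (norm_nonneg _).trans h2
  set r := ‖y - z‖ with hr
  have hr0 : 0 ≤ r := norm_nonneg _
  set E := Real.exp (-a * r ^ 2) with hE
  have hE0 : 0 < E := Real.exp_pos _
  have hb : expBarrier a R z y ≤ E := by
    unfold expBarrier
    have := Real.exp_pos (-a * R ^ 2)
    linarith
  have hb0 : 0 ≤ expBarrier a R z y := by
    unfold expBarrier
    rw [sub_nonneg, Real.exp_le_exp]
    nlinarith [pow_le_pow_left₀ hr0 h2 2]
  have hbound : ∀ J : Jet n, -(K * ‖J‖) ≤ ℓ J := fun J => by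
    have := (ℓ.le_opNorm J).trans (mul_le_mul_of_nonneg_right hℓK (norm_nonneg _))
    rw [Real.norm_eq_abs] at this
    exact (abs_le.1 this).1
  have hdec : jetAt (expBarrier a R z) y =
      Jet.mk (expBarrier a R z y) 0 0 + Jet.mk 0 ((-2 * a * E) • innerForm n (y - z)) 0
      + (4 * a ^ 2 * E) • Jet.mk 0 0 (tensorSq (y - z))
      + Jet.mk 0 0 (-(2 * a * E) • innerForm n) := by
    rw [jetAt_expBarrier, Jet.smul_mk, Jet.mk_add, Jet.mk_add, Jet.mk_add]
    simp [sub_eq_add_neg, hE, hr]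
  have e1 := hbound (Jet.mk (expBarrier a R z y) 0 0)
  have e2 := hbound (Jet.mk 0 ((-2 * a * E) • innerForm n (y - z)) 0)
  have e3 := hℓ (y - z)
  have e4 := hbound (Jet.mk 0 0 (-(2 * a * E) • innerForm n))
  have n1 : ‖(Jet.mk (expBarrier a R z y) 0 0 : Jet n)‖ ≤ E := by
    rw [Jet.norm_mk]
    simp [abs_of_nonneg hb0, hb, hE0.le]
  have n2 : ‖(Jet.mk 0 ((-2 * a * E) • innerForm n (y - z)) 0 : Jet n)‖ ≤ 2 * a * E * R := by
    rw [Jet.norm_mk, norm_zero, norm_zero, norm_smul, Real.norm_eq_abs,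
      show -2 * a * E = -(2 * a * E) by ring, abs_neg, abs_of_nonneg (by positivity)]
    have h3 : ‖innerForm n (y - z)‖ ≤ R :=
      ((innerForm n).le_opNorm _).trans ((mul_le_mul_of_nonneg_right norm_innerForm_le
        (norm_nonneg _)).trans (by rw [one_mul]; exact h2))
    have h4 : 0 ≤ 2 * a * E * R := by positivity
    simp only [max_le_iff]
    exact ⟨h4, mul_le_mul_of_nonneg_left h3 (by positivity), h4⟩
  have n4 : ‖(Jet.mk 0 0 (-(2 * a * E) • innerForm n) : Jet n)‖ ≤ 2 * a * E := by
    rw [Jet.norm_mk, norm_zero, norm_zero, norm_smul, Real.norm_eq_abs, abs_neg,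
      abs_of_nonneg (by positivity)]
    have h4 : 0 ≤ 2 * a * E := by positivity
    simp only [max_le_iff]
    exact ⟨h4, h4, mul_le_of_le_one_right h4 norm_innerForm_le⟩
  have m1 := mul_le_mul_of_nonneg_left n1 hK
  have m2 := mul_le_mul_of_nonneg_left n2 hK
  have m4 := mul_le_mul_of_nonneg_left n4 hK
  have m0 := mul_le_mul_of_nonneg_left hb hK
  rw [hdec, map_add, map_add, map_add, map_smul, smul_eq_mul]
  have m3 : 4 * a ^ 2 * E * (κ * (R / 2) ^ 2) ≤
      4 * a ^ 2 * E * ℓ (Jet.mk 0 0 (tensorSq (y - z))) := by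
    refine mul_le_mul_of_nonneg_left (le_trans ?_ e3) (by positivity)
    exact mul_le_mul_of_nonneg_left (pow_le_pow_left₀ (by linarith) h1 2) hκ.le
  have key : K * E + K * E + K * (2 * a * E * R) + K * (2 * a * E)
      < 4 * a ^ 2 * E * (κ * (R / 2) ^ 2) := by
    have k1 : 2 * K ≤ a * (2 * K) := le_mul_of_one_le_left (by positivity) ha
    have k2 : 2 * K + 2 * a * K * R + 2 * a * K < a ^ 2 * (κ * R ^ 2) := by
      have := mul_lt_mul_of_pos_left haR (by linarith : 0 < a)
      nlinarith
    have := mul_lt_mul_of_pos_left k2 hE0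
    nlinarith
  linarith

/-- Hopf's boundary point lemma, with uniformly elliptic coefficients given pointwise. -/
theorem hopf_boundary_point {w : EuclideanSpace ℝ (Fin n) → ℝ} {y₀ z : EuclideanSpace ℝ (Fin n)}
    {R κ K : ℝ} (hR : 0 < R) (hy₀ : ‖y₀ - z‖ = R) (hκ : 0 < κ)
    (hw : ∀ᶠ y in 𝓝 y₀, ContDiffAt ℝ 2 w y) (hw0 : w y₀ = 0)
    (hpos : ∀ᶠ y in 𝓝 y₀, ‖y - z‖ ≤ R → y ≠ y₀ → 0 < w y)
    (hL : ∀ᶠ y in 𝓝 y₀, ‖y - z‖ < R → ∃ ℓ : Jet n →L[ℝ] ℝ, ‖ℓ‖ ≤ K ∧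
        (∀ e, κ * ‖e‖ ^ 2 ≤ ℓ (Jet.mk 0 0 (tensorSq e))) ∧
        (∀ B, (∀ e, 0 ≤ B e e) → 0 ≤ ℓ (Jet.mk 0 0 B)) ∧ ℓ (jetAt w y) ≤ 0) :
    0 < fderiv ℝ w y₀ (z - y₀) := by
  -- A negative `K` bounds no norm, so `0` serves as well.
  wlog hK : 0 ≤ K generalizing K
  · exact this (K := 0) (hL.mono fun y hy hyz => by
      obtain ⟨ℓ, h1, h2⟩ := hy hyz
      exact ⟨ℓ, by linarith, h2⟩) le_rfl
  set a : ℝ := (2 * K * R + 4 * K) / (κ * R ^ 2) + 1 with ha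
  have ha1 : 1 ≤ a := by
    rw [ha, le_add_iff_nonneg_left]; positivity
  have haR : 2 * K * R + 4 * K < a * (κ * R ^ 2) := by
    rw [ha, add_mul, div_mul_cancel₀ _ (by positivity)]
    have : 0 < κ * R ^ 2 := by positivity
    linarith
  set h := expBarrier a R z with hh
  have hcd := contDiff_expBarrier a R z
  obtain ⟨δ₀, hδ₀, hball⟩ := Metric.eventually_nhds_iff_ball.1 ((hw.and hpos).and hL)
  -- The bound `R / 2` keeps the comparison region inside the annulus `R/2 ≤ |y - z| ≤ R` where the
  -- barrier works.
  set δ := min (δ₀ / 2) (R / 2) with hδ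
  have hδ0 : 0 < δ := lt_min (by linarith) (by linarith)
  have hδ1 : δ < δ₀ := (min_le_left _ _).trans_lt (by linarith)
  have hδ2 : δ ≤ R / 2 := min_le_right _ _
  have hmem : ∀ y, ‖y - y₀‖ ≤ δ → y ∈ Metric.ball y₀ δ₀ := fun y hy => by
    rw [mem_ball_iff_norm]; linarith
  set D : Set (EuclideanSpace ℝ (Fin n)) := {y | ‖y - z‖ ≤ R ∧ ‖y - y₀‖ ≤ δ} with hD
  have hDeq : D = Metric.closedBall z R ∩ Metric.closedBall y₀ δ := by
    ext y; simp [hD, dist_eq_norm]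
  have hDc : IsCompact D := by
    rw [hDeq]; exact (isCompact_closedBall _ _).inter (isCompact_closedBall _ _)
  have hwc : ContinuousOn w D := fun y hy =>
    ((hball y (hmem y hy.2)).1.1).continuousAt.continuousWithinAt
  have hw_nonneg : ∀ y ∈ D, 0 ≤ w y := fun y hy => by
    rcases eq_or_ne y y₀ with rfl | hne
    · exact hw0.ge
    · exact ((hball y (hmem y hy.2)).1.2 hy.1 hne).le
  have hy₀D : y₀ ∈ D := ⟨hy₀.le, by simpa using hδ0.le⟩
  obtain ⟨ε, hε, hεw⟩ : ∃ ε > 0, ∀ y ∈ D, ‖y - y₀‖ = δ → ε ≤ w y := by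
    have hSc : IsCompact (D ∩ Metric.sphere y₀ δ) := hDc.inter_right Metric.isClosed_sphere
    rcases (D ∩ Metric.sphere y₀ δ).eq_empty_or_nonempty with hE | hne
    · refine ⟨1, one_pos, fun y hy hy' => ?_⟩
      have : y ∈ D ∩ Metric.sphere y₀ δ := ⟨hy, by simpa [dist_eq_norm] using hy'⟩
      rw [hE] at this
      exact this.elim
    · obtain ⟨y, hy, hmin⟩ := hSc.exists_isMinOn hne (hwc.mono Set.inter_subset_left)
      refine ⟨w y, ?_, fun x hx hx' => hmin ⟨hx, by simpa [dist_eq_norm] using hx'⟩⟩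
      refine (hball y (hmem y hy.1.2)).1.2 hy.1.1 ?_
      rintro rfl
      have := hy.2
      simp at this
      linarith
  have hh_le : ∀ y, h y ≤ 1 := fun y => by
    have h1 : Real.exp (-a * ‖y - z‖ ^ 2) ≤ 1 := by
      rw [Real.exp_le_one_iff]
      have : 0 ≤ a * ‖y - z‖ ^ 2 := by positivity
      linarith
    have := Real.exp_pos (-a * R ^ 2)
    simp only [hh, expBarrier]
    linarith
  have hh_nonneg : ∀ y, ‖y - z‖ ≤ R → 0 ≤ h y := fun y hy => by
    simp only [hh, expBarrier]
    rw [sub_nonneg, Real.exp_le_exp]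
    nlinarith [pow_le_pow_left₀ (norm_nonneg _) hy 2]
  -- At a negative interior minimum, `ℓ` of the jet of `w - ε h` is at least `-ε K h`, because the
  -- Hessian is nonnegative and `w ≥ 0` bounds the depth by `ε h`. It is also less than `-ε K h`, by
  -- the equation for `w` and the barrier inequality.
  have hmain : ∀ y ∈ D, 0 ≤ w y - ε * h y := by
    obtain ⟨y₁, hy₁, hmin⟩ := hDc.exists_isMinOn ⟨y₀, hy₀D⟩
      (hwc.sub (continuousOn_const.mul hcd.continuous.continuousOn) :
        ContinuousOn (fun y => w y - ε * h y) D)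
    intro y hy
    refine le_trans ?_ (hmin hy)
    by_contra! hneg
    change w y₁ - ε * h y₁ < 0 at hneg
    have hlt1 : ‖y₁ - z‖ < R := by
      refine lt_of_le_of_ne hy₁.1 fun heq => ?_
      have : h y₁ = 0 := by simp [hh, expBarrier, heq]
      rw [this, mul_zero, sub_zero] at hneg
      exact absurd (hw_nonneg y₁ hy₁) (not_le.2 hneg)
    have hlt2 : ‖y₁ - y₀‖ < δ := by
      refine lt_of_le_of_ne hy₁.2 fun heq => ?_
      have h1 := hεw y₁ hy₁ heq
      have h2 := mul_le_mul_of_nonneg_left (hh_le y₁) hε.le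
      linarith
    obtain ⟨⟨hwy₁, -⟩, hLy₁⟩ := hball y₁ (hmem y₁ hy₁.2)
    obtain ⟨ℓ, hℓK, hℓκ, hℓB, hℓw⟩ := hLy₁ hlt1
    have hcd1 : ContDiffAt ℝ 2 (fun y => ε * h y) y₁ := contDiffAt_const.mul hcd.contDiffAt
    have hcd2 : ContDiffAt ℝ 2 (fun y => w y - ε * h y) y₁ := hwy₁.sub hcd1
    have hloc : IsLocalMin (fun y => w y - ε * h y) y₁ := by
      have e1 : ∀ᶠ y in 𝓝 y₁, ‖y - z‖ < R :=
        (continuous_id.sub continuous_const).norm.continuousAt.eventually_lt_const hlt1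
      have e2 : ∀ᶠ y in 𝓝 y₁, ‖y - y₀‖ < δ :=
        (continuous_id.sub continuous_const).norm.continuousAt.eventually_lt_const hlt2
      filter_upwards [e1, e2] with y h1 h2 using hmin ⟨h1.le, h2.le⟩
    have hfd := hloc.fderiv_eq_zero
    have hray : ∀ e, 0 ≤ fderiv ℝ (fderiv ℝ (fun y => w y - ε * h y)) y₁ e e := fun e => by
      refine fderiv_fderiv_nonneg_of_ray_min hcd2 (by rw [hfd]; simp) ?_
      have hc : Tendsto (fun t : ℝ => y₁ + t • e) (𝓝[>] 0) (𝓝 y₁) := by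
        have := (hasDerivAt_line y₁ e 0).continuousAt.tendsto
        simp only [zero_smul, add_zero] at this
        exact this.mono_left nhdsWithin_le_nhds
      exact hc.eventually hloc
    have hj := jetAt_sub hwy₁ hcd1
    rw [jetAt_const_mul ε hcd.contDiffAt] at hj
    have hj2 : ℓ (jetAt (fun y => w y - ε * h y) y₁) =
        (w y₁ - ε * h y₁) * ℓ (Jet.mk 1 0 0) + ℓ (Jet.mk 0 0
          (fderiv ℝ (fderiv ℝ (fun y => w y - ε * h y)) y₁)) := by
      have hsplit : ∀ (s : ℝ) (B : EuclideanSpace ℝ (Fin n) →L[ℝ] EuclideanSpace ℝ (Fin n) →L[ℝ] ℝ),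
          (Jet.mk s 0 B : Jet n) = s • Jet.mk 1 0 0 + Jet.mk 0 0 B := fun s B => by
        rw [Jet.smul_mk, Jet.mk_add]; simp
      rw [jetAt, hfd, hsplit, map_add, map_smul, smul_eq_mul]
    rw [hj, map_sub, map_smul, smul_eq_mul] at hj2
    have hB := hℓB _ hray
    have hone : ‖ℓ (Jet.mk 1 0 0)‖ ≤ K := by
      refine (ℓ.le_opNorm _).trans ?_
      rw [Jet.norm_mk]
      simpa using hℓK
    rw [Real.norm_eq_abs] at hone
    have hsup := expBarrier_supersolution hK ha1 haR hκ hℓK hℓκ (z := z) (y := y₁) (R := R)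
      (by
        have : ‖y₀ - z‖ ≤ ‖y₁ - y₀‖ + ‖y₁ - z‖ := by
          have := norm_sub_le_norm_sub_add_norm_sub y₀ y₁ z
          rwa [norm_sub_rev y₀ y₁] at this
        linarith) hlt1.le
    have hs : -(ε * h y₁) ≤ w y₁ - ε * h y₁ := by linarith [hw_nonneg y₁ hy₁]
    have hsc : -(ε * h y₁ * K) ≤ (w y₁ - ε * h y₁) * ℓ (Jet.mk 1 0 0) := by
      have h1 : |(w y₁ - ε * h y₁) * ℓ (Jet.mk 1 0 0)| ≤ ε * h y₁ * K := by
        rw [abs_mul]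
        refine mul_le_mul ?_ hone (abs_nonneg _) (mul_nonneg hε.le (hh_nonneg _ hy₁.1))
        rw [abs_of_neg hneg]
        linarith
      exact (abs_le.1 h1).1
    have := mul_lt_mul_of_pos_left hsup hε
    rw [← hh] at this
    nlinarith
  have hline := hasDerivAt_line y₀ (z - y₀) 0
  have hdw : HasDerivAt (fun t : ℝ => w (y₀ + t • (z - y₀))) (fderiv ℝ w y₀ (z - y₀)) 0 := by
    refine HasFDerivAt.comp_hasDerivAt (l := w) (f := fun t : ℝ => y₀ + t • (z - y₀)) (0:ℝ) ?_ hline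
    rw [zero_smul, add_zero]
    exact (hw.self_of_nhds.differentiableAt (by norm_num)).hasFDerivAt
  have hdh : HasDerivAt (fun t : ℝ => h (y₀ + t • (z - y₀))) (fderiv ℝ h y₀ (z - y₀)) 0 := by
    refine HasFDerivAt.comp_hasDerivAt (l := h) (f := fun t : ℝ => y₀ + t • (z - y₀)) (0:ℝ) ?_ hline
    rw [zero_smul, add_zero]
    exact (hcd.contDiffAt.differentiableAt (by norm_num)).hasFDerivAt
  -- `w - ε h` vanishes at `y₀` and is nonnegative inwards, so the inner derivative of `w` is at
  -- least `ε` times that of `h`, which is positive.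
  have hge := deriv_nonneg_of_right_min (hdw.sub (hdh.const_mul ε)) (by
    have e1 : ∀ᶠ t : ℝ in 𝓝 0, ‖y₀ + t • (z - y₀) - y₀‖ < δ := by
      have : Continuous fun t : ℝ => ‖y₀ + t • (z - y₀) - y₀‖ := by fun_prop
      exact this.continuousAt.eventually_lt_const (by simpa using hδ0)
    have e2 : ∀ᶠ t : ℝ in 𝓝 0, t < 1 := gt_mem_nhds one_pos
    filter_upwards [nhdsWithin_le_nhds e1, nhdsWithin_le_nhds e2, self_mem_nhdsWithin]
      with t h1 h2 h3
    have h3 : (0:ℝ) < t := h3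
    have hy : y₀ + t • (z - y₀) ∈ D := by
      refine ⟨?_, h1.le⟩
      rw [show y₀ + t • (z - y₀) - z = (1 - t) • (y₀ - z) by module, norm_smul, hy₀,
        Real.norm_eq_abs, abs_of_pos (by linarith)]
      nlinarith
    have h0 : h y₀ = 0 := by simp [hh, expBarrier, hy₀]
    simpa [hw0, h0] using hmain _ hy)
  have hh1 : 0 < fderiv ℝ h y₀ (z - y₀) := by
    have : fderiv ℝ h y₀ = (-2 * a * Real.exp (-a * ‖y₀ - z‖ ^ 2)) • innerForm n (y₀ - z) := by
      have := congrArg Jet.der (jetAt_expBarrier a R z y₀)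
      simpa [jetAt] using this
    rw [this, smul_apply, innerForm_apply, ← neg_sub y₀ z, inner_neg_right,
      real_inner_self_eq_norm_sq, hy₀, smul_eq_mul]
    have : 0 < a * Real.exp (-a * R ^ 2) * R ^ 2 := by positivity
    linarith
  have := mul_pos hε hh1
  linarith

end Hopf

/-! ### Strong maximum principle and Hopf lemma for `v` and its Kelvin transform. -/

section StrongMaximum

variable {n : ℕ}

/-- The structural hypotheses on the operator `F` on `U`. -/
structure EllipticOperator (U : Set (SymMat n)) (F : SymMat n → ℝ) : Prop where
  isOpen : IsOpen U
  conj_mem : ∀ (O : Matrix.orthogonalGroup (Fin n) ℝ), ∀ M ∈ U, SymMat.conj O M ∈ U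
  convex : ConvexInPosDir U
  contDiffOn : ContDiffOn ℝ 2 F U
  conj_eq : ∀ (O : Matrix.orthogonalGroup (Fin n) ℝ), ∀ M ∈ U, F (SymMat.conj O M) = F M
  posDef : ∀ M ∈ U, (SymMat.grad F M).PosDef

/-- Positive entire solutions of `F(A[v]) = v ^ q` with at most quadratic growth. -/
structure IsEntireSolution (U : Set (SymMat n)) (F : SymMat n → ℝ) (q : ℝ)
    (v : EuclideanSpace ℝ (Fin n) → ℝ) : Prop where
  contDiff : ContDiff ℝ 2 v
  pos : ∀ y, 0 < v y
  mem : ∀ y, confJet (jetAt v y) ∈ U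
  eq : ∀ y, F (confJet (jetAt v y)) = v y ^ q
  growth : ∃ C, ∀ y, v y ≤ C * (1 + ‖y‖ ^ 2)

theorem continuousAt_jetAt {f : EuclideanSpace ℝ (Fin n) → ℝ} {x : EuclideanSpace ℝ (Fin n)}
    (hf : ContDiffAt ℝ 2 f x) : ContinuousAt (jetAt f) x := by
  refine Jet.continuousAt_mk hf.continuousAt hf.hasFDerivAt_fderiv.continuousAt ?_
  have h1 : ContDiffAt ℝ 1 (fderiv ℝ f) x := hf.fderiv_right (by norm_num)
  have h2 : ContDiffAt ℝ 0 (fderiv ℝ (fderiv ℝ f)) x := h1.fderiv_right (by norm_num)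
  exact h2.continuousAt

/-- First-order contact with ordered Hessians puts the segment between the two jets in the domain.
By continuity the jets at nearby points stay close to its ends, so one pair `κ`, `K` serves a whole
neighbourhood. `S` is the region in which `v'` is a supersolution. -/
theorem EllipticOperator.linearization_at_contact {U : Set (SymMat n)} {F : SymMat n → ℝ}
    (hE : EllipticOperator U F) {q : ℝ} {v v' : EuclideanSpace ℝ (Fin n) → ℝ}
    {y₀ : EuclideanSpace ℝ (Fin n)} (hv : ContDiff ℝ 2 v)
    (hv' : ∀ᶠ y in 𝓝 y₀, ContDiffAt ℝ 2 v' y) (h0 : jetAt v y₀ ∈ jetDomain U)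
    (h1 : jetAt v' y₀ ∈ jetDomain U) (hval : v' y₀ = v y₀)
    (hder : fderiv ℝ v' y₀ = fderiv ℝ v y₀)
    (hess : ∀ e, 0 ≤ fderiv ℝ (fderiv ℝ (fun y => v' y - v y)) y₀ e e)
    {S : Set (EuclideanSpace ℝ (Fin n))}
    (hS : ∀ᶠ y in 𝓝 y₀, y ∈ S → jetOp F q (jetAt v' y) ≤ jetOp F q (jetAt v y)) :
    ∃ κ > 0, ∃ K, ∀ᶠ y in 𝓝 y₀, y ∈ S → ∃ ℓ : Jet n →L[ℝ] ℝ, ‖ℓ‖ ≤ K ∧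
        (∀ e, κ * ‖e‖ ^ 2 ≤ ℓ (Jet.mk 0 0 (tensorSq e))) ∧
        (∀ B, (∀ e, 0 ≤ B e e) → 0 ≤ ℓ (Jet.mk 0 0 B)) ∧
        ℓ (jetAt (fun y => v' y - v y) y) ≤ 0 := by
  have hseg : segment ℝ (jetAt v y₀) (jetAt v' y₀) ⊆ jetDomain U := by
    refine segment_subset_jetDomain hE.isOpen hE.convex h0 h1 hval hder fun e => ?_
    have := hess e
    rwa [fderiv_fderiv_sub hv'.self_of_nhds hv.contDiffAt] at this
  obtain ⟨κ, hκ, K, δ, hδ, H⟩ :=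
    exists_linearization hE.isOpen hE.contDiffOn hE.posDef q hseg
  refine ⟨κ, hκ, K, ?_⟩
  have c0 := (continuousAt_jetAt (hv.contDiffAt (x := y₀))).eventually_mem
    (Metric.closedBall_mem_nhds _ hδ)
  have c1 := (continuousAt_jetAt hv'.self_of_nhds).eventually_mem (Metric.closedBall_mem_nhds _ hδ)
  filter_upwards [c0, c1, hS, hv'] with y hy0 hy1 hyS hyv hy
  obtain ⟨ℓ, hℓ1, hℓ2, hℓ3, hℓ4⟩ := H _ hy0 _ hy1 (hyS hy)
  exact ⟨ℓ, hℓ1, hℓ2, hℓ3, by rwa [jetAt_sub hyv hv.contDiffAt]⟩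

variable {U : Set (SymMat n)} {F : SymMat n → ℝ} {q : ℝ} {v : EuclideanSpace ℝ (Fin n) → ℝ}

theorem IsEntireSolution.jetAt_mem (hv : IsEntireSolution U F q v)
    (y : EuclideanSpace ℝ (Fin n)) : jetAt v y ∈ jetDomain U := ⟨hv.pos y, hv.mem y⟩

theorem IsEntireSolution.contDiffAt_kelvin (hv : IsEntireSolution U F q v) (L : ℝ)
    {y : EuclideanSpace ℝ (Fin n)} (hy : y ≠ 0) : ContDiffAt ℝ 2 (kelvin L v) y :=
  _root_.contDiffAt_kelvin hy hv.contDiff.contDiffAt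

theorem IsEntireSolution.kelvin_mem (hE : EllipticOperator U F) (hv : IsEntireSolution U F q v)
    {L : ℝ} (hL : 0 < L) {y : EuclideanSpace ℝ (Fin n)} (hy : y ≠ 0) :
    jetAt (kelvin L v) y ∈ jetDomain U := by
  have hy0 : 0 < ‖y‖ := norm_pos_iff.2 hy
  refine ⟨?_, ?_⟩
  · change 0 < kelvin L v y
    exact mul_pos (by positivity) (hv.pos _)
  · rw [confJet_kelvin hy hL.ne' hv.contDiff.contDiffAt]
    exact hE.conj_mem _ _ (hv.mem _)

/-- By conformal invariance `F(A[v_L])` at `y` is `v ^ q` at the inverted point. Outside the sphere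
`v_L(y)` is that value of `v` times `|y|²/L ≥ 1`, so `q ≥ 0` gives the sign. -/
theorem IsEntireSolution.jetOp_kelvin_le (hE : EllipticOperator U F)
    (hv : IsEntireSolution U F q v) (hq : 0 ≤ q) {L : ℝ} (hL : 0 < L)
    {y : EuclideanSpace ℝ (Fin n)} (hy : L ≤ ‖y‖ ^ 2) :
    jetOp F q (jetAt (kelvin L v) y) ≤ jetOp F q (jetAt v y) := by
  have hy0 : y ≠ 0 := by
    rintro rfl
    simp at hy
    linarith
  have h1 : jetOp F q (jetAt v y) = 0 := by
    rw [jetOp, hv.eq]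
    exact sub_self _
  rw [h1, jetOp, confJet_kelvin hy0 hL.ne' hv.contDiff.contDiffAt, hE.conj_eq _ _ (hv.mem _),
    hv.eq, sub_nonpos]
  refine Real.rpow_le_rpow (hv.pos _).le ?_ hq
  exact le_mul_of_one_le_left (hv.pos _).le ((one_le_div hL).2 hy)

/-- The point may lie on the sphere, so not every ray stays in the exterior. Rays with `⟨y₀, e⟩ > 0`
do; replacing `e` by `-e` covers the opposite side, and `e + s y₀` with `s → 0` covers tangential
directions. -/
theorem hess_nonneg_of_exterior_min {w : EuclideanSpace ℝ (Fin n) → ℝ}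
    {y₀ : EuclideanSpace ℝ (Fin n)} {L : ℝ} (hw : ContDiffAt ℝ 2 w y₀) (hy₀ : y₀ ≠ 0)
    (hL : L ≤ ‖y₀‖ ^ 2) (h0 : w y₀ = 0) (hd : fderiv ℝ w y₀ = 0)
    (hpos : ∀ y, L ≤ ‖y‖ ^ 2 → 0 ≤ w y) (e : EuclideanSpace ℝ (Fin n)) :
    0 ≤ fderiv ℝ (fderiv ℝ w) y₀ e e := by
  have key : ∀ e, 0 < inner ℝ y₀ e → 0 ≤ fderiv ℝ (fderiv ℝ w) y₀ e e := fun e he => by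
    refine fderiv_fderiv_nonneg_of_ray_min hw (by rw [hd]; rfl) ?_
    filter_upwards [self_mem_nhdsWithin] with t ht
    have ht : (0:ℝ) < t := ht
    rw [h0]
    refine hpos _ ?_
    rw [norm_add_sq_real, inner_smul_right]
    nlinarith [mul_pos ht he, sq_nonneg ‖t • e‖]
  have hn : 0 < inner ℝ y₀ y₀ := by rw [real_inner_self_eq_norm_sq]; positivity
  wlog he : 0 ≤ inner ℝ y₀ e generalizing e
  · have := this (-e) (by rw [inner_neg_right]; linarith)
    simpa using this
  have hc : Continuous fun s : ℝ => fderiv ℝ (fderiv ℝ w) y₀ (e + s • y₀) (e + s • y₀) := by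
    fun_prop
  have ht : Tendsto (fun s : ℝ => fderiv ℝ (fderiv ℝ w) y₀ (e + s • y₀) (e + s • y₀)) (𝓝[>] 0)
      (𝓝 (fderiv ℝ (fderiv ℝ w) y₀ e e)) := by
    have := hc.tendsto 0
    simp only [zero_smul, add_zero] at this
    exact this.mono_left nhdsWithin_le_nhds
  refine ge_of_tendsto ht ?_
  filter_upwards [self_mem_nhdsWithin] with s hs
  have hs : (0:ℝ) < s := hs
  refine key _ ?_
  rw [inner_add_right, inner_smul_right]
  have := mul_pos hs hn
  linarith

/-- Hopf's lemma makes a directional derivative of `v_L - v` at `y₀` strictly positive, while the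
gradient vanishes there. It applies alike to contact outside the sphere and on it. -/
theorem IsEntireSolution.no_flat_contact (hE : EllipticOperator U F)
    (hv : IsEntireSolution U F q v) (hq : 0 ≤ q) {L : ℝ} (hL : 0 < L)
    (hle : ∀ y, L ≤ ‖y‖ ^ 2 → v y ≤ kelvin L v y) {y₀ z : EuclideanSpace ℝ (Fin n)} {R : ℝ}
    (hy₀ : L ≤ ‖y₀‖ ^ 2) (h0 : kelvin L v y₀ = v y₀)
    (hd : fderiv ℝ (fun y => kelvin L v y - v y) y₀ = 0) (hR : 0 < R) (hz : ‖y₀ - z‖ = R)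
    (hball : ∀ y, ‖y - z‖ ≤ R → y ≠ y₀ → L ≤ ‖y‖ ^ 2 ∧ v y < kelvin L v y) : False := by
  have hy₀0 : y₀ ≠ 0 := by
    rintro rfl
    simp at hy₀
    linarith
  have hne : ∀ᶠ y in 𝓝 y₀, y ≠ 0 := continuousAt_id.eventually_ne hy₀0
  have hK : ∀ᶠ y in 𝓝 y₀, ContDiffAt ℝ 2 (kelvin L v) y :=
    hne.mono fun y hy => hv.contDiffAt_kelvin L hy
  have hw : ∀ᶠ y in 𝓝 y₀, ContDiffAt ℝ 2 (fun y => kelvin L v y - v y) y :=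
    hK.mono fun y hy => hy.sub hv.contDiff.contDiffAt
  have hder : fderiv ℝ (kelvin L v) y₀ = fderiv ℝ v y₀ := by
    rw [fderiv_fun_sub (hK.self_of_nhds.differentiableAt (by norm_num))
      (hv.contDiff.contDiffAt.differentiableAt (by norm_num)), sub_eq_zero] at hd
    exact hd
  have hhess := hess_nonneg_of_exterior_min hw.self_of_nhds hy₀0 hy₀
    (by simp only [h0, sub_self]) hd (fun y hy => sub_nonneg.2 (hle y hy))
  obtain ⟨κ, hκ, K, hlin⟩ := hE.linearization_at_contact (q := q) (S := {y | L ≤ ‖y‖ ^ 2})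
    hv.contDiff hK (hv.jetAt_mem y₀) (hv.kelvin_mem hE hL hy₀0) h0 hder hhess
    (Eventually.of_forall fun y hy => hv.jetOp_kelvin_le hE hq hL hy)
  have := hopf_boundary_point hR hz hκ hw (by simp only [h0, sub_self])
    (Eventually.of_forall fun y hy hne => sub_pos.2 (hball y hy hne).2)
    (hlin.mono fun y hy hyz => hy (hball y hyz.le (by rintro rfl; linarith)).1)
  rw [hd] at this
  exact lt_irrefl _ this

/-- The strong maximum principle. If `p` near `x` were not a contact point, the ball about `p`
reaching the nearest contact point `y₀` would be free of contact inside, and `y₀` is a flat contact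
because it is an interior minimum. -/
theorem IsEntireSolution.eventually_contact (hE : EllipticOperator U F)
    (hv : IsEntireSolution U F q v) (hq : 0 ≤ q) {L : ℝ} (hL : 0 < L)
    (hle : ∀ y, L ≤ ‖y‖ ^ 2 → v y ≤ kelvin L v y) {x : EuclideanSpace ℝ (Fin n)}
    (hx : L < ‖x‖ ^ 2) (h0 : kelvin L v x = v x) : ∀ᶠ y in 𝓝 x, kelvin L v y = v y := by
  have hopen : IsOpen {y : EuclideanSpace ℝ (Fin n) | L < ‖y‖ ^ 2} :=
    isOpen_lt continuous_const (by fun_prop)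
  obtain ⟨δ, hδ, hδs⟩ := Metric.nhds_basis_closedBall.mem_iff.1 (hopen.mem_nhds hx)
  have hne0 : ∀ y : EuclideanSpace ℝ (Fin n), L < ‖y‖ ^ 2 → y ≠ 0 := fun y hy h => by
    rw [h] at hy
    simp at hy
    linarith
  have hcont : ContinuousOn (fun y => kelvin L v y - v y) (Metric.closedBall x δ) := fun y hy =>
    ((hv.contDiffAt_kelvin L (hne0 y (hδs hy))).sub
      hv.contDiff.contDiffAt).continuousAt.continuousWithinAt
  have hZc : IsCompact (Metric.closedBall x δ ∩ {y | kelvin L v y - v y = 0}) :=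
    (isCompact_closedBall x δ).of_isClosed_subset
      (hcont.preimage_isClosed_of_isClosed Metric.isClosed_closedBall isClosed_singleton)
      Set.inter_subset_left
  have hxZ : x ∈ Metric.closedBall x δ ∩ {y | kelvin L v y - v y = 0} :=
    ⟨Metric.mem_closedBall_self hδ.le, by simp [h0]⟩
  filter_upwards [Metric.ball_mem_nhds x (half_pos hδ)] with p hp
  by_contra hpne
  obtain ⟨y₀, hy₀, hmin⟩ := hZc.exists_isMinOn ⟨x, hxZ⟩
    (f := fun y => ‖y - p‖) (by fun_prop)
  set R := ‖y₀ - p‖ with hRdef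
  have hRx : R ≤ ‖x - p‖ := hmin hxZ
  rw [mem_ball_iff_norm, norm_sub_rev] at hp
  have hc0 : kelvin L v y₀ = v y₀ := sub_eq_zero.1 hy₀.2
  have hR0 : 0 < R := by
    refine norm_pos_iff.2 (sub_ne_zero.2 ?_)
    rintro rfl
    exact hpne hc0
  have hin : ∀ y, ‖y - p‖ < R → L < ‖y‖ ^ 2 ∧ v y < kelvin L v y := fun y hy => by
    have hyx : y ∈ Metric.closedBall x δ := by
      rw [mem_closedBall_iff_norm]
      have := norm_sub_le_norm_sub_add_norm_sub y p x
      rw [norm_sub_rev p x] at this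
      linarith
    refine ⟨hδs hyx, lt_of_le_of_ne (hle y (le_of_lt (hδs hyx))) fun heq => ?_⟩
    have : R ≤ ‖y - p‖ := hmin ⟨hyx, by simp [heq]⟩
    linarith
  have hy₀L : L < ‖y₀‖ ^ 2 := hδs hy₀.1
  -- The ball of half the radius, internally tangent at `y₀`, meets the contact set only at `y₀`,
  -- even on its boundary.
  refine hv.no_flat_contact hE hq hL hle (y₀ := y₀) (z := (1 / 2 : ℝ) • (p + y₀)) (R := R / 2)
    hy₀L.le hc0 ?_ (by linarith) ?_ fun y hy hne => ?_
  · refine IsLocalMin.fderiv_eq_zero ?_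
    filter_upwards [hopen.mem_nhds hy₀L] with y hy
    rw [hc0, sub_self, sub_nonneg]
    exact hle y (le_of_lt hy)
  · rw [show y₀ - (1 / 2 : ℝ) • (p + y₀) = (1 / 2 : ℝ) • (y₀ - p) by module, norm_smul]
    norm_num
    ring
  · have hpar := parallelogram_law_with_norm ℝ (y - (1 / 2 : ℝ) • (p + y₀)) ((1 / 2 : ℝ) • (p - y₀))
    rw [show y - (1 / 2 : ℝ) • (p + y₀) + (1 / 2 : ℝ) • (p - y₀) = y - y₀ by module,
      show y - (1 / 2 : ℝ) • (p + y₀) - (1 / 2 : ℝ) • (p - y₀) = y - p by module, norm_smul,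
      norm_sub_rev p y₀, ← hRdef] at hpar
    norm_num at hpar
    have hyy : 0 < ‖y - y₀‖ := norm_pos_iff.2 (sub_ne_zero.2 hne)
    have hlt : ‖y - p‖ < R := by
      norm_num at hy
      have h1 := mul_self_le_mul_self (norm_nonneg _) hy
      nlinarith [mul_pos hyy hyy, norm_nonneg (y - p)]
    exact ⟨(hin y hlt).1.le, (hin y hlt).2⟩

/-- Contact would spread along the ray from `x` to infinity: strictness at infinity gives a last
contact point on the ray, and contact being open moves it further out. -/
theorem IsEntireSolution.lt_kelvin (hE : EllipticOperator U F)
    (hv : IsEntireSolution U F q v) (hq : 0 ≤ q) {L : ℝ} (hL : 0 < L)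
    (hle : ∀ y, L ≤ ‖y‖ ^ 2 → v y ≤ kelvin L v y)
    (hinf : ∃ R, ∀ y : EuclideanSpace ℝ (Fin n), R < ‖y‖ → v y < kelvin L v y)
    {x : EuclideanSpace ℝ (Fin n)} (hx : L < ‖x‖ ^ 2) : v x < kelvin L v x := by
  refine lt_of_le_of_ne (hle x hx.le) fun heq => ?_
  obtain ⟨R, hR⟩ := hinf
  have hx0 : x ≠ 0 := by
    rintro rfl
    simp at hx
    linarith
  have hxn : 0 < ‖x‖ := norm_pos_iff.2 hx0
  have hcont : ContinuousOn (fun t : ℝ => kelvin L v (t • x) - v (t • x)) (Set.Ici 1) :=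
    fun t ht => by
    have ht : (1:ℝ) ≤ t := ht
    have h1 : t • x ≠ 0 := smul_ne_zero (by linarith) hx0
    have h2 : ContinuousAt (fun y => kelvin L v y - v y) (t • x) :=
      ((hv.contDiffAt_kelvin L h1).sub hv.contDiff.contDiffAt).continuousAt
    have h3 : ContinuousAt (fun t : ℝ => t • x) t := by fun_prop
    exact (ContinuousAt.comp (f := fun t : ℝ => t • x) h2 h3).continuousWithinAt
  set T := Set.Ici (1:ℝ) ∩ (fun t : ℝ => kelvin L v (t • x) - v (t • x)) ⁻¹' {0} with hT
  have hTclosed : IsClosed T := hcont.preimage_isClosed_of_isClosed isClosed_Ici isClosed_singleton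
  have hTc : IsCompact T := by
    refine (isCompact_Icc (a := (1:ℝ)) (b := max 1 (R / ‖x‖))).of_isClosed_subset hTclosed ?_
    rintro t ⟨ht1, ht2⟩
    refine ⟨ht1, le_max_of_le_right ?_⟩
    have ht1 : (1:ℝ) ≤ t := ht1
    by_contra! h
    rw [div_lt_iff₀ hxn] at h
    have := hR (t • x) (by rwa [norm_smul, Real.norm_eq_abs, abs_of_pos (by linarith)])
    have ht2 : kelvin L v (t • x) - v (t • x) = 0 := ht2
    linarith
  obtain ⟨t, ⟨ht1, ht2⟩, htmax⟩ := hTc.exists_isGreatest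
    ⟨1, Set.mem_Ici.2 le_rfl, by simp [heq]⟩
  have ht1 : (1:ℝ) ≤ t := ht1
  have ht2 : kelvin L v (t • x) - v (t • x) = 0 := ht2
  have htx : L < ‖t • x‖ ^ 2 := by
    rw [norm_smul, mul_pow, Real.norm_eq_abs, sq_abs]
    nlinarith [sq_nonneg ‖x‖, mul_self_le_mul_self zero_le_one ht1]
  have hev := hv.eventually_contact hE hq hL hle htx (sub_eq_zero.1 ht2)
  have h3 : ContinuousAt (fun t : ℝ => t • x) t := by fun_prop
  have hev' : ∀ᶠ s in 𝓝[>] t, kelvin L v (s • x) = v (s • x) :=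
    nhdsWithin_le_nhds (h3.eventually hev)
  obtain ⟨s, hs1, hs2⟩ := (hev'.and self_mem_nhdsWithin).exists
  have hs2 : t < s := hs2
  have : s ≤ t := htmax ⟨Set.mem_Ici.2 (by linarith), by simp [hs1]⟩
  linarith

/-- On the sphere the gradient of `v_L - v` is `(2/L)(v - Dv(x)x) x`. If this factor were not
positive, the one-sided minimum would make it zero, a flat contact. -/
theorem IsEntireSolution.fderiv_self_lt (hE : EllipticOperator U F)
    (hv : IsEntireSolution U F q v) (hq : 0 ≤ q) {L : ℝ} (hL : 0 < L)
    (hle : ∀ y, L ≤ ‖y‖ ^ 2 → v y ≤ kelvin L v y)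
    (hinf : ∃ R, ∀ y : EuclideanSpace ℝ (Fin n), R < ‖y‖ → v y < kelvin L v y)
    {x : EuclideanSpace ℝ (Fin n)} (hx : ‖x‖ ^ 2 = L) : fderiv ℝ v x x < v x := by
  have hx0 : x ≠ 0 := by
    rintro rfl
    simp at hx
    linarith
  have hxn : 0 < ‖x‖ := norm_pos_iff.2 hx0
  have hinv : inv0 L x = x := by rw [inv0, hx, div_self hL.ne', one_smul]
  have hc0 : kelvin L v x = v x := by rw [kelvin, hinv, hx, div_self hL.ne', one_mul]
  have hK := hv.contDiffAt_kelvin L hx0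
  have hKd := hK.differentiableAt (by norm_num)
  have hvd : DifferentiableAt ℝ v x := hv.contDiff.contDiffAt.differentiableAt (by norm_num)
  have hfd : ∀ e, fderiv ℝ (fun y => kelvin L v y - v y) x e =
      2 * inner ℝ x e / L * (v x - fderiv ℝ v x x) := fun e => by
    rw [fderiv_fun_sub hKd hvd, sub_apply, fderiv_kelvin hx0 hL.ne' (by rwa [hinv]), hinv, refl0,
      map_sub, map_smul, hx, smul_eq_mul]
    ring
  by_contra! hge
  have hflat : v x - fderiv ℝ v x x = 0 := by
    refine le_antisymm (by linarith) ?_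
    have hdw : HasDerivAt (fun t : ℝ => kelvin L v (x + t • x) - v (x + t • x))
        (fderiv ℝ (fun y => kelvin L v y - v y) x x) 0 := by
      refine HasFDerivAt.comp_hasDerivAt (l := fun y => kelvin L v y - v y)
        (f := fun t : ℝ => x + t • x) (0:ℝ) ?_ (hasDerivAt_line x x 0)
      rw [zero_smul, add_zero]
      exact (hKd.sub hvd).hasFDerivAt
    have := deriv_nonneg_of_right_min hdw (by
      filter_upwards [self_mem_nhdsWithin] with t ht
      have ht : (0:ℝ) < t := ht
      rw [zero_smul, add_zero, hc0, sub_self, sub_nonneg]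
      refine hle _ ?_
      rw [show x + t • x = (1 + t) • x by module, norm_smul, mul_pow, Real.norm_eq_abs, sq_abs, hx]
      nlinarith [mul_pos ht hL, mul_pos (mul_pos ht ht) hL])
    rw [hfd, real_inner_self_eq_norm_sq, hx, mul_div_assoc, div_self hL.ne'] at this
    linarith
  -- The ball of radius `|x|` about `2x` lies outside the sphere and touches it only at `x`.
  refine hv.no_flat_contact hE hq hL hle (y₀ := x) (z := (2:ℝ) • x) (R := ‖x‖) hx.ge hc0 ?_ hxn ?_
    fun y hy hne => ?_
  · ext e
    rw [hfd, hflat, mul_zero]; rfl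
  · rw [show x - (2:ℝ) • x = -x by module, norm_neg]
  · have hpar := parallelogram_law_with_norm ℝ (y - x) x
    rw [sub_add_cancel, show y - x - x = y - (2:ℝ) • x by module] at hpar
    have hyy : 0 < ‖y - x‖ := norm_pos_iff.2 (sub_ne_zero.2 hne)
    have hlt : L < ‖y‖ ^ 2 := by
      have h1 := mul_self_le_mul_self (norm_nonneg _) hy
      nlinarith [mul_pos hyy hyy]
    exact ⟨hlt.le, hv.lt_kelvin hE hq hL hle hinf hlt⟩

end StrongMaximum

/-! ### Starting, continuing and stopping the spheres. -/

section MovingSpheres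

variable {n : ℕ}

/-- `v` lies below its Kelvin transform outside the ball of radius `√L`. -/
def BelowKelvin (L : ℝ) (v : EuclideanSpace ℝ (Fin n) → ℝ) : Prop :=
  ∀ y, L ≤ ‖y‖ ^ 2 → v y ≤ kelvin L v y

theorem norm_inv0 {L : ℝ} (hL : 0 ≤ L) (y : EuclideanSpace ℝ (Fin n)) :
    ‖inv0 L y‖ = L / ‖y‖ := by
  rw [inv0, norm_smul, Real.norm_eq_abs, abs_of_nonneg (by positivity)]
  rcases eq_or_ne ‖y‖ 0 with h | h
  · simp [h]
  · field_simp

/-- The derivative of `t⁻¹ v(t y)` is `t⁻² (Dv(ty)(ty) - v(ty)) ≤ 0`. With `c = L/|y|²` the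
conclusion is `v ≤ v_L` at `y`. -/
theorem le_inv_mul_of_fderiv_self_le {v : EuclideanSpace ℝ (Fin n) → ℝ}
    (hv : Differentiable ℝ v) {S : Set (EuclideanSpace ℝ (Fin n))} (hS : Convex ℝ S)
    (hd : ∀ y ∈ S, fderiv ℝ v y y ≤ v y) {y : EuclideanSpace ℝ (Fin n)} {c : ℝ} (hc : 0 < c)
    (hc1 : c ≤ 1) (hy : y ∈ S) (hcy : c • y ∈ S) : v y ≤ c⁻¹ * v (c • y) := by
  have hmem : ∀ t ∈ Set.Icc c 1, t • y ∈ S := fun t ht => by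
    have h := hS.segment_subset hcy hy
    refine h ?_
    rcases eq_or_lt_of_le hc1 with h1 | h1
    · have : t = 1 := le_antisymm ht.2 (h1 ▸ ht.1)
      rw [this, one_smul]
      exact right_mem_segment ℝ _ _
    · refine ⟨(1 - t) / (1 - c), (t - c) / (1 - c), div_nonneg (sub_nonneg.2 ht.2) (by linarith),
        div_nonneg (sub_nonneg.2 ht.1) (by linarith), ?_, ?_⟩
      · rw [← add_div, div_eq_one_iff_eq (by linarith)]; ring
      · rw [smul_smul, ← add_smul]
        congr 1
        have : 1 - c ≠ 0 := by linarith
        field_simp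
        ring
  have hder : ∀ t : ℝ, 0 < t → HasDerivAt (fun t : ℝ => t⁻¹ * v (t • y))
      ((t ^ 2)⁻¹ * (fderiv ℝ v (t • y) (t • y) - v (t • y))) t := fun t ht => by
    have h1 : HasDerivAt (fun t : ℝ => v (t • y)) (fderiv ℝ v (t • y) y) t := by
      refine HasFDerivAt.comp_hasDerivAt (l := v) (f := fun t : ℝ => t • y) t (hv _).hasFDerivAt ?_
      simpa using (hasDerivAt_id t).smul_const y
    refine ((hasDerivAt_inv ht.ne').mul h1).congr_deriv ?_
    rw [map_smul, smul_eq_mul]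
    field_simp
    ring
  have hanti : AntitoneOn (fun t : ℝ => t⁻¹ * v (t • y)) (Set.Icc c 1) := by
    refine antitoneOn_of_deriv_nonpos (convex_Icc c 1) ?_ ?_ ?_
    · exact fun t ht => (hder t (hc.trans_le ht.1)).continuousAt.continuousWithinAt
    · exact fun t ht => (hder t (hc.trans_le
        (interior_subset ht).1)).differentiableAt.differentiableWithinAt
    · intro t ht
      have ht := interior_subset ht
      rw [(hder t (hc.trans_le ht.1)).deriv]
      exact mul_nonpos_of_nonneg_of_nonpos (by positivity) (sub_nonpos.2 (hd _ (hmem t ht)))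
  simpa using hanti (Set.left_mem_Icc.2 hc1) (Set.right_mem_Icc.2 hc1) hc1

variable {U : Set (SymMat n)} {F : SymMat n → ℝ} {q : ℝ} {v : EuclideanSpace ℝ (Fin n) → ℝ}

theorem IsEntireSolution.eventually_fderiv_self_lt (hv : IsEntireSolution U F q v)
    {x : EuclideanSpace ℝ (Fin n)} (hx : fderiv ℝ v x x < v x) :
    ∀ᶠ y in 𝓝 x, fderiv ℝ v y y < v y := by
  have h1 : Continuous fun y => fderiv ℝ v y y :=
    (hv.contDiff.continuous_fderiv (by norm_num)).clm_apply continuous_id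
  exact (h1.tendsto x).eventually_lt (hv.contDiff.continuous.tendsto x) hx

theorem kelvin_eq_inv_mul {L : ℝ} (v : EuclideanSpace ℝ (Fin n) → ℝ)
    (y : EuclideanSpace ℝ (Fin n)) :
    kelvin L v y = (L / ‖y‖ ^ 2)⁻¹ * v ((L / ‖y‖ ^ 2) • y) := by
  rw [kelvin, inv0, inv_div]

/-- Near `0` one has `Dv(y)y < v(y)`, since the left side vanishes at `0`, and radial monotonicity
applies. Away from `0`, `v_L` is at least `|y|² v(0)/(2L)`, which beats the quadratic growth of `v`
for small `L`. -/
theorem IsEntireSolution.exists_belowKelvin (hv : IsEntireSolution U F q v) :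
    ∃ L₀ > 0, ∀ L, 0 < L → L < L₀ → BelowKelvin L v := by
  obtain ⟨C, hC⟩ := hv.growth
  have h0 := hv.pos 0
  have e1 := hv.eventually_fderiv_self_lt (x := 0) (by simpa using h0)
  have e2 : ∀ᶠ y in 𝓝 (0 : EuclideanSpace ℝ (Fin n)), v 0 / 2 < v y :=
    hv.contDiff.continuous.continuousAt.eventually_const_lt (by linarith)
  obtain ⟨r, hr, hball⟩ := Metric.eventually_nhds_iff_ball.1 (e1.and e2)
  have hC0 : 0 < C := by
    have := (hv.pos 0).trans_le (hC 0)
    simpa using this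
  set C' := C * (1 + 1 / r ^ 2) with hC'
  have hC'0 : 0 < C' := by positivity
  refine ⟨min (r ^ 2) (v 0 / 2 / C'), lt_min (by positivity) (by positivity),
    fun L hL hL0 y hy => ?_⟩
  have hL1 : L < r ^ 2 := hL0.trans_le (min_le_left _ _)
  have hL2 : L < v 0 / 2 / C' := hL0.trans_le (min_le_right _ _)
  have hy0 : 0 < ‖y‖ := by
    rcases (norm_nonneg y).eq_or_lt with h | h
    · rw [← h] at hy
      simp at hy
      linarith
    · exact h
  have hinv : ‖inv0 L y‖ = L / ‖y‖ := norm_inv0 hL.le y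
  rcases lt_or_ge ‖y‖ r with hyr | hyr
  · rw [kelvin_eq_inv_mul]
    have hc1 : L / ‖y‖ ^ 2 ≤ 1 := (div_le_one (by positivity)).2 hy
    refine le_inv_mul_of_fderiv_self_le (hv.contDiff.differentiable (by norm_num))
      (convex_ball (0 : EuclideanSpace ℝ (Fin n)) r) (fun y hy => (hball y hy).1.le)
      (by positivity) hc1 (by simpa using hyr) ?_
    rw [mem_ball_zero_iff, norm_smul, Real.norm_eq_abs, abs_of_pos (by positivity)]
    exact (mul_le_of_le_one_left hy0.le hc1).trans_lt hyr
  · have h1 : inv0 L y ∈ Metric.ball (0 : EuclideanSpace ℝ (Fin n)) r := by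
      rw [mem_ball_zero_iff, hinv, div_lt_iff₀ hy0]
      nlinarith
    have h2 := (hball _ h1).2
    have h3 : v y ≤ C' * ‖y‖ ^ 2 := by
      refine (hC y).trans ?_
      rw [hC', mul_assoc]
      refine mul_le_mul_of_nonneg_left ?_ hC0.le
      have : 1 ≤ 1 / r ^ 2 * ‖y‖ ^ 2 := by
        rw [one_div, ← div_eq_inv_mul, one_le_div (by positivity)]
        exact pow_le_pow_left₀ hr.le hyr 2
      linarith
    rw [lt_div_iff₀ hC'0] at hL2
    refine h3.trans ?_
    rw [kelvin, div_mul_eq_mul_div, le_div_iff₀ hL]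
    have : ‖y‖ ^ 2 * (L * C') ≤ ‖y‖ ^ 2 * v (inv0 L y) :=
      mul_le_mul_of_nonneg_left (hL2.trans h2).le (by positivity)
    linarith

theorem continuousAt_inv0 (L : ℝ) {y : EuclideanSpace ℝ (Fin n)} (hy : y ≠ 0) :
    ContinuousAt (fun p : ℝ × EuclideanSpace ℝ (Fin n) => inv0 p.1 p.2) (L, y) := by
  have hy2 : ‖y‖ ^ 2 ≠ 0 := by simpa using hy
  have h1 : ContinuousAt (fun p : ℝ × EuclideanSpace ℝ (Fin n) => p.1 / ‖p.2‖ ^ 2) (L, y) :=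
    ContinuousAt.div (by fun_prop) (by fun_prop) hy2
  exact h1.smul continuousAt_snd

theorem IsEntireSolution.continuousAt_kelvin (hv : IsEntireSolution U F q v) {L : ℝ} (hL : L ≠ 0)
    {y : EuclideanSpace ℝ (Fin n)} (hy : y ≠ 0) :
    ContinuousAt (fun p : ℝ × EuclideanSpace ℝ (Fin n) => kelvin p.1 v p.2) (L, y) := by
  have h1 : ContinuousAt (fun p : ℝ × EuclideanSpace ℝ (Fin n) => ‖p.2‖ ^ 2 / p.1) (L, y) :=
    ContinuousAt.div (by fun_prop) (by fun_prop) hL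
  exact h1.mul (hv.contDiff.continuous.continuousAt.comp (continuousAt_inv0 L hy))

theorem IsEntireSolution.belowKelvin_of_lt (hv : IsEntireSolution U F q v) {L : ℝ} (hL : 0 < L)
    (h : ∀ L', 0 < L' → L' < L → BelowKelvin L' v) : BelowKelvin L v := by
  intro y hy
  have hy0 : y ≠ 0 := by
    rintro rfl
    simp at hy
    linarith
  have hc : ContinuousAt (fun L' : ℝ => kelvin L' v y) L :=
    ContinuousAt.comp (f := fun L' : ℝ => (L', y)) (hv.continuousAt_kelvin hL.ne' hy0)
      (by fun_prop)
  have ht : Tendsto (fun L' : ℝ => kelvin L' v y) (𝓝[<] L) (𝓝 (kelvin L v y)) :=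
    hc.tendsto.mono_left nhdsWithin_le_nhds
  refine ge_of_tendsto ht ?_
  filter_upwards [self_mem_nhdsWithin, nhdsWithin_le_nhds (lt_mem_nhds hL)] with L' h1 h2
  have h1 : L' < L := h1
  exact h L' h2 h1 y (by linarith)

/-- `v_L(y)/|y|²` is `v/L` at the inverted point, which tends to `0` as `y` goes to infinity,
uniformly for `L'` near `L`. -/
theorem IsEntireSolution.exists_pos_bound_at_infinity (hv : IsEntireSolution U F q v) {L b : ℝ}
    (hL : 0 < L) (hb : b < v 0 / L) : ∃ δ > 0, ∃ R, ∀ L', |L' - L| < δ → 0 < L' ∧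
      ∀ y : EuclideanSpace ℝ (Fin n), R < ‖y‖ → b * ‖y‖ ^ 2 < kelvin L' v y := by
  have hc : ContinuousAt (fun p : ℝ × EuclideanSpace ℝ (Fin n) => v p.2 / p.1) (L, 0) :=
    ContinuousAt.div (hv.contDiff.continuous.continuousAt.comp continuousAt_snd)
      continuousAt_fst hL.ne'
  obtain ⟨δ, hδ, hball⟩ := Metric.eventually_nhds_iff_ball.1 (hc.eventually_const_lt hb)
  set δ' := min δ (L / 2) with hδ'
  have hδ'0 : 0 < δ' := lt_min hδ (by linarith)
  refine ⟨δ', hδ'0, 2 * L / δ, fun L' hL' => ?_⟩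
  have h1 := abs_lt.1 (hL'.trans_le (min_le_right _ _))
  have hL'0 : 0 < L' := by linarith
  refine ⟨hL'0, fun y hy => ?_⟩
  have hy0 : 0 < ‖y‖ := lt_of_le_of_lt (by positivity) hy
  have hin : (L', inv0 L' y) ∈ Metric.ball ((L, 0) : ℝ × EuclideanSpace ℝ (Fin n)) δ := by
    rw [← ball_prod_same, Set.mem_prod]
    refine ⟨?_, ?_⟩
    · rw [Metric.mem_ball, Real.dist_eq]
      exact hL'.trans_le (min_le_left _ _)
    · rw [mem_ball_zero_iff, norm_inv0 hL'0.le, div_lt_iff₀ hy0]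
      rw [div_lt_iff₀ hδ] at hy
      linarith
  have := hball _ hin
  simp only at this
  rw [kelvin, div_mul_eq_mul_div, mul_div_assoc, mul_comm b]
  exact mul_lt_mul_of_pos_left this (by positivity)

/-- Strictness at infinity keeps the violating points for `L'` decreasing to `L` bounded. Their
limit cannot lie outside the sphere, by the strong maximum principle. If it is on the sphere, the
strict radial derivative holds in a ball that eventually contains both the points and their
inverses, so radial monotonicity forbids the violation. -/
theorem IsEntireSolution.belowKelvin_extends (hE : EllipticOperator U F)
    (hv : IsEntireSolution U F q v) (hq : 0 ≤ q) {L : ℝ} (hL : 0 < L) (hle : BelowKelvin L v)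
    {b R₀ : ℝ} (hb : b < v 0 / L) (hR₀ : ∀ y : EuclideanSpace ℝ (Fin n), R₀ < ‖y‖ →
      v y ≤ b * ‖y‖ ^ 2) : ∃ ε > 0, ∀ L', L ≤ L' → L' < L + ε → BelowKelvin L' v := by
  obtain ⟨δ, hδ, R, hR⟩ := hv.exists_pos_bound_at_infinity hL hb
  set R₁ := max R₀ R with hR₁
  have hfar : ∀ L', |L' - L| < δ → ∀ y : EuclideanSpace ℝ (Fin n), R₁ < ‖y‖ →
      v y < kelvin L' v y := fun L' hL' y hy =>
    (hR₀ y ((le_max_left _ _).trans_lt hy)).trans_lt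
      ((hR L' hL').2 y ((le_max_right _ _).trans_lt hy))
  have hinf : ∃ R, ∀ y : EuclideanSpace ℝ (Fin n), R < ‖y‖ → v y < kelvin L v y :=
    ⟨R₁, hfar L (by simpa using hδ)⟩
  by_contra! hcon
  have hseq : ∀ k : ℕ, ∃ p : ℝ × EuclideanSpace ℝ (Fin n), L ≤ p.1 ∧ p.1 < L + δ / (k + 1) ∧
      p.1 ≤ ‖p.2‖ ^ 2 ∧ kelvin p.1 v p.2 < v p.2 := fun k => by
    obtain ⟨L', h1, h2, h3⟩ := hcon (δ / (k + 1)) (by positivity)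
    rw [BelowKelvin] at h3
    push Not at h3
    obtain ⟨y, h4, h5⟩ := h3
    exact ⟨(L', y), h1, h2, h4, h5⟩
  choose p hp1 hp2 hp3 hp4 using hseq
  have hpδ : ∀ k, |(p k).1 - L| < δ := fun k => by
    rw [abs_of_nonneg (sub_nonneg.2 (hp1 k))]
    have : δ / (k + 1) ≤ δ := div_le_self hδ.le (by simp)
    linarith [hp2 k]
  have hbdd : ∀ k, (p k).2 ∈ Metric.closedBall (0 : EuclideanSpace ℝ (Fin n)) R₁ := fun k => by
    rw [mem_closedBall_zero_iff]
    by_contra! h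
    exact absurd (hfar _ (hpδ k) _ h) (not_lt.2 (hp4 k).le)
  obtain ⟨y, -, φ, hφ, hy⟩ := (isCompact_closedBall _ _).tendsto_subseq hbdd
  have hLlim : Tendsto (fun k => (p k).1) atTop (𝓝 L) := by
    have h1 : Tendsto (fun k : ℕ => L + δ / ((k : ℝ) + 1)) atTop (𝓝 L) := by
      have := (tendsto_one_div_add_atTop_nhds_zero_nat (𝕜 := ℝ)).const_mul δ
      simpa [div_eq_mul_inv] using this.const_add L
    exact tendsto_of_tendsto_of_tendsto_of_le_of_le tendsto_const_nhds h1 hp1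
      fun k => (hp2 k).le
  have hLφ : Tendsto (fun k => (p (φ k)).1) atTop (𝓝 L) := hLlim.comp hφ.tendsto_atTop
  have hyφ : Tendsto (fun k => (p (φ k)).2) atTop (𝓝 y) := hy
  have hpφ : Tendsto (fun k => p (φ k)) atTop (𝓝 (L, y)) := hLφ.prodMk_nhds hyφ
  have hyL : L ≤ ‖y‖ ^ 2 := le_of_tendsto_of_tendsto' hLφ (hyφ.norm.pow 2) fun k => hp3 _
  have hy0 : y ≠ 0 := by
    rintro rfl
    simp at hyL
    linarith
  have hge : kelvin L v y ≤ v y := le_of_tendsto_of_tendsto'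
    ((hv.continuousAt_kelvin hL.ne' hy0).tendsto.comp hpφ)
    ((hv.contDiff.continuous.tendsto y).comp hyφ) fun k => (hp4 _).le
  have hyeq : ‖y‖ ^ 2 = L := by
    refine le_antisymm ?_ hyL
    by_contra! h
    exact absurd (hv.lt_kelvin hE hq hL hle hinf h) (not_lt.2 hge)
  have hrad := hv.fderiv_self_lt hE hq hL hle hinf hyeq
  obtain ⟨r, hr, hball⟩ := Metric.eventually_nhds_iff_ball.1 (hv.eventually_fderiv_self_lt hrad)
  have hinv := continuousAt_inv0 L hy0
  have hinvy : inv0 L y = y := by rw [inv0, hyeq, div_self hL.ne', one_smul]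
  have e1 : ∀ᶠ k in atTop, (p (φ k)).2 ∈ Metric.ball y r := hyφ.eventually_mem
    (Metric.ball_mem_nhds _ hr)
  have e2 : ∀ᶠ k in atTop, inv0 (p (φ k)).1 (p (φ k)).2 ∈ Metric.ball y r := by
    have := hinv.tendsto.comp hpφ
    rw [hinvy] at this
    exact this.eventually_mem (Metric.ball_mem_nhds _ hr)
  obtain ⟨k, hk1, hk2⟩ := (e1.and e2).exists
  have hLk : 0 < (p (φ k)).1 := hL.trans_le (hp1 _)
  have hnk : 0 < ‖(p (φ k)).2‖ ^ 2 := hLk.trans_le (hp3 _)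
  have hmono := le_inv_mul_of_fderiv_self_le (hv.contDiff.differentiable (by norm_num))
    (convex_ball y r) (fun y hy => (hball y hy).le) (div_pos hLk hnk)
    ((div_le_one hnk).2 (hp3 _)) hk1 hk2
  rw [← kelvin_eq_inv_mul] at hmono
  exact absurd (hp4 (φ k)) (not_lt.2 hmono)

/-- The moving sphere alternative: the spheres never stop, or they stop because of the
behaviour of `v` at infinity. -/
theorem IsEntireSolution.moving_spheres (hE : EllipticOperator U F)
    (hv : IsEntireSolution U F q v) (hq : 0 ≤ q) :
    (∀ L, 0 < L → BelowKelvin L v) ∨ ∃ L > 0, BelowKelvin L v ∧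
      ∀ b < v 0 / L, ∀ R, ∃ y : EuclideanSpace ℝ (Fin n), R < ‖y‖ ∧ b * ‖y‖ ^ 2 < v y := by
  by_cases hall : ∀ L, 0 < L → BelowKelvin L v
  · exact Or.inl hall
  right
  push Not at hall
  obtain ⟨L₁, hL₁, hnot⟩ := hall
  -- At the supremum of `A`, a gap `b < v 0 / L` at infinity would let the spheres continue.
  set A : Set ℝ := {L | 0 < L ∧ ∀ L', 0 < L' → L' < L → BelowKelvin L' v} with hA
  obtain ⟨L₀, hL₀, hstart⟩ := hv.exists_belowKelvin
  have hL₀A : L₀ ∈ A := ⟨hL₀, hstart⟩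
  have hbdd : BddAbove A := ⟨L₁, fun L hL => by
    by_contra! h
    exact hnot (hL.2 L₁ hL₁ h)⟩
  set L := sSup A with hLdef
  have hLpos : 0 < L := hL₀.trans_le (le_csSup hbdd hL₀A)
  have hlt : ∀ L', 0 < L' → L' < L → BelowKelvin L' v := fun L' h0 h1 => by
    obtain ⟨L'', hA'', h2⟩ := exists_lt_of_lt_csSup ⟨L₀, hL₀A⟩ h1
    exact hA''.2 L' h0 h2
  have hLB := hv.belowKelvin_of_lt hLpos hlt
  refine ⟨L, hLpos, hLB, ?_⟩
  by_contra! hcon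
  obtain ⟨b, hb, R₀, hR₀⟩ := hcon
  obtain ⟨ε, hε, hext⟩ := hv.belowKelvin_extends hE hq hLpos hLB hb hR₀
  have : L + ε ∈ A := ⟨by linarith, fun L' h0 h1 => by
    rcases lt_or_ge L' L with h | h
    · exact hlt L' h0 h
    · exact hext L' h h1⟩
  have := le_csSup hbdd this
  linarith

end MovingSpheres

/-! ### Barriers for superharmonic functions. -/

section Superharmonic

variable {n : ℕ}

theorem sum_fderiv_fderiv_nonneg_of_isLocalMin {w : EuclideanSpace ℝ (Fin n) → ℝ}
    {y : EuclideanSpace ℝ (Fin n)} (hw : ContDiffAt ℝ 2 w y) (hmin : IsLocalMin w y) :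
    0 ≤ Laplacian.laplacian w y := by
  rw [laplacian_eq_sum]
  refine Finset.sum_nonneg fun i _ => ?_
  refine fderiv_fderiv_nonneg_of_ray_min hw (by rw [hmin.fderiv_eq_zero]; rfl) ?_
  have hc : Tendsto (fun t : ℝ => y + t • (EuclideanSpace.single i 1 : EuclideanSpace ℝ (Fin n)))
      (𝓝[>] 0) (𝓝 y) := by
    have := (hasDerivAt_line y (EuclideanSpace.single i 1) 0).continuousAt.tendsto
    simp only [zero_smul, add_zero] at this
    exact this.mono_left nhdsWithin_le_nhds
  exact hc.eventually hmin

/-- At an interior minimum of `u - h` the Laplacian would be nonnegative, whereas it is negative;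
strictness makes the minimum principle elementary. -/
theorem le_of_strictly_subharmonic {u h : EuclideanSpace ℝ (Fin n) → ℝ}
    {K : Set (EuclideanSpace ℝ (Fin n))} (hK : IsCompact K)
    (hc : ContinuousOn (fun y => u y - h y) K)
    (H : ∀ y ∈ K, h y ≤ u y ∨ (K ∈ 𝓝 y ∧ ContDiffAt ℝ 2 u y ∧ ContDiffAt ℝ 2 h y ∧
      Laplacian.laplacian u y ≤ 0 ∧ 0 < Laplacian.laplacian h y)) :
    ∀ y ∈ K, h y ≤ u y := by
  intro y hy
  obtain ⟨x, hx, hmin⟩ := hK.exists_isMinOn ⟨y, hy⟩ hc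
  have hle : u x - h x ≤ u y - h y := hmin hy
  rcases H x hx with hb | ⟨hKx, hu, hh, h1, h2⟩
  · linarith
  · exfalso
    have hloc : IsLocalMin (fun y => u y - h y) x := hmin.isLocalMin hKx
    have h3 := sum_fderiv_fderiv_nonneg_of_isLocalMin (hu.sub hh) hloc
    have h4 : Laplacian.laplacian (fun y => u y - h y) x
        = Laplacian.laplacian u x - Laplacian.laplacian h x := by
      rw [laplacian_eq_sum, laplacian_eq_sum, laplacian_eq_sum, fderiv_fderiv_sub hu hh,
        ← Finset.sum_sub_distrib]
      rfl
    linarith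

theorem contDiffAt_norm_sq_rpow {y : EuclideanSpace ℝ (Fin n)} (hy : y ≠ 0) (s : ℝ) :
    ContDiffAt ℝ 2 (fun y : EuclideanSpace ℝ (Fin n) => (‖y‖ ^ 2) ^ s) y :=
  (contDiffAt_id.norm_sq ℝ).rpow_const_of_ne (by simpa using hy)

theorem laplacian_norm_sq_rpow {y : EuclideanSpace ℝ (Fin n)} (hy : y ≠ 0) (σ : ℝ) :
    Laplacian.laplacian (fun y : EuclideanSpace ℝ (Fin n) => (‖y‖ ^ 2) ^ (-σ)) y =
      2 * σ * (2 * σ + 2 - n) * (‖y‖ ^ 2) ^ (-σ - 1) := by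
  have hy2 : 0 < ‖y‖ ^ 2 := by positivity
  have h := (fderiv_rpow_neg (contDiffAt_norm_sub_sq 0 y) (by simpa using hy2) σ).2
  have h1 := fderiv_norm_sub_sq (0 : EuclideanSpace ℝ (Fin n)) y
  simp only [sub_zero] at h h1
  simp only [h1.1, h1.2] at h
  rw [laplacian_eq_sum]
  simp only [h]
  have hs : ∑ i, (y i) ^ 2 = ‖y‖ ^ 2 := (EuclideanSpace.real_norm_sq_eq y).symm
  have hterm : ∀ i : Fin n, σ * (σ + 1) * (‖y‖ ^ 2) ^ (-σ - 2) *
      (2 * inner ℝ y (EuclideanSpace.single i 1)) * (2 * inner ℝ y (EuclideanSpace.single i 1))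
      - σ * (‖y‖ ^ 2) ^ (-σ - 1) * (2 * inner ℝ (EuclideanSpace.single i (1:ℝ) :
        EuclideanSpace ℝ (Fin n)) (EuclideanSpace.single i 1))
      = 4 * σ * (σ + 1) * (‖y‖ ^ 2) ^ (-σ - 2) * (y i) ^ 2 - 2 * σ * (‖y‖ ^ 2) ^ (-σ - 1) :=
    fun i => by
    simp [EuclideanSpace.inner_single_right]
    ring
  simp only [hterm]
  rw [Finset.sum_sub_distrib, ← Finset.mul_sum, hs]
  have hp : (‖y‖ ^ 2) ^ (-σ - 1) = (‖y‖ ^ 2) ^ (-σ - 2) * ‖y‖ ^ 2 := by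
    rw [show -σ - 1 = -σ - 2 + 1 by ring, Real.rpow_add hy2, Real.rpow_one]
  rw [hp]
  simp
  ring

/-- For `σ > (n-2)/2` the function `|y|^(-2σ)` is strictly subharmonic. Subtracting its value at
radius `R` makes the barrier vanish on the outer sphere, where only `u > 0` is known. Then `R → ∞`,
and `σ` decreases to `(n-2)/2`. -/
theorem exists_lower_bound_of_superharmonic (hn : 3 ≤ n) {u : EuclideanSpace ℝ (Fin n) → ℝ}
    (hu : ContDiff ℝ 2 u) (hpos : ∀ y, 0 < u y) (hsup : ∀ y, Laplacian.laplacian u y ≤ 0) :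
    ∃ c > 0, ∀ y, 1 ≤ ‖y‖ → c * (‖y‖ ^ 2) ^ (-(((n : ℝ) - 2) / 2)) ≤ u y := by
  have hn' : (3:ℝ) ≤ n := by exact_mod_cast hn
  obtain ⟨c, hc, hcu⟩ : ∃ c > 0, ∀ y : EuclideanSpace ℝ (Fin n), ‖y‖ = 1 → c ≤ u y := by
    rcases (Metric.sphere (0 : EuclideanSpace ℝ (Fin n)) 1).eq_empty_or_nonempty with hE | hne
    · refine ⟨1, one_pos, fun y hy => ?_⟩
      have : y ∈ Metric.sphere (0 : EuclideanSpace ℝ (Fin n)) 1 := by simpa using hy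
      rw [hE] at this
      exact this.elim
    · obtain ⟨x, hx, hmin⟩ := (isCompact_sphere (0 : EuclideanSpace ℝ (Fin n)) 1).exists_isMinOn
        hne hu.continuous.continuousOn
      exact ⟨u x, hpos x, fun y hy => hmin (by simpa using hy)⟩
  set m := ((n : ℝ) - 2) / 2 with hm
  have hm0 : 0 < m := by rw [hm]; linarith
  refine ⟨c, hc, fun y hy => ?_⟩
  have hy0 : 0 < ‖y‖ ^ 2 := by positivity
  have step1 : ∀ σ, m < σ → ∀ R, ‖y‖ ≤ R →
      c * ((‖y‖ ^ 2) ^ (-σ) - (R ^ 2) ^ (-σ)) ≤ u y := by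
    intro σ hσ R hyR
    set K : Set (EuclideanSpace ℝ (Fin n)) := {x | 1 ≤ ‖x‖ ∧ ‖x‖ ≤ R} with hK
    have hKc : IsCompact K := by
      refine (isCompact_closedBall (0 : EuclideanSpace ℝ (Fin n)) R).of_isClosed_subset ?_ ?_
      · exact (isClosed_le continuous_const continuous_norm).inter
          (isClosed_le continuous_norm continuous_const)
      · intro x hx
        simpa using hx.2
    have hne : ∀ x ∈ K, x ≠ 0 := fun x hx h0 => by
      have := hx.1
      rw [h0, norm_zero] at this
      linarith
    have hcd : ∀ x ∈ K, ContDiffAt ℝ 2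
        (fun x : EuclideanSpace ℝ (Fin n) => c * ((‖x‖ ^ 2) ^ (-σ) - (R ^ 2) ^ (-σ))) x :=
      fun x hx => contDiffAt_const.mul
        ((contDiffAt_norm_sq_rpow (hne x hx) _).sub contDiffAt_const)
    refine le_of_strictly_subharmonic hKc (fun x hx => (hu.contDiffAt.sub
      (hcd x hx)).continuousAt.continuousWithinAt) (fun x hx => ?_) y ⟨hy, hyR⟩
    have hR0 : 0 ≤ (R ^ 2) ^ (-σ) := by positivity
    rcases hx.1.eq_or_lt with h1 | h1
    · left
      refine le_trans ?_ (hcu x h1.symm)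
      rw [← h1, one_pow, Real.one_rpow]
      nlinarith
    rcases hx.2.eq_or_lt with h2 | h2
    · left
      rw [h2, sub_self, mul_zero]
      exact (hpos x).le
    right
    refine ⟨?_, hu.contDiffAt, hcd x hx, hsup x, ?_⟩
    · have e1 : ∀ᶠ x' in 𝓝 x, 1 < ‖x'‖ := continuous_norm.continuousAt.eventually_const_lt h1
      have e2 : ∀ᶠ x' in 𝓝 x, ‖x'‖ < R := continuous_norm.continuousAt.eventually_lt_const h2
      filter_upwards [e1, e2] with x' h1' h2' using ⟨h1'.le, h2'.le⟩
    · have hx0 := hne x hx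
      have hlap : Laplacian.laplacian
          (fun x : EuclideanSpace ℝ (Fin n) => c * ((‖x‖ ^ 2) ^ (-σ) - (R ^ 2) ^ (-σ))) x =
          c * Laplacian.laplacian (fun x : EuclideanSpace ℝ (Fin n) => (‖x‖ ^ 2) ^ (-σ)) x := by
        rw [laplacian_eq_sum, laplacian_eq_sum, fderiv_fderiv_const_mul c
          ((contDiffAt_norm_sq_rpow hx0 _).sub contDiffAt_const), Finset.mul_sum]
        refine Finset.sum_congr rfl fun i _ => ?_
        have : fderiv ℝ (fun x : EuclideanSpace ℝ (Fin n) => (‖x‖ ^ 2) ^ (-σ) - (R ^ 2) ^ (-σ)) =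
            fderiv ℝ (fun x : EuclideanSpace ℝ (Fin n) => (‖x‖ ^ 2) ^ (-σ)) := by
          ext x : 1
          exact fderiv_sub_const _
        rw [this]
        rfl
      rw [hlap, laplacian_norm_sq_rpow hx0]
      have : 0 < 2 * σ + 2 - n := by rw [hm] at hσ; linarith
      have hσ0 : 0 < σ := hm0.trans hσ
      have hxp : 0 < ‖x‖ := norm_pos_iff.2 hx0
      positivity
  have step2 : ∀ σ, m < σ → c * (‖y‖ ^ 2) ^ (-σ) ≤ u y := by
    intro σ hσ
    have ht : Tendsto (fun R : ℝ => c * ((‖y‖ ^ 2) ^ (-σ) - (R ^ 2) ^ (-σ))) atTop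
        (𝓝 (c * ((‖y‖ ^ 2) ^ (-σ) - 0))) := by
      refine (tendsto_const_nhds.sub ?_).const_mul c
      exact (tendsto_rpow_neg_atTop (hm0.trans hσ)).comp (tendsto_pow_atTop two_ne_zero)
    rw [sub_zero] at ht
    refine le_of_tendsto ht ?_
    filter_upwards [eventually_ge_atTop ‖y‖] with R hR using step1 σ hσ R hR
  have hcont : Continuous fun σ : ℝ => c * (‖y‖ ^ 2) ^ (-σ) := by
    refine continuous_const.mul ?_
    exact continuous_const.rpow continuous_neg (fun _ => Or.inl hy0.ne')
  have ht : Tendsto (fun σ : ℝ => c * (‖y‖ ^ 2) ^ (-σ)) (𝓝[>] m) (𝓝 (c * (‖y‖ ^ 2) ^ (-m))) :=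
    (hcont.tendsto m).mono_left nhdsWithin_le_nhds
  refine le_of_tendsto ht ?_
  filter_upwards [self_mem_nhdsWithin] with σ hσ using step2 σ hσ

/-- The convex function `t ^ (-m)` lies above its tangent at `β`. -/
theorem rpow_neg_tangent_le {β t m : ℝ} (hβ : 0 < β) (ht : 0 < t) (hm : 0 ≤ m) :
    β ^ (-m) - m * β ^ (-m - 1) * (t - β) ≤ t ^ (-m) := by
  have h1 : 1 - m * (t / β - 1) ≤ (t / β) ^ (-m) := by
    have htβ : 0 < t / β := div_pos ht hβ
    rw [Real.rpow_def_of_pos htβ]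
    have h2 := Real.add_one_le_exp (Real.log (t / β) * -m)
    have h3 := mul_le_mul_of_nonneg_left (Real.log_le_sub_one_of_pos htβ) hm
    linarith
  have h2 : t ^ (-m) = β ^ (-m) * (t / β) ^ (-m) := by
    rw [← Real.mul_rpow hβ.le (by positivity), mul_div_cancel₀ _ hβ.ne']
  have h3 : β ^ (-m) = β ^ (-m - 1) * β := by
    rw [← Real.rpow_add_one hβ.ne']; congr 1; ring
  rw [h2]
  refine le_trans (le_of_eq ?_) (mul_le_mul_of_nonneg_left h1 (by positivity))
  rw [h3]
  field_simp

/-- The comparison function `c + ℓ(z) + a ⟨d, z⟩² + b |z|² - δ |z| ^ (-1/2)`. -/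
noncomputable def quadBarrier (c a b δ : ℝ) (p d z : EuclideanSpace ℝ (Fin n)) : ℝ :=
  c + (inner ℝ p z + (a * (inner ℝ d z) ^ 2 + (b * ‖z‖ ^ 2 + (-δ) * (‖z‖ ^ 2) ^ (-(1 / 4 : ℝ)))))

theorem contDiffAt_quadBarrier (c a b δ : ℝ) (p d : EuclideanSpace ℝ (Fin n))
    {z : EuclideanSpace ℝ (Fin n)} (hz : z ≠ 0) : ContDiffAt ℝ 2 (quadBarrier c a b δ p d) z := by
  unfold quadBarrier
  refine contDiffAt_const.add ((contDiffAt_const.inner ℝ contDiffAt_id).add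
    ((contDiffAt_const.mul ((contDiffAt_const.inner ℝ contDiffAt_id).pow 2)).add
    ((contDiffAt_const.mul (contDiffAt_id.norm_sq ℝ)).add
    (contDiffAt_const.mul (contDiffAt_norm_sq_rpow hz _)))))

theorem laplacian_quadBarrier (c a b δ : ℝ) (p d : EuclideanSpace ℝ (Fin n))
    {z : EuclideanSpace ℝ (Fin n)} (hz : z ≠ 0) :
    Laplacian.laplacian (quadBarrier c a b δ p d) z =
      2 * a * ‖d‖ ^ 2 + 2 * n * b - δ * (1 / 2 * (5 / 2 - n) * (‖z‖ ^ 2) ^ (-(1 / 4 : ℝ) - 1)) := by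
  have c1 : ContDiffAt ℝ 2 (fun z : EuclideanSpace ℝ (Fin n) => inner ℝ p z) z :=
    contDiffAt_const.inner ℝ contDiffAt_id
  have c2 : ContDiffAt ℝ 2 (fun z : EuclideanSpace ℝ (Fin n) => inner ℝ d z) z :=
    contDiffAt_const.inner ℝ contDiffAt_id
  have c3 : ContDiffAt ℝ 2 (fun z : EuclideanSpace ℝ (Fin n) => (inner ℝ d z) ^ 2) z := c2.pow 2
  have c4 : ContDiffAt ℝ 2 (fun z : EuclideanSpace ℝ (Fin n) => ‖z‖ ^ 2) z :=
    contDiffAt_id.norm_sq ℝ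
  have c5 := contDiffAt_norm_sq_rpow hz (-(1 / 4 : ℝ))
  have d1 : fderiv ℝ (fderiv ℝ (fun z : EuclideanSpace ℝ (Fin n) => inner ℝ p z)) z = 0 :=
    fderiv_fderiv_clm (innerSL ℝ p) z
  have d3 : ∀ e, fderiv ℝ (fderiv ℝ (fun z : EuclideanSpace ℝ (Fin n) => (inner ℝ d z) ^ 2)) z e e
      = 2 * (inner ℝ d e) ^ 2 := fun e => by
    have h := (fderiv_comp_real c2 (g := fun t => t ^ 2) (g' := fun t => 2 * t) (g'' := 2)
      (Eventually.of_forall fun t => by simpa using hasDerivAt_pow 2 t)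
      (by simpa using (hasDerivAt_id _).const_mul (2:ℝ))).2 e e
    have h1 : fderiv ℝ (fun z : EuclideanSpace ℝ (Fin n) => inner ℝ d z) z e = inner ℝ d e :=
      congrArg (fun ℓ : EuclideanSpace ℝ (Fin n) →L[ℝ] ℝ => ℓ e) (innerSL ℝ d).fderiv
    have h2 : fderiv ℝ (fderiv ℝ (fun z : EuclideanSpace ℝ (Fin n) => inner ℝ d z)) z = 0 :=
      fderiv_fderiv_clm (innerSL ℝ d) z
    rw [h, h1, h2]
    simp
    ring
  have d4 : ∀ e, fderiv ℝ (fderiv ℝ (fun z : EuclideanSpace ℝ (Fin n) => ‖z‖ ^ 2)) z e e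
      = 2 * inner ℝ e e := fun e => by
    have := (fderiv_norm_sub_sq 0 z).2 e e
    simpa only [sub_zero] using this
  have d5 := laplacian_norm_sq_rpow hz (1 / 4 : ℝ)
  have hd : ∑ i, (d i) ^ 2 = ‖d‖ ^ 2 := (EuclideanSpace.real_norm_sq_eq d).symm
  rw [laplacian_eq_sum] at d5 ⊢
  unfold quadBarrier
  rw [fderiv_fderiv_const_add, fderiv_fderiv_add c1 ((contDiffAt_const.mul c3).add
      ((contDiffAt_const.mul c4).add (contDiffAt_const.mul c5))), d1, zero_add,
    fderiv_fderiv_add (contDiffAt_const.mul c3) ((contDiffAt_const.mul c4).add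
      (contDiffAt_const.mul c5)), fderiv_fderiv_add (contDiffAt_const.mul c4)
      (contDiffAt_const.mul c5), fderiv_fderiv_const_mul _ c3, fderiv_fderiv_const_mul _ c4,
    fderiv_fderiv_const_mul _ c5]
  simp only [add_apply, smul_apply, d3, d4, Finset.sum_add_distrib, smul_eq_mul, ← Finset.mul_sum,
    d5]
  simp [EuclideanSpace.inner_single_right, hd]
  ring

/-- Invert: `V(z) = |z|² v(z/|z|²)` satisfies `V ≤ β + ⟨p,z⟩ - |⟨d,z⟩| + ε|z|` near `0`, with `p`
and `d` half the sum and half the difference of `ξ₁` and `ξ₂`. So `W = V ^ (-m)`, superharmonic off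
the origin, lies above `β ^ (-m)` plus a linear function plus a ridge `k|⟨d,z⟩|`, up to `kε|z|`. A
harmonic quadratic polynomial below this on a small sphere has value at `0` strictly above `β ^
(-m)`. The comparison carries it to `W`, and undoing the power and the inversion gives the gap. -/
theorem exists_gap_of_two_upper_bounds (hn : 3 ≤ n) {v : EuclideanSpace ℝ (Fin n) → ℝ}
    (hv : ContDiff ℝ 2 v) (hpos : ∀ y, 0 < v y)
    (htr : ∀ y, 0 ≤ (confJet (jetAt v y) : Matrix (Fin n) (Fin n) ℝ).trace)
    {β : ℝ} (hβ : 0 < β) {ξ₁ ξ₂ : EuclideanSpace ℝ (Fin n)} (hne : ξ₁ ≠ ξ₂)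
    (h₁ : ∀ ε > 0, ∃ R, ∀ y, R < ‖y‖ → v y ≤ β * ‖y‖ ^ 2 + inner ℝ ξ₁ y + ε * ‖y‖)
    (h₂ : ∀ ε > 0, ∃ R, ∀ y, R < ‖y‖ → v y ≤ β * ‖y‖ ^ 2 + inner ℝ ξ₂ y + ε * ‖y‖) :
    ∃ b < β, ∃ R, ∀ y : EuclideanSpace ℝ (Fin n), R < ‖y‖ → v y ≤ b * ‖y‖ ^ 2 := by
  have hn' : (3:ℝ) ≤ n := by exact_mod_cast hn
  set m := ((n : ℝ) - 2) / 2 with hm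
  have hm0 : 0 < m := by rw [hm]; linarith
  set V : EuclideanSpace ℝ (Fin n) → ℝ := kelvin 1 v with hV
  have hVcd : ∀ z, z ≠ 0 → ContDiffAt ℝ 2 V z := fun z hz =>
    contDiffAt_kelvin hz hv.contDiffAt
  have hVpos : ∀ z, z ≠ 0 → 0 < V z := fun z hz => by
    have : 0 < ‖z‖ := norm_pos_iff.2 hz
    exact mul_pos (by positivity) (hpos _)
  set W : EuclideanSpace ℝ (Fin n) → ℝ := fun z => V z ^ (-m) with hW
  have hWcd : ∀ z, z ≠ 0 → ContDiffAt ℝ 2 W z := fun z hz =>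
    (hVcd z hz).rpow_const_of_ne (hVpos z hz).ne'
  have hWlap : ∀ z, z ≠ 0 → Laplacian.laplacian W z ≤ 0 := fun z hz => by
    have h1 := laplacian_rpow_neg (hVcd z hz) (hVpos z hz)
    have h2 := htr (inv0 1 z)
    rw [← trace_conj (reflOrth hz), ← confJet_kelvin hz one_ne_zero hv.contDiffAt] at h2
    rw [hW, h1, ← hm, neg_mul, neg_mul]
    exact neg_nonpos.2 (mul_nonneg (mul_nonneg hm0.le (Real.rpow_nonneg (hVpos z hz).le _)) h2)
  set d : EuclideanSpace ℝ (Fin n) := (1 / 2 : ℝ) • (ξ₁ - ξ₂) with hd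
  set p : EuclideanSpace ℝ (Fin n) := (1 / 2 : ℝ) • (ξ₁ + ξ₂) with hp
  have hd0 : 0 < ‖d‖ := norm_pos_iff.2 (smul_ne_zero (by norm_num) (sub_ne_zero.2 hne))
  have hξ1 : ξ₁ = p + d := by rw [hd, hp]; module
  have hξ2 : ξ₂ = p - d := by rw [hd, hp]; module
  -- Half of the gain `k‖d‖r/n` that the ridge yields at the origin; the error `kεr` uses up only
  -- this half.
  set ε := ‖d‖ / (2 * n) with hε
  have hε0 : 0 < ε := by positivity
  obtain ⟨R₁, hR₁⟩ := h₁ ε hε0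
  obtain ⟨R₂, hR₂⟩ := h₂ ε hε0
  set R := max (max R₁ R₂) 0 + 1 with hR
  have hR0 : 0 < R := by
    have : 0 ≤ max (max R₁ R₂) 0 := le_max_right _ _
    linarith
  have hRR₁ : R₁ < R := by
    have : R₁ ≤ max (max R₁ R₂) 0 := (le_max_left _ _).trans (le_max_left _ _)
    linarith
  have hRR₂ : R₂ < R := by
    have : R₂ ≤ max (max R₁ R₂) 0 := (le_max_right _ _).trans (le_max_left _ _)
    linarith
  set r := 1 / R with hr
  have hr0 : 0 < r := by positivity
  have hVle : ∀ z, z ≠ 0 → ‖z‖ ≤ r → V z ≤ β + inner ℝ p z - |inner ℝ d z| + ε * ‖z‖ := by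
    intro z hz hzr
    have hz0 : 0 < ‖z‖ := norm_pos_iff.2 hz
    have hnorm : ‖inv0 1 z‖ = 1 / ‖z‖ := norm_inv0 zero_le_one z
    have hRz : R ≤ ‖inv0 1 z‖ := by
      rw [hnorm, le_div_iff₀ hz0, mul_comm, ← le_div_iff₀ hR0]
      exact hzr
    have conv : ∀ ξ : EuclideanSpace ℝ (Fin n),
        v (inv0 1 z) ≤ β * ‖inv0 1 z‖ ^ 2 + inner ℝ ξ (inv0 1 z) + ε * ‖inv0 1 z‖ →
        V z ≤ β + inner ℝ ξ z + ε * ‖z‖ := fun ξ h => by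
      have h3 := mul_le_mul_of_nonneg_left h (by positivity : 0 ≤ ‖z‖ ^ 2 / 1)
      refine h3.trans (le_of_eq ?_)
      rw [hnorm, inv0, inner_smul_right]
      field_simp
    have k1 := conv ξ₁ (hR₁ _ (hRR₁.trans_le hRz))
    have k2 := conv ξ₂ (hR₂ _ (hRR₂.trans_le hRz))
    rw [hξ1, inner_add_left] at k1
    rw [hξ2, inner_sub_left] at k2
    rcases abs_cases (inner ℝ d z) with ⟨h, -⟩ | ⟨h, -⟩ <;> rw [h] <;> linarith
  set α := β ^ (-m) with hα
  set k := m * β ^ (-m - 1) with hk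
  have hk0 : 0 < k := by positivity
  have hα0 : 0 < α := by positivity
  have hWge : ∀ z, z ≠ 0 → ‖z‖ ≤ r →
      α - k * (inner ℝ p z - |inner ℝ d z| + ε * ‖z‖) ≤ W z := fun z hz hzr => by
    refine le_trans ?_ (rpow_neg_tangent_le hβ (hVpos z hz) hm0.le)
    have := mul_le_mul_of_nonneg_left (hVle z hz hzr) hk0.le
    rw [← hα, ← hk]
    linarith
  -- This is the largest `a` for which Cauchy-Schwarz gives `a⟨d,z⟩² ≤ k|⟨d,z⟩|` on `|z| = r`. Then
  -- `b` makes the quadratic part harmonic, and `b r² = -2krε` leaves room for `c = α + krε`.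
  set a := k / (‖d‖ * r) with ha
  have ha0 : 0 < a := by positivity
  set b := -(a * ‖d‖ ^ 2 / n) with hb
  set c := α + k * r * ε with hc
  have hbar : ∀ z, quadBarrier c a b 0 (-k • p) d z =
      c - k * inner ℝ p z + a * (inner ℝ d z) ^ 2 + b * ‖z‖ ^ 2 := fun z => by
    simp only [quadBarrier, inner_smul_left]
    simp
    ring
  have hbarδ : ∀ δ z, quadBarrier c a b δ (-k • p) d z =
      quadBarrier c a b 0 (-k • p) d z - δ * (‖z‖ ^ 2) ^ (-(1 / 4 : ℝ)) := fun δ z => by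
    simp only [quadBarrier]
    ring
  have hbr : b * r ^ 2 = - (2 * k * r * ε) := by
    rw [hb, ha, hε]
    field_simp
  have hsphere : ∀ z, ‖z‖ = r → quadBarrier c a b 0 (-k • p) d z ≤ W z := fun z hz => by
    have hz0 : z ≠ 0 := by
      rintro rfl
      rw [norm_zero] at hz
      linarith
    refine le_trans ?_ (hWge z hz0 hz.le)
    rw [hbar, hz, hbr, hc]
    have h1 : a * (inner ℝ d z) ^ 2 ≤ k * |inner ℝ d z| := by
      have h2 : |inner ℝ d z| ≤ ‖d‖ * r := hz ▸ abs_real_inner_le_norm d z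
      rw [ha, div_mul_eq_mul_div, div_le_iff₀ (by positivity), ← sq_abs]
      calc k * |inner ℝ d z| ^ 2 = k * |inner ℝ d z| * |inner ℝ d z| := by ring
        _ ≤ _ := mul_le_mul_of_nonneg_left h2 (by positivity)
    linarith
  have hcontbar : Continuous fun z => quadBarrier c a b 0 (-k • p) d z := by
    simp only [hbar]
    fun_prop
  have hcompare : ∀ z, z ≠ 0 → ‖z‖ ≤ r → quadBarrier c a b 0 (-k • p) d z ≤ W z := by
    intro z hz hzr
    have hz0 : 0 < ‖z‖ := norm_pos_iff.2 hz
    -- The term `-δ|z|^(-1/2)` is strictly subharmonic because `1/2 < n - 2`. It also pushes the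
    -- barrier below `0 ≤ W` on a small inner sphere, where nothing else is known about `W`; `δ → 0`
    -- removes it.
    have hδ : ∀ δ > 0, quadBarrier c a b δ (-k • p) d z ≤ W z := by
      intro δ hδ
      obtain ⟨M, hM⟩ := (isCompact_closedBall (0 : EuclideanSpace ℝ (Fin n))
        r).exists_bound_of_continuousOn hcontbar.continuousOn
      have hlim : Tendsto (fun ρ : ℝ => δ * (ρ ^ 2) ^ (-(1 / 4 : ℝ))) (𝓝[>] 0) atTop := by
        refine Tendsto.const_mul_atTop hδ ?_
        refine (tendsto_rpow_neg_nhdsGT_zero (by norm_num)).comp ?_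
        refine tendsto_nhdsWithin_iff.2 ⟨?_, ?_⟩
        · have : Tendsto (fun ρ : ℝ => ρ ^ 2) (𝓝 0) (𝓝 (0 ^ 2)) :=
            (continuous_pow 2).tendsto 0
          rw [zero_pow two_ne_zero] at this
          exact this.mono_left nhdsWithin_le_nhds
        · filter_upwards [self_mem_nhdsWithin] with ρ hρ
          have hρ : (0:ℝ) < ρ := hρ
          exact pow_pos hρ 2
      have hρz' : ∀ᶠ ρ in 𝓝[>] (0 : ℝ), ρ < ‖z‖ := nhdsWithin_le_nhds (gt_mem_nhds hz0)
      have hev := (hlim.eventually_ge_atTop M).and (hρz'.and self_mem_nhdsWithin)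
      obtain ⟨ρ, hρM, hρz, hρ0⟩ := hev.exists
      have hρ0 : (0:ℝ) < ρ := hρ0
      set K : Set (EuclideanSpace ℝ (Fin n)) := {x | ρ ≤ ‖x‖ ∧ ‖x‖ ≤ r} with hK
      have hKc : IsCompact K := by
        refine (isCompact_closedBall (0 : EuclideanSpace ℝ (Fin n)) r).of_isClosed_subset ?_ ?_
        · exact (isClosed_le continuous_const continuous_norm).inter
            (isClosed_le continuous_norm continuous_const)
        · intro x hx
          simpa using hx.2
      have hne : ∀ x ∈ K, x ≠ 0 := fun x hx h0 => by
        have := hx.1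
        rw [h0, norm_zero] at this
        linarith
      refine le_of_strictly_subharmonic hKc (fun x hx => ((hWcd x (hne x hx)).sub
        (contDiffAt_quadBarrier c a b δ _ d (hne x hx))).continuousAt.continuousWithinAt)
        (fun x hx => ?_) z ⟨hρz.le, hzr⟩
      have hx0 := hne x hx
      have hxp : 0 < ‖x‖ := norm_pos_iff.2 hx0
      rcases hx.1.eq_or_lt with h1 | h1
      · left
        refine le_trans ?_ (Real.rpow_nonneg (hVpos x hx0).le _)
        have := hM x (by simpa using hx.2)
        rw [Real.norm_eq_abs] at this
        rw [hbarδ, ← h1]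
        have := (abs_le.1 this).2
        linarith
      rcases hx.2.eq_or_lt with h2 | h2
      · left
        refine le_trans ?_ (hsphere x h2)
        rw [hbarδ]
        have : 0 ≤ δ * (‖x‖ ^ 2) ^ (-(1 / 4 : ℝ)) := by positivity
        linarith
      right
      refine ⟨?_, hWcd x hx0, contDiffAt_quadBarrier c a b δ _ d hx0, hWlap x hx0, ?_⟩
      · have e1 : ∀ᶠ x' in 𝓝 x, ρ < ‖x'‖ := continuous_norm.continuousAt.eventually_const_lt h1
        have e2 : ∀ᶠ x' in 𝓝 x, ‖x'‖ < r := continuous_norm.continuousAt.eventually_lt_const h2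
        filter_upwards [e1, e2] with x' h1' h2' using ⟨h1'.le, h2'.le⟩
      · rw [laplacian_quadBarrier c a b δ _ d hx0]
        have hcancel : 2 * a * ‖d‖ ^ 2 + 2 * n * b = 0 := by
          rw [hb]
          field_simp
          ring
        rw [hcancel]
        have : 0 < δ * (1 / 2 * ((n : ℝ) - 5 / 2) * (‖x‖ ^ 2) ^ (-(1 / 4 : ℝ) - 1)) := by
          have : (0:ℝ) < n - 5 / 2 := by linarith
          positivity
        linarith
    have ht : Tendsto (fun δ : ℝ => quadBarrier c a b δ (-k • p) d z) (𝓝[>] 0)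
        (𝓝 (quadBarrier c a b 0 (-k • p) d z)) := by
      have hcδ : Continuous fun δ : ℝ => quadBarrier c a b δ (-k • p) d z := by
        unfold quadBarrier
        fun_prop
      exact (hcδ.tendsto 0).mono_left nhdsWithin_le_nhds
    refine le_of_tendsto ht ?_
    filter_upwards [self_mem_nhdsWithin] with δ h using hδ δ h
  have hcα : α < c := by
    rw [hc, lt_add_iff_pos_right]
    positivity
  set γ := (α + c) / 2 with hγ
  have hγα : α < γ := by rw [hγ]; linarith
  have hγc : γ < c := by rw [hγ]; linarith
  have hnear : ∀ᶠ z in 𝓝 (0 : EuclideanSpace ℝ (Fin n)),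
      γ < quadBarrier c a b 0 (-k • p) d z := by
    refine hcontbar.continuousAt.eventually_const_lt ?_
    change γ < quadBarrier c a b 0 (-k • p) d 0
    rw [hbar]
    simpa using hγc
  obtain ⟨ρ, hρ, hball⟩ := Metric.eventually_nhds_iff_ball.1 hnear
  have hγ0 : 0 < γ := hα0.trans hγα
  refine ⟨γ ^ (-m⁻¹), ?_, max R (1 / ρ), fun y hy => ?_⟩
  · have : β = α ^ (-m⁻¹) := by
      rw [hα, ← Real.rpow_mul hβ.le]
      field_simp
      simp
    conv_rhs => rw [this]
    exact Real.rpow_lt_rpow_of_neg hα0 hγα (by rw [neg_lt_zero]; positivity)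
  · have hyR : R < ‖y‖ := (le_max_left _ _).trans_lt hy
    have hyρ : 1 / ρ < ‖y‖ := (le_max_right _ _).trans_lt hy
    have hy0 : 0 < ‖y‖ := hR0.trans hyR
    have hyne : y ≠ 0 := norm_pos_iff.1 hy0
    set z := inv0 1 y with hz
    have hzn : ‖z‖ = 1 / ‖y‖ := norm_inv0 zero_le_one y
    have hz0 : 0 < ‖z‖ := by rw [hzn]; positivity
    have hzne : z ≠ 0 := norm_pos_iff.1 hz0
    have hzr : ‖z‖ ≤ r := by
      rw [hzn, hr]
      exact one_div_le_one_div_of_le hR0 hyR.le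
    have hzρ : z ∈ Metric.ball (0 : EuclideanSpace ℝ (Fin n)) ρ := by
      rw [mem_ball_zero_iff, hzn, div_lt_iff₀ hy0]
      rw [div_lt_iff₀ hρ] at hyρ
      linarith
    have hWγ : γ ≤ W z := (hball z hzρ).le.trans (hcompare z hzne hzr)
    have hinv : inv0 1 z = y := by
      rw [inv0, hzn, hz, inv0, smul_smul]
      have : 1 / (1 / ‖y‖) ^ 2 * (1 / ‖y‖ ^ 2) = 1 := by field_simp
      rw [this, one_smul]
    have hVz : V z = v y / ‖y‖ ^ 2 := by
      rw [hV, kelvin, hinv, hzn]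
      field_simp
    have hVle' : V z ≤ γ ^ (-m⁻¹) := by
      have h1 : V z = W z ^ (-m⁻¹) := by
        rw [hW]
        simp only
        rw [← Real.rpow_mul (hVpos z hzne).le]
        field_simp
        simp
      rw [h1]
      exact Real.rpow_le_rpow_of_nonpos hγ0 hWγ (by rw [neg_nonpos]; positivity)
    rw [hVz, div_le_iff₀ (by positivity)] at hVle'
    exact hVle'

end Superharmonic

/-! ### Asymptotics at infinity and the form of `v`. -/

section Classification

variable {n : ℕ} {U : Set (SymMat n)} {F : SymMat n → ℝ} {q : ℝ}
  {v : EuclideanSpace ℝ (Fin n) → ℝ}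

theorem jetAt_comp_const_add (v : EuclideanSpace ℝ (Fin n) → ℝ) (x y : EuclideanSpace ℝ (Fin n)) :
    jetAt (fun y => v (x + y)) y = jetAt v (x + y) := by
  rw [jetAt, jetAt, fderiv_comp_const_add, fderiv_fderiv_comp_const_add]

theorem IsEntireSolution.comp_const_add (hv : IsEntireSolution U F q v)
    (x : EuclideanSpace ℝ (Fin n)) : IsEntireSolution U F q (fun y => v (x + y)) where
  contDiff := hv.contDiff.comp (contDiff_const.add contDiff_id)
  pos := fun y => hv.pos _
  mem := fun y => by
    rw [jetAt_comp_const_add]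
    exact hv.mem _
  eq := fun y => by
    rw [jetAt_comp_const_add]
    exact hv.eq _
  growth := by
    obtain ⟨C, hC⟩ := hv.growth
    have hC0 : 0 < C := by
      have h1 := (hv.pos 0).trans_le (hC 0)
      simpa using h1
    refine ⟨C * (1 + 2 * ‖x‖ ^ 2 + 2), fun y => (hC _).trans ?_⟩
    rw [mul_assoc]
    refine mul_le_mul_of_nonneg_left ?_ hC0.le
    have h1 : ‖x + y‖ ^ 2 ≤ (‖x‖ + ‖y‖) ^ 2 :=
      pow_le_pow_left₀ (norm_nonneg _) (norm_add_le _ _) 2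
    nlinarith [sq_nonneg (‖x‖ - ‖y‖), mul_nonneg (sq_nonneg ‖x‖) (sq_nonneg ‖y‖),
      sq_nonneg ‖y‖]

/-- With `z = y - x`, the bound by the transform involves `v` at `x` plus the inverse of `z`, which
tends to `x`. The first-order expansion there gives `β|z|² + ⟨∇v(x),z⟩ + o(|z|)`; expanding `|y -
x|²` produces the shift `-2βx`. -/
theorem BelowKelvin.exists_le_quadratic {x : EuclideanSpace ℝ (Fin n)} {L : ℝ} (hL : 0 < L)
    (hd : DifferentiableAt ℝ v x) (h : BelowKelvin L (fun y => v (x + y))) :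
    ∀ ε > 0, ∃ R, ∀ y, R < ‖y‖ → v y ≤ v x / L * ‖y‖ ^ 2
      + inner ℝ (gradient v x - (2 * (v x / L)) • x) y + ε * ‖y‖ := by
  intro ε hε
  set β := v x / L with hβ
  set g := gradient v x with hg
  have hlin : ∀ᶠ w in 𝓝 (0 : EuclideanSpace ℝ (Fin n)),
      v (x + w) ≤ v x + inner ℝ g w + ε / 2 * ‖w‖ := by
    have h1 := hd.hasGradientAt.hasFDerivAt.isLittleO
    have h2 := h1.def (half_pos hε)
    have h3 : Tendsto (fun w => x + w) (𝓝 0) (𝓝 x) := by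
      have : Continuous fun w => x + w := by fun_prop
      simpa using this.tendsto 0
    filter_upwards [h3.eventually h2] with w hw
    simp only [add_sub_cancel_left, InnerProductSpace.toDual_apply_apply, Real.norm_eq_abs] at hw
    have := (abs_le.1 hw).2
    linarith
  obtain ⟨δ, hδ, hball⟩ := Metric.eventually_nhds_iff_ball.1 hlin
  set K := β * ‖x‖ ^ 2 - inner ℝ g x + ε / 2 * ‖x‖ with hK
  refine ⟨max 0 (max (‖x‖ + (L / δ + L + 1)) (2 / ε * K)), fun y hy => ?_⟩
  have hy1 : ‖x‖ + (L / δ + L + 1) < ‖y‖ :=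
    (le_max_left _ _).trans_lt ((le_max_right _ _).trans_lt hy)
  have hy2 : 2 / ε * K < ‖y‖ := (le_max_right _ _).trans_lt ((le_max_right _ _).trans_lt hy)
  have hLδ : 0 < L / δ := by positivity
  set z := y - x with hz
  have hzn : L / δ + L + 1 < ‖z‖ := by
    have := norm_sub_norm_le y x
    linarith
  have hz0 : 0 < ‖z‖ := by linarith
  have hLz : L ≤ ‖z‖ ^ 2 := by nlinarith
  have h1 : v y ≤ ‖z‖ ^ 2 / L * v (x + inv0 L z) := by
    have := h z hLz
    simpa [kelvin, hz] using this
  have h2 : v (x + inv0 L z) ≤ v x + inner ℝ g (inv0 L z) + ε / 2 * ‖inv0 L z‖ := by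
    refine hball _ ?_
    rw [mem_ball_zero_iff, norm_inv0 hL.le, div_lt_iff₀ hz0]
    have : L / δ < ‖z‖ := by linarith
    rw [div_lt_iff₀ hδ] at this
    linarith
  have h3 : ‖z‖ ^ 2 / L * (v x + inner ℝ g (inv0 L z) + ε / 2 * ‖inv0 L z‖)
      = β * ‖z‖ ^ 2 + inner ℝ g z + ε / 2 * ‖z‖ := by
    rw [norm_inv0 hL.le, inv0, inner_smul_right, hβ]
    field_simp
  have h4 : ‖z‖ ^ 2 = ‖y‖ ^ 2 - 2 * inner ℝ x y + ‖x‖ ^ 2 := by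
    rw [hz, norm_sub_sq_real, real_inner_comm]
  have h5 : ‖z‖ ≤ ‖y‖ + ‖x‖ := norm_sub_le _ _
  have h6 : K < ε / 2 * ‖y‖ := by
    rw [div_mul_eq_mul_div, div_lt_iff₀ hε] at hy2
    linarith
  have h7 := h1.trans (mul_le_mul_of_nonneg_left h2 (by positivity : 0 ≤ ‖z‖ ^ 2 / L))
  have h8 := mul_le_mul_of_nonneg_left h5 (half_pos hε).le
  rw [h3, h4] at h7
  have h9 : inner ℝ g z = inner ℝ g y - inner ℝ g x := inner_sub_right _ _ _
  rw [inner_sub_left, real_inner_smul_left]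
  linarith

theorem BelowKelvin.exists_le_sq {x : EuclideanSpace ℝ (Fin n)} {L : ℝ} (hL : 0 < L)
    (hd : DifferentiableAt ℝ v x) (h : BelowKelvin L (fun y => v (x + y))) :
    ∀ b > v x / L, ∃ R, ∀ y, R < ‖y‖ → v y ≤ b * ‖y‖ ^ 2 := by
  intro b hb
  obtain ⟨R, hR⟩ := h.exists_le_quadratic hL hd 1 one_pos
  set ξ := gradient v x - (2 * (v x / L)) • x with hξ
  refine ⟨max R ((‖ξ‖ + 1) / (b - v x / L)), fun y hy => ?_⟩
  have hy1 := hR y ((le_max_left _ _).trans_lt hy)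
  have hy2 := (le_max_right _ _).trans_lt hy
  rw [div_lt_iff₀ (sub_pos.2 hb)] at hy2
  have h1 := real_inner_le_norm ξ y
  have h2 := mul_le_mul_of_nonneg_left hy2.le (norm_nonneg y)
  nlinarith

/-- Take spheres with centre far out on the line through `y` and `z`, beyond `z`, for which the two
points are inverse to each other. The Kelvin factor tends to `1` as the centre recedes. -/
theorem eq_of_forall_belowKelvin
    (h : ∀ x L, 0 < L → BelowKelvin L (fun y => v (x + y))) (y z : EuclideanSpace ℝ (Fin n)) :
    v y ≤ v z := by
  rcases eq_or_ne y z with rfl | hne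
  · exact le_rfl
  set w := z - y with hw
  have hw0 : 0 < ‖w‖ := norm_pos_iff.2 (sub_ne_zero.2 hne.symm)
  have key : ∀ R : ℝ, 0 < R → v y ≤ (1 + R⁻¹) * v z := fun R hR => by
    -- From this centre `z` and `y` are at distances `R‖w‖` and `(R+1)‖w‖`; the product is the
    -- squared radius that exchanges them.
    have h1 := h (z + R • w) (R * (R + 1) * ‖w‖ ^ 2) (by positivity) (-(R + 1) • w) (by
      rw [norm_smul, Real.norm_eq_abs, abs_neg, abs_of_pos (by positivity), mul_pow]
      refine mul_le_mul_of_nonneg_right ?_ (by positivity)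
      nlinarith)
    have hn2 : ‖-(R + 1) • w‖ ^ 2 = (R + 1) ^ 2 * ‖w‖ ^ 2 := by
      rw [norm_smul, Real.norm_eq_abs, abs_neg, abs_of_pos (by positivity), mul_pow]
    rw [kelvin, inv0, hn2] at h1
    have e1 : z + R • w + -(R + 1) • w = y := by
      rw [hw]; module
    have e2 : (R * (R + 1) * ‖w‖ ^ 2 / ((R + 1) ^ 2 * ‖w‖ ^ 2)) • -(R + 1) • w = -R • w := by
      rw [smul_smul]
      congr 1
      field_simp
    have e3 : z + R • w + -R • w = z := by module
    have e4 : (R + 1) ^ 2 * ‖w‖ ^ 2 / (R * (R + 1) * ‖w‖ ^ 2) = 1 + R⁻¹ := by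
      field_simp
    simpa only [e1, e2, e3, e4] using h1
  have hlim : Tendsto (fun R : ℝ => (1 + R⁻¹) * v z) atTop (𝓝 ((1 + 0) * v z)) :=
    (tendsto_inv_atTop_zero.const_add 1).mul_const _
  rw [add_zero, one_mul] at hlim
  refine ge_of_tendsto hlim ?_
  filter_upwards [eventually_gt_atTop 0] with R hR using key R hR

/-- `limsup v/|y|²` does not depend on the origin: raising `b` to `b'` leaves a margin quadratic in
`|z|` that absorbs the lower-order terms of `|x + z|²`. -/
theorem frequently_lt_of_translate {x : EuclideanSpace ℝ (Fin n)} {β : ℝ}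
    (hβ : 0 < β)
    (h : ∀ b < β, ∀ R, ∃ y : EuclideanSpace ℝ (Fin n), R < ‖y‖ ∧ b * ‖y‖ ^ 2 < v (x + y)) :
    ∀ b < β, ∀ R, ∃ y : EuclideanSpace ℝ (Fin n), R < ‖y‖ ∧ b * ‖y‖ ^ 2 < v y := by
  intro b hb R
  set c := max b 0 with hc
  have hc0 : 0 ≤ c := le_max_right _ _
  have hcβ : c < β := max_lt hb hβ
  set k := ‖x‖ with hk
  have hk0 : 0 ≤ k := norm_nonneg x
  set b' := (c + β) / 2 with hb'
  have hcb : c < b' := by rw [hb']; linarith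
  obtain ⟨z, hz, hvz⟩ := h b' (by rw [hb']; linarith)
    (max (R + k) (max 1 ((2 * c * k + c * k ^ 2) / (b' - c))))
  have hz1 := (le_max_left _ _).trans_lt hz
  have hz2 := (le_max_left _ _).trans_lt ((le_max_right _ _).trans_lt hz)
  have hz3 := (le_max_right _ _).trans_lt ((le_max_right _ _).trans_lt hz)
  rw [div_lt_iff₀ (sub_pos.2 hcb)] at hz3
  refine ⟨x + z, ?_, lt_of_le_of_lt ?_ hvz⟩
  · have h1 := norm_sub_le (x + z) x
    rw [add_sub_cancel_left] at h1
    linarith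
  · have h1 : ‖x + z‖ ^ 2 ≤ (k + ‖z‖) ^ 2 :=
      pow_le_pow_left₀ (norm_nonneg _) (norm_add_le _ _) 2
    have h2 : b * ‖x + z‖ ^ 2 ≤ c * ‖x + z‖ ^ 2 :=
      mul_le_mul_of_nonneg_right (le_max_left _ _) (by positivity)
    have h3 := mul_le_mul_of_nonneg_left h1 hc0
    have h4 := mul_le_mul_of_nonneg_right hz3.le (norm_nonneg z)
    have h5 : c * k ^ 2 * 1 ≤ c * k ^ 2 * ‖z‖ :=
      mul_le_mul_of_nonneg_left hz2.le (by positivity)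
    nlinarith

theorem le_of_frequently_lt {β β' : ℝ}
    (h : ∀ b < β, ∀ R, ∃ y : EuclideanSpace ℝ (Fin n), R < ‖y‖ ∧ b * ‖y‖ ^ 2 < v y)
    (h' : ∀ b > β', ∃ R, ∀ y : EuclideanSpace ℝ (Fin n), R < ‖y‖ → v y ≤ b * ‖y‖ ^ 2) :
    β ≤ β' := by
  by_contra! hlt
  obtain ⟨R, hR⟩ := h' ((β + β') / 2) (by linarith)
  obtain ⟨y, hy, hvy⟩ := h ((β + β') / 2) (by linarith) R
  exact absurd (hR y hy) (not_le.2 hvy)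

/-- With `z = -ξ/(2β)`, the function `v - β|x - z|²` has zero derivative. -/
theorem eq_quadratic_of_gradient (hd : Differentiable ℝ v) {β : ℝ} (hβ : β ≠ 0)
    {ξ : EuclideanSpace ℝ (Fin n)} (h : ∀ x, gradient v x - (2 * β) • x = ξ) :
    ∃ z, ∀ x, v x = v z + β * ‖x - z‖ ^ 2 := by
  refine ⟨-(2 * β)⁻¹ • ξ, fun x => ?_⟩
  set z := -(2 * β)⁻¹ • ξ with hz
  have hξ : ξ = -(2 * β) • z := by
    rw [hz, smul_smul]
    rw [neg_mul_neg, mul_inv_cancel₀ (by simpa using hβ), one_smul]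
  set w : EuclideanSpace ℝ (Fin n) → ℝ := fun x => v x - β * ‖x - z‖ ^ 2 with hw
  have hnd : ∀ x, DifferentiableAt ℝ (fun x => ‖x - z‖ ^ 2) x := fun x =>
    (contDiffAt_norm_sub_sq z x).differentiableAt (by norm_num)
  have hwd : Differentiable ℝ w := fun x => (hd x).sub ((hnd x).const_mul β)
  have hw0 : ∀ x, fderiv ℝ w x = 0 := fun x => by
    ext e
    rw [hw, fderiv_fun_sub (hd x) ((hnd x).const_mul β), fderiv_const_mul (hnd x)]
    have h1 : fderiv ℝ v x e = inner ℝ (gradient v x) e := by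
      rw [(hd x).hasGradientAt.hasFDerivAt.fderiv, InnerProductSpace.toDual_apply_apply]
    have h2 : gradient v x = (2 * β) • (x - z) := by
      have := h x
      rw [hξ, sub_eq_iff_eq_add] at this
      rw [this]
      module
    simp only [sub_apply, smul_apply, smul_eq_mul,
      (fderiv_norm_sub_sq z x).1, h1, h2, real_inner_smul_left, zero_apply]
    ring
  have hc := is_const_of_fderiv_eq_zero hwd hw0 x z
  simp only [hw, sub_self, norm_zero] at hc
  linarith

/-- Once the spheres stop about one centre, `limsup v/|y|² = β > 0` holds globally. This forces them
to stop about every centre at `L = v(x)/β`, and the upper bounds at infinity from different centres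
must then have the same linear part. -/
theorem IsEntireSolution.eq_const_or_quadratic (hn : 3 ≤ n) (hE : EllipticOperator U F)
    (hv : IsEntireSolution U F q v) (hq : 0 ≤ q)
    (htr : ∀ y, 0 ≤ (confJet (jetAt v y) : Matrix (Fin n) (Fin n) ℝ).trace) :
    (∃ c, ∀ x, v x = c) ∨ ∃ z, ∃ β > 0, ∀ x, v x = v z + β * ‖x - z‖ ^ 2 := by
  have hd : Differentiable ℝ v := hv.contDiff.differentiable (by norm_num)
  have hms := fun x => (hv.comp_const_add x).moving_spheres hE hq
  simp only [add_zero] at hms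
  by_cases hall : ∀ x L, 0 < L → BelowKelvin L (fun y => v (x + y))
  · exact Or.inl ⟨v 0, fun x => le_antisymm (eq_of_forall_belowKelvin hall _ _)
      (eq_of_forall_belowKelvin hall _ _)⟩
  right
  push Not at hall
  obtain ⟨x₀, L', hL', hnot⟩ := hall
  rcases hms x₀ with h | ⟨L₀, hL₀, hB₀, hfr₀⟩
  · exact absurd (h L' hL') hnot
  set β := v x₀ / L₀ with hβdef
  have hβ : 0 < β := div_pos (hv.pos _) hL₀
  have hfr := frequently_lt_of_translate hβ hfr₀
  have hx : ∀ x, ∃ L > 0, BelowKelvin L (fun y => v (x + y)) ∧ v x / L = β := fun x => by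
    rcases hms x with h | ⟨L, hL, hB, hf⟩
    · exfalso
      have hvx := hv.pos x
      -- Were no sphere about `x` to stop, the one with this `L` would bound the limsup by `β/2`.
      have hL : 0 < 2 * v x / β := by positivity
      have h1 := le_of_frequently_lt hfr ((h _ hL).exists_le_sq hL (hd x))
      have h2 : v x / (2 * v x / β) = β / 2 := by field_simp
      linarith
    · refine ⟨L, hL, hB, le_antisymm ?_ (le_of_frequently_lt hfr (hB.exists_le_sq hL (hd x)))⟩
      refine le_of_frequently_lt (frequently_lt_of_translate (div_pos (hv.pos x) hL) hf) ?_
      exact hB₀.exists_le_sq hL₀ (hd x₀)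
  have hup : ∀ x, ∀ ε > 0, ∃ R, ∀ y, R < ‖y‖ → v y ≤ β * ‖y‖ ^ 2
      + inner ℝ (gradient v x - (2 * β) • x) y + ε * ‖y‖ := fun x => by
    obtain ⟨L, hL, hB, hLβ⟩ := hx x
    rw [← hLβ]
    exact hB.exists_le_quadratic hL (hd x)
  have hξ : ∀ x, gradient v x - (2 * β) • x = gradient v 0 - (2 * β) • 0 := fun x => by
    by_contra hne
    obtain ⟨b, hb, R, hR⟩ :=
      exists_gap_of_two_upper_bounds hn hv.contDiff hv.pos htr hβ hne (hup x) (hup 0)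
    obtain ⟨y, hy, hvy⟩ := hfr b hb R
    exact absurd (hR y hy) (not_le.2 hvy)
  obtain ⟨z, hz⟩ := eq_quadratic_of_gradient hd hβ.ne' hξ
  exact ⟨z, β, hβ, hz⟩

theorem confJet_quadratic (c β : ℝ) (z x : EuclideanSpace ℝ (Fin n)) :
    confJet (jetAt (fun x => c + β * ‖x - z‖ ^ 2) x) = (2 * β * c) • SymMat.id n := by
  have h := fderiv_radial z x (g := fun t => c + β * t) (g' := fun _ => β) (g'' := 0)
    (Eventually.of_forall fun t => by simpa using ((hasDerivAt_id t).const_mul β).const_add c)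
    (hasDerivAt_const _ _)
  have hs := sum_sq_apply_single (fderiv ℝ (fun x => c + β * ‖x - z‖ ^ 2) x) ((2 * β) • (x - z))
    fun e => by rw [h.1, real_inner_smul_left]; ring
  apply Subtype.ext
  ext i j
  rw [confJet_apply]
  simp only [jetAt, Jet.val_mk, Jet.der_mk, Jet.hess_mk, hs, h.2]
  rw [norm_smul, mul_pow, Real.norm_eq_abs, sq_abs]
  simp [SymMat.id, Matrix.one_apply, EuclideanSpace.inner_single_right]
  by_cases hij : i = j
  · simp [hij]
    ring
  · simp [hij, Ne.symm hij]

theorem EllipticOperator.of_conj_image_eq (hUopen : IsOpen U)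
    (hUinv : ∀ O : Matrix.orthogonalGroup (Fin n) ℝ, SymMat.conj O '' U = U)
    (hUconv : ConvexInPosDir U) (hF : ContDiffOn ℝ 2 F U)
    (hFinv : ∀ O : Matrix.orthogonalGroup (Fin n) ℝ, ∀ M ∈ U, F (SymMat.conj O M) = F M)
    (hFell : ∀ M ∈ U, (SymMat.grad F M).PosDef) : EllipticOperator U F where
  isOpen := hUopen
  conj_mem O _ hM := hUinv O ▸ Set.mem_image_of_mem _ hM
  convex := hUconv
  contDiffOn := hF
  conj_eq := hFinv
  posDef := hFell

/-- Raising `u ≥ c|y|^(2-n)` to the power `-2/(n-2)` reverses it into `v ≤ C|y|²` outside the unit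
ball. -/
theorem exists_growth_bound (hn : 3 ≤ n) (hv : Continuous v) (hpos : ∀ y, 0 < v y)
    {c : ℝ} (hc : 0 < c) (h : ∀ y : EuclideanSpace ℝ (Fin n), 1 ≤ ‖y‖ →
      c * (‖y‖ ^ 2) ^ (-(((n : ℝ) - 2) / 2)) ≤ v y ^ (-(((n : ℝ) - 2) / 2))) :
    ∃ C, ∀ y, v y ≤ C * (1 + ‖y‖ ^ 2) := by
  have hn' : (3 : ℝ) ≤ n := by exact_mod_cast hn
  set m := ((n : ℝ) - 2) / 2 with hm
  have hm0 : 0 < m := by rw [hm]; linarith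
  obtain ⟨K, hK⟩ := (isCompact_closedBall (0 : EuclideanSpace ℝ (Fin n))
    1).exists_bound_of_continuousOn hv.continuousOn
  have hC0 : 0 < c ^ (-m⁻¹) := by positivity
  refine ⟨max K (c ^ (-m⁻¹)), fun y => ?_⟩
  rcases le_total ‖y‖ 1 with hy | hy
  · have h1 := hK y (by simpa using hy)
    rw [Real.norm_of_nonneg (hpos y).le] at h1
    have h2 : 0 ≤ max K (c ^ (-m⁻¹)) := hC0.le.trans (le_max_right _ _)
    calc v y ≤ max K (c ^ (-m⁻¹)) * 1 := by rw [mul_one]; exact h1.trans (le_max_left _ _)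
      _ ≤ _ := mul_le_mul_of_nonneg_left (by linarith [sq_nonneg ‖y‖]) h2
  · have hy2 : 0 < ‖y‖ ^ 2 := by positivity
    have h1 := Real.rpow_le_rpow_of_nonpos (by positivity) (h y hy)
      (by rw [neg_nonpos]; positivity : -m⁻¹ ≤ 0)
    have hmm : -m * -m⁻¹ = 1 := by field_simp
    rw [← Real.rpow_mul (hpos y).le, hmm, Real.rpow_one,
      Real.mul_rpow hc.le (by positivity), ← Real.rpow_mul hy2.le, hmm, Real.rpow_one] at h1
    calc v y ≤ c ^ (-m⁻¹) * ‖y‖ ^ 2 := h1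
      _ ≤ max K (c ^ (-m⁻¹)) * (1 + ‖y‖ ^ 2) := mul_le_mul (le_max_right _ _) (by linarith) hy2.le
        (hC0.le.trans (le_max_right _ _))

end Classification

/-! ### The theorem. -/

theorem theorem1 (n : ℕ) (hn : 3 ≤ n)
    (U : Set (SymMat n)) (hUopen : IsOpen U)
    (hUinv : ∀ O : Matrix.orthogonalGroup (Fin n) ℝ, SymMat.conj O '' U = U)
    (hUconv : ∀ M N : SymMat n, (N : Matrix (Fin n) (Fin n) ℝ).PosDef →
      Convex ℝ (U ∩ {X : SymMat n | ∃ t : ℝ, 0 < t ∧ X = M + t • N}))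
    (F : SymMat n → ℝ) (hF : ContDiffOn ℝ 2 F U)
    (hFinv : ∀ O : Matrix.orthogonalGroup (Fin n) ℝ, ∀ M ∈ U, F (SymMat.conj O M) = F M)
    (hFell : ∀ M ∈ U, (SymMat.grad F M).PosDef)
    (p : ℝ) (hp : p ≤ ((n : ℝ) + 2) / ((n : ℝ) - 2))
    (u : EuclideanSpace ℝ (Fin n) → ℝ) (hu : ContDiff ℝ 2 u)
    (hupos : ∀ x, 0 < u x)
    (husuper : ∀ x, Laplacian.laplacian u x ≤ 0)
    (huU : ∀ x, conformalHessian u x hu.contDiffAt ∈ U)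
    (hueq : ∀ x, F (conformalHessian u x hu.contDiffAt)
      = u x ^ (p - ((n : ℝ) + 2) / ((n : ℝ) - 2))) :
    (∃ c : ℝ, ∀ x, u x = c) ∨
    (p = ((n : ℝ) + 2) / ((n : ℝ) - 2) ∧
      ∃ (xbar : EuclideanSpace ℝ (Fin n)) (a b : ℝ), 0 < a ∧ 0 < b ∧
        (2 * b ^ 2 * (a ^ 2)⁻¹) • SymMat.id n ∈ U ∧
        F ((2 * b ^ 2 * (a ^ 2)⁻¹) • SymMat.id n) = 1 ∧
        ∀ x, u x = (a / (1 + b ^ 2 * ‖x - xbar‖ ^ 2)) ^ (((n : ℝ) - 2) / 2)) := by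
  have hn' : (3 : ℝ) ≤ n := by exact_mod_cast hn
  set m := ((n : ℝ) - 2) / 2 with hm
  have hm0 : 0 < m := by rw [hm]; linarith
  set κ := ((n : ℝ) + 2) / ((n : ℝ) - 2) with hκ
  set v : EuclideanSpace ℝ (Fin n) → ℝ := fun x => u x ^ (-m⁻¹) with hvdef
  have hvpos : ∀ x, 0 < v x := fun x => Real.rpow_pos_of_pos (hupos x) _
  have hvcd : ContDiff ℝ 2 v := hu.rpow_const_of_ne fun x => (hupos x).ne'
  have huv : u = fun x => v x ^ (-m) := by
    ext x
    rw [hvdef, ← Real.rpow_mul (hupos x).le]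
    field_simp
    simp
  have hconf : ∀ x, conformalHessian u x hu.contDiffAt = confJet (jetAt v x) := fun x => by
    apply Subtype.ext
    rw [conformalHessian]
    simp only [huv]
    exact conformalHessianMatrix_rpow hn hvcd.contDiffAt (hvpos x)
  have htr : ∀ y, 0 ≤ (confJet (jetAt v y) : Matrix (Fin n) (Fin n) ℝ).trace := fun y => by
    have h1 := husuper y
    rw [huv, laplacian_rpow_neg hvcd.contDiffAt (hvpos y), ← hm] at h1
    have h2 : 0 < m * v y ^ (-m - 2) := mul_pos hm0 (Real.rpow_pos_of_pos (hvpos y) _)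
    by_contra! h3
    have := mul_neg_of_pos_of_neg h2 h3
    linarith
  obtain ⟨c, hc, hlow⟩ := exists_lower_bound_of_superharmonic hn hu hupos husuper
  have hq : 0 ≤ m * (κ - p) := mul_nonneg hm0.le (sub_nonneg.2 hp)
  -- Since `u = v ^ (-m)`, the right side `u ^ (p - κ)` is `v ^ (m(κ - p))`, with nonnegative
  -- exponent.
  have hsol : IsEntireSolution U F (m * (κ - p)) v :=
    { contDiff := hvcd
      pos := hvpos
      mem := fun y => hconf y ▸ huU y
      eq := fun y => by
        rw [← hconf y, hueq y, huv, ← Real.rpow_mul (hvpos y).le]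
        congr 1
        ring
      growth := exists_growth_bound hn hvcd.continuous hvpos hc fun y hy => by
        have := hlow y hy
        rwa [huv] at this }
  have hE := EllipticOperator.of_conj_image_eq hUopen hUinv hUconv hF hFinv hFell
  rcases hsol.eq_const_or_quadratic hn hE hq htr with ⟨c, hc⟩ | ⟨z, β, hβ, hquad⟩
  · left
    refine ⟨c ^ (-m), fun x => ?_⟩
    rw [huv]
    simp only [hc]
  right
  set d := v z with hd
  have hd0 : 0 < d := hvpos z
  have hvfun : v = fun x => d + β * ‖x - z‖ ^ 2 := funext hquad
  have hconst : ∀ x, confJet (jetAt v x) = (2 * β * d) • SymMat.id n := fun x => by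
    rw [hvfun]
    exact confJet_quadratic d β z x
  have hFc : ∀ x, F ((2 * β * d) • SymMat.id n) = v x ^ (m * (κ - p)) := fun x => by
    rw [← hconst x]
    exact hsol.eq x
  -- `F(A[v])` is constant, so a positive exponent would give `v` equal values at `z` and at
  -- distance `1` from `z`, where they are `d` and `d + β`.
  have hpκ : m * (κ - p) = 0 := by
    by_contra hne
    have hlt : 0 < m * (κ - p) := lt_of_le_of_ne hq (Ne.symm hne)
    have i : Fin n := ⟨0, by omega⟩
    have h1 : v (z + EuclideanSpace.single i 1) = d + β := by
      rw [hvfun]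
      simp
    have h2 := Real.rpow_lt_rpow hd0.le (lt_add_of_pos_right d hβ) hlt
    rw [← h1, ← hFc, hd, ← hFc] at h2
    exact lt_irrefl _ h2
  have hbsq : √(β / d) ^ 2 = β / d := Real.sq_sqrt (by positivity)
  have hcoef : 2 * √(β / d) ^ 2 * ((1 / d) ^ 2)⁻¹ = 2 * β * d := by
    rw [hbsq]
    field_simp
  -- From `v = d(1 + (β/d)|x - z|²)` one reads off `a = 1/d` and `b² = β/d`, so that `2b²/a² = 2βd`,
  -- the multiple of the identity found above.
  refine ⟨?_, z, 1 / d, √(β / d), by positivity, by positivity, ?_, ?_, fun x => ?_⟩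
  · rcases mul_eq_zero.1 hpκ with h | h
    · exact absurd h hm0.ne'
    · linarith
  · rw [hcoef, ← hconst 0]
    exact hsol.mem 0
  · rw [hcoef, hFc 0, hpκ, Real.rpow_zero]
  · have h1 : 1 / d / (1 + √(β / d) ^ 2 * ‖x - z‖ ^ 2) = (v x)⁻¹ := by
      have : 0 < d + β * ‖x - z‖ ^ 2 := by positivity
      rw [hbsq, hvfun]
      field_simp
    rw [h1, Real.inv_rpow (hvpos x).le, ← Real.rpow_neg (hvpos x).le, huv]
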